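/- Let $d\in\mathbb N$, $K>0$, and let $V:\mathbb R^d\to\mathbb R$ be a measurable potential for which $H^1(\mathbb R^d)$ is the finite energy space, i.e. there are constants $C,b\in\mathbb R$ and $c>0$ such that for every $u\in H^1(\mathbb R^d;\mathbb C)$ the function $V|u|^2$ is integrable and $$\int|V||u|^2\,dx\le C\|u\|_{H^1}^2,\qquad c\|u\|_{H^1}^2\le \tfrac12\|\nabla u\|_{L^2}^2+\int V|u|^2\,dx+b\|u\|_{L^2}^2$$ (for example any $V\in L^p(\mathbb R^d)+L^\infty(\mathbb R^d)$ with $p\ge1$, $p>d/2$). Write $\langle f,g\rangle=\int\bar f g\,dx$. Let $\psi_1^0,\psi_2^0\in H^1(\mathbb R^d;\mathbb C)$ satisfy $\|\psi_1^0\|_{L^2}=\|\psi_2^0\|_{L^2}=1$ and $\langle\psi_1^0,\psi_2^0\rangle\ne-1$, and let $(\psi_1,\psi_2)\in C([0,\infty);H^1)$ be a solution, with initial data $(\psi_1^0,\psi_2^0)$, of the Schrödinger–Lohe system of two identical oscillators $$\begin{aligned}i\partial_t\psi_1&=-\tfrac12\Delta\psi_1+V\psi_1+\tfrac{iK}{4}\big(\psi_2-\langle\psi_2,\psi_1\rangle\psi_1\big),\\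 i\partial_t\psi_2&=-\tfrac12\Delta\psi_2+V\psi_2+\tfrac{iK}{4}\big(\psi_1-\langle\psi_1,\psi_2\rangle\psi_2\big)\end{aligned}$$ in $H^{-1}$ for all $t\ge0$. Put $\psi_d=\psi_1-\psi_2$, and for $j\in\{1,2,d\}$ let $\rho_j=|\psi_j|^2$ and $\Lambda_j=\operatorname{Im}(\bar\phi_j\nabla\psi_j)$ be the associated hydrodynamic variables, where $\phi_j(t)$ is any polar factor of $\psi_j(t)$, i.e. a measurable function with $|\phi_j|\le1$ and $\psi_j=\sqrt{\rho_j}\,\phi_j$ a.e. Then, for every $t\ge 0$ and every $j\in\{1,2,d\}$, $\sqrt{\rho_j}(t)$ has a weak gradient in $L^2$, and $$\lim_{t\to\infty}\Big(\|\nabla\sqrt{\rho_d}(t)\|_{L^2}+\|\Lambda_d(t)\|_{L^2}\Big)=0,\qquad \lim_{t\to\infty}\Big(\|\nabla\sqrt{\rho_1}(t)-\nabla\sqrt{\rho_2}(t)\|_{L^2}+\|\Lambda_1(t)-\Lambda_2(t)\|_{L^2}\Big)=0 .$$ -/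

import Mathlib

open MeasureTheory Filter Topology Set
open scoped ENNReal ContDiff ComplexConjugate

noncomputable section

namespace SchrodingerLohe

/-- The physical space `ℝ^d`. -/
abbrev Space (d : ℕ) : Type := EuclideanSpace ℝ (Fin d)

/-- `g` is the weak gradient of `u` on `ℝ^d`: both are locally integrable and
`∫ u ∂ⱼη = - ∫ gⱼ η` for all `j` and all smooth compactly supported `η`. -/
structure HasWeakGradient {𝕜 : Type*} [RCLike 𝕜] {d : ℕ} (u : Space d → 𝕜)
    (g : Space d → EuclideanSpace 𝕜 (Fin d)) : Prop where
  locallyIntegrable : LocallyIntegrable u volume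
  locallyIntegrable_grad : LocallyIntegrable g volume
  integral_eq : ∀ η : Space d → ℝ, ContDiff ℝ ∞ η → HasCompactSupport η → ∀ j : Fin d,
    ∫ x, (fderiv ℝ η x (EuclideanSpace.single j 1)) • u x = - ∫ x, η x • g x j

/-- `g` is the weak gradient of `u`, and it is square integrable. -/
def HasL2WeakGradient {𝕜 : Type*} [RCLike 𝕜] {d : ℕ} (u : Space d → 𝕜)
    (g : Space d → EuclideanSpace 𝕜 (Fin d)) : Prop :=
  HasWeakGradient u g ∧ MemLp g 2 volume

section aux

variable {d : ℕ}

lemma integrable_fderiv_smul {u : Space d → ℂ} (hu : LocallyIntegrable u volume)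
    {η : Space d → ℝ} (hη : ContDiff ℝ ∞ η) (hc : HasCompactSupport η) (v : Space d) :
    Integrable (fun x => (fderiv ℝ η x v) • u x) volume := by
  refine hu.integrable_smul_left_of_hasCompactSupport ?_ ?_
  · exact (hη.continuous_fderiv (by simp)).clm_apply continuous_const
  · exact hc.fderiv_apply (𝕜 := ℝ) v

lemma integrable_smul_coord {g : Space d → EuclideanSpace ℂ (Fin d)}
    (hg : LocallyIntegrable g volume)
    {η : Space d → ℝ} (hη : ContDiff ℝ ∞ η) (hc : HasCompactSupport η) (j : Fin d) :
    Integrable (fun x => η x • g x j) volume := by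
  have h := hg.integrable_smul_left_of_hasCompactSupport hη.continuous hc
  exact (EuclideanSpace.proj (𝕜 := ℂ) j).integrable_comp h

lemma HasWeakGradient.congr {u u' : Space d → ℂ} {g g' : Space d → EuclideanSpace ℂ (Fin d)}
    (h : HasWeakGradient u g) (hu : u =ᵐ[volume] u') (hg : g =ᵐ[volume] g') :
    HasWeakGradient u' g' where
  locallyIntegrable := (locallyIntegrable_congr hu).1 h.locallyIntegrable
  locallyIntegrable_grad := (locallyIntegrable_congr hg).1 h.locallyIntegrable_grad
  integral_eq η hη hc j := by
    have h1 : ∫ x, (fderiv ℝ η x (EuclideanSpace.single j 1)) • u' x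
        = ∫ x, (fderiv ℝ η x (EuclideanSpace.single j 1)) • u x :=
      integral_congr_ae (by filter_upwards [hu] with x hx; rw [hx])
    have h2 : ∫ x, η x • g' x j = ∫ x, η x • g x j :=
      integral_congr_ae (by filter_upwards [hg] with x hx; rw [hx])
    rw [h1, h2, h.integral_eq η hη hc j]

lemma HasWeakGradient.zero :
    HasWeakGradient (0 : Space d → ℂ) (0 : Space d → EuclideanSpace ℂ (Fin d)) where
  locallyIntegrable := locallyIntegrable_zero
  locallyIntegrable_grad := locallyIntegrable_zero
  integral_eq η hη hc j := by simp

lemma HasWeakGradient.add {u u' : Space d → ℂ} {g g' : Space d → EuclideanSpace ℂ (Fin d)}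
    (h : HasWeakGradient u g) (h' : HasWeakGradient u' g') :
    HasWeakGradient (u + u') (g + g') where
  locallyIntegrable := h.locallyIntegrable.add h'.locallyIntegrable
  locallyIntegrable_grad := h.locallyIntegrable_grad.add h'.locallyIntegrable_grad
  integral_eq η hη hc j := by
    simp only [Pi.add_apply, PiLp.add_apply, smul_add]
    rw [integral_add (integrable_fderiv_smul h.locallyIntegrable hη hc _)
        (integrable_fderiv_smul h'.locallyIntegrable hη hc _),
      integral_add (integrable_smul_coord h.locallyIntegrable_grad hη hc j)
        (integrable_smul_coord h'.locallyIntegrable_grad hη hc j),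
      h.integral_eq η hη hc j, h'.integral_eq η hη hc j, neg_add]

lemma HasWeakGradient.const_smul {u : Space d → ℂ} {g : Space d → EuclideanSpace ℂ (Fin d)}
    (h : HasWeakGradient u g) (c : ℂ) : HasWeakGradient (c • u) (c • g) where
  locallyIntegrable := h.locallyIntegrable.smul c
  locallyIntegrable_grad := h.locallyIntegrable_grad.smul c
  integral_eq η hη hc j := by
    simp only [Pi.smul_apply, PiLp.smul_apply, smul_comm _ c]
    rw [integral_smul, integral_smul, h.integral_eq η hη hc j, smul_neg]

end aux

/-- The Sobolev space `H¹(ℝ^d; ℂ)`, as the space of pairs `(u, ∇u)` with `u` and its weak gradient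
in `L²`. It carries the norm `‖u‖_{H¹}² = ‖u‖² + ‖∇u‖²` and the topology of that norm. -/
def H1 (d : ℕ) : Submodule ℂ (WithLp 2
    (Lp ℂ 2 (volume : Measure (Space d)) ×
      Lp (EuclideanSpace ℂ (Fin d)) 2 (volume : Measure (Space d)))) where
  carrier := {w | HasWeakGradient (w.fst : Space d → ℂ)
    (w.snd : Space d → EuclideanSpace ℂ (Fin d))}
  add_mem' {a b} ha hb :=
    (HasWeakGradient.add ha hb).congr (Lp.coeFn_add a.fst b.fst).symm
      (Lp.coeFn_add a.snd b.snd).symm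
  zero_mem' := HasWeakGradient.zero.congr (Lp.coeFn_zero _ _ _).symm (Lp.coeFn_zero _ _ _).symm
  smul_mem' c a ha := (HasWeakGradient.const_smul ha c).congr (Lp.coeFn_smul c a.fst).symm
    (Lp.coeFn_smul c a.snd).symm

/-- The underlying `L²` function of an element of `H¹`. -/
def toL2 {d : ℕ} (u : H1 d) : Lp ℂ 2 (volume : Measure (Space d)) := u.1.fst

/-- The weak gradient of an element of `H¹`. -/
def grad {d : ℕ} (u : H1 d) : Lp (EuclideanSpace ℂ (Fin d)) 2 (volume : Measure (Space d)) :=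
  u.1.snd

/-- `V` is a real potential for which `H¹` is the finite energy space: on `H¹` the potential energy
`∫ V |u|²` is finite and bounded by `‖u‖_{H¹}²`, and the energy `½ ‖∇u‖² + ∫ V |u|²` controls the
`H¹` norm up to a multiple of the mass. -/
structure HasEnergySpaceH1 {d : ℕ} (V : Space d → ℝ) : Prop where
  aestronglyMeasurable : AEStronglyMeasurable V volume
  integrable : ∀ u : H1 d, Integrable (fun x => V x * ‖toL2 u x‖ ^ 2) volume
  bounded : ∃ C : ℝ, ∀ u : H1 d, ∫ x, |V x| * ‖toL2 u x‖ ^ 2 ≤ C * ‖u‖ ^ 2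
  coercive : ∃ c > 0, ∃ b : ℝ, ∀ u : H1 d,
    c * ‖u‖ ^ 2 ≤ 1 / 2 * ‖grad u‖ ^ 2 + (∫ x, V x * ‖toL2 u x‖ ^ 2) + b * ‖toL2 u‖ ^ 2

/-- The duality pairing of `(-½ Δ + V) u` with `w`, antilinear in `w`:
`½ ∫ conj(∇w) · ∇u + ∫ V conj(w) u`. -/
def hamiltonianForm {d : ℕ} (V : Space d → ℝ) (w u : H1 d) : ℂ :=
  1 / 2 * inner ℂ (grad w) (grad u) + ∫ x, (V x : ℂ) * (conj (toL2 w x) * toL2 u x)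

/-- `i ∂ₜ u = -½ Δu + V u + (i K / 4) (v - ⟨v, u⟩ u)` for `t ≥ 0`, in `H⁻¹`, that is, tested with
every `w ∈ H¹`; `⟨f, g⟩ = ∫ conj(f) g`. -/
def SolvesLoheEquation {d : ℕ} (K : ℝ) (V : Space d → ℝ) (u v : ℝ → H1 d) : Prop :=
  ∀ t : ℝ, 0 ≤ t → ∀ w : H1 d, ∃ D : ℂ,
    HasDerivWithinAt (fun s => inner ℂ (toL2 w) (toL2 (u s))) D (Ici 0) t ∧
    Complex.I * D = hamiltonianForm V w (u t) + Complex.I * K / 4 *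
      (inner ℂ (toL2 w) (toL2 (v t))
        - inner ℂ (toL2 (v t)) (toL2 (u t)) * inner ℂ (toL2 w) (toL2 (u t)))

/-- `(ψ₁, ψ₂) ∈ C(ℝ₊; H¹)` solves the Schrödinger–Lohe system of two identical oscillators with
one-body potential `V` and coupling strength `K`. -/
structure IsLoheSolution {d : ℕ} (K : ℝ) (V : Space d → ℝ) (ψ₁ ψ₂ : ℝ → H1 d) : Prop where
  continuousOn₁ : ContinuousOn ψ₁ (Ici 0)
  continuousOn₂ : ContinuousOn ψ₂ (Ici 0)
  equation₁ : SolvesLoheEquation K V ψ₁ ψ₂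
  equation₂ : SolvesLoheEquation K V ψ₂ ψ₁

/-- The mass density `ρ = |ψ|²`. -/
def density {d : ℕ} (ψ : H1 d) (x : Space d) : ℝ := ‖toL2 ψ x‖ ^ 2

/-- The amplitude `√ρ`. -/
def sqrtDensity {d : ℕ} (ψ : H1 d) (x : Space d) : ℝ := √(density ψ x)

/-- `φ` is a polar factor of `ψ`: `|φ| ≤ 1` and `ψ = √ρ φ` almost everywhere. -/
structure IsPolarFactor {d : ℕ} (ψ : H1 d) (φ : Space d → ℂ) : Prop where
  aestronglyMeasurable : AEStronglyMeasurable φ volume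
  norm_le : ∀ᵐ x, ‖φ x‖ ≤ 1
  eq_mul : ∀ᵐ x, toL2 ψ x = (sqrtDensity ψ x : ℂ) * φ x

/-- The hydrodynamic variable `Λ = Im(conj(φ) ∇ψ)`, for a polar factor `φ` of `ψ`. -/
def hydroLambda {d : ℕ} (ψ : H1 d) (φ : Space d → ℂ) (x : Space d) : EuclideanSpace ℝ (Fin d) :=
  WithLp.toLp 2 (fun j => (conj (φ x) * grad ψ x j).im)

end SchrodingerLohe

end

/-!
Mass is conserved and the correlation `z = ⟨ψ₁, ψ₂⟩` solves the Riccati equation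
`z' = (K / 2) (1 - z²)`. Its solution with `z(0) ≠ -1` and `|z| ≤ 1` converges to `1` like `exp(-K t)`
(`IsLohePair.exists_correlation_bound`). The difference `ψ₁ - ψ₂` and the sum `ψ₁ + ψ₂` solve the
same Schrödinger equation with sources; the source of the difference is a damping up to terms of
size `|1 - z|`, and the source of the sum has size `|1 - z|`. The conserved energy, shifted by a
multiple of the mass so as to be coercive on `H¹`, therefore stays bounded along the sum and decays
exponentially along the difference (`IsLohePair.exists_decay`). Since the equation holds in `H⁻¹`
only, the balance laws for mass and energy are first proved for time averages, which lie in the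
domain of the Hamiltonian `H`, and then in the limit of short averages
(`IsWeakSolution.hasDerivWithinAt_form`).

For a polar factor `φ` of `ψ`, the weak gradient of `√ρ` and the field `Λ` are the real and the
imaginary part of `conj(φ) ∇ψ` (`IsPolarFactor.hasL2WeakGradient`). The chain rule is obtained from
the strong convergence of difference quotients, and the choice of `φ` on `{ψ = 0}` is immaterial
because `∇ψ = 0` almost everywhere there. As `|conj(φ) ∇ψ| ≤ |∇ψ|`, the first limit is the decay of
`ψ₁ - ψ₂` in `H¹`.

The second limit does not follow from `ψ₁ - ψ₂ → 0` and boundedness in `H¹`, as `ψ ↦ conj(φ) ∇ψ` is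
continuous but not uniformly continuous on bounded sets. It rests on uniform continuity in time.
Increments `ψ₂(t + θ) - ψ₂(t)` solve the equation with an exponentially small source, so their
energy at late times is controlled by that at a fixed time, and `ψ₂` is uniformly continuous in
`H¹`. Consequently short time averages approximate `ψ₂(t)` in `H¹` uniformly in `t`, and they lie in
the domain of `H` with a uniform bound on their image (`IsWeakSolution.exists_domain_approx`).

Write `a = ψ₂` and `b = ψ₁ - ψ₂`. Where `|b|` is much smaller than `|a|`, the polar factors of `a`
and `a + b` are close. The rest of space is covered by a cutoff `σ`, a logarithmic function of
`|b|² / (|a|² + |b|²)`, chosen so that `‖a ∇σ‖` is small and `|σ a| ≤ α |b|`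
(`exists_isLocalization`). The localization identity `⟨σ a, H (σ a)⟩ = Re ⟨σ² a, H a⟩ + ½ ‖a ∇σ‖²`
holds, and its first term is small, since `H a` is essentially bounded in `L²` and `σ² a` is small
there. By coercivity `σ a` is small in `H¹`, hence so is `σ ∇a`, and the polar gradients approach
each other in `L²` (`tendsto_eLpNorm_polarGrad_sub`).
-/

/-! ### Weak evolution equations driven by a hermitian form -/

namespace SchrodingerLohe

section WeakEvolution

open Complex (I)

variable {E : Type*} [NormedAddCommGroup E] [NormedSpace ℂ E]

lemma isBoundedBilinearMap_of_sesquilinear (B : E →L⋆[ℂ] E →L[ℂ] ℂ) :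
    IsBoundedBilinearMap ℝ (fun p : E × E => B p.1 p.2) where
  add_left x₁ x₂ y := by simp
  smul_left c x y := by
    rw [← Complex.coe_smul c x, map_smulₛₗ, smul_apply, Complex.conj_ofReal, Complex.coe_smul]
  add_right x y₁ y₂ := by simp
  smul_right c x y := by
    rw [← Complex.coe_smul c y, map_smul, Complex.coe_smul]
  bound := by
    refine ⟨‖B‖ + 1, by positivity, fun x y => (B.le_opNorm₂ x y).trans ?_⟩
    gcongr
    linarith

lemma exists_form_bound (B : E →L⋆[ℂ] E →L[ℂ] ℂ) :
    ∃ H : ℝ, 0 ≤ H ∧ ∀ w u, ‖B w u‖ ≤ H * ‖w‖ * ‖u‖ :=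
  ⟨‖B‖, norm_nonneg B, B.le_opNorm₂⟩

lemma continuous_sesquilinear (B : E →L⋆[ℂ] E →L[ℂ] ℂ) {X : Type*} [TopologicalSpace X]
    {f g : X → E} (hf : Continuous f) (hg : Continuous g) :
    Continuous fun x => B (f x) (g x) :=
  (isBoundedBilinearMap_of_sesquilinear B).continuous.comp (hf.prodMk hg)

lemma hasDerivAt_sesquilinear (B : E →L⋆[ℂ] E →L[ℂ] ℂ) {f g : ℝ → E} {f' g' : E} {t : ℝ}
    (hf : HasDerivAt f f' t) (hg : HasDerivAt g g' t) :
    HasDerivAt (fun s => B (f s) (g s)) (B f' (g t) + B (f t) g') t := by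
  have h := ((isBoundedBilinearMap_of_sesquilinear B).hasFDerivAt (f t, g t)).comp_hasDerivAt t
    (hf.prodMk hg)
  rw [add_comm]
  exact h

/-- The Steklov average `∫₀¹ u (t + s θ) dθ`, the mean of `u` over `[t, t + s]`. -/
noncomputable def steklov (u : ℝ → E) (s t : ℝ) : E := ∫ θ in (0 : ℝ)..1, u (t + s * θ)

lemma continuous_steklov {u : ℝ → E} (hu : Continuous u) :
    Continuous fun p : ℝ × ℝ => steklov u p.1 p.2 := by
  unfold steklov
  refine intervalIntegral.continuous_parametric_intervalIntegral_of_continuous' ?_ 0 1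
  fun_prop

lemma steklov_eq {u : ℝ → E} {s : ℝ} (hs : s ≠ 0) (t : ℝ) :
    steklov u s t = s⁻¹ • ∫ τ in t..t + s, u τ := by
  unfold steklov
  rw [intervalIntegral.integral_comp_add_mul _ hs]
  simp

lemma steklov_zero [CompleteSpace E] (u : ℝ → E) (t : ℝ) : steklov u 0 t = u t := by
  simp [steklov]

lemma hasDerivAt_steklov [CompleteSpace E] {u : ℝ → E} (hu : Continuous u) {s : ℝ} (hs : s ≠ 0)
    (t : ℝ) :
    HasDerivAt (steklov u s) (s⁻¹ • (u (t + s) - u t)) t := by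
  have h0 : ∀ x, HasDerivAt (fun x => ∫ τ in (0 : ℝ)..x, u τ) (u x) x := fun x =>
    intervalIntegral.integral_hasDerivAt_right (hu.intervalIntegrable _ _)
      (hu.stronglyMeasurableAtFilter _ _) hu.continuousAt
  have h1 : HasDerivAt (fun x => (∫ τ in (0 : ℝ)..(x + s), u τ) - ∫ τ in (0 : ℝ)..x, u τ)
      (u (t + s) - u t) t := ((h0 (t + s)).comp_add_const t s).sub (h0 t)
  have h2 : steklov u s
      = fun x => s⁻¹ • ((∫ τ in (0 : ℝ)..(x + s), u τ) - ∫ τ in (0 : ℝ)..x, u τ) := by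
    funext x
    rw [steklov_eq hs, intervalIntegral.integral_interval_sub_left
      (hu.intervalIntegrable _ _) (hu.intervalIntegrable _ _)]
  rw [h2]
  exact h1.const_smul s⁻¹

lemma norm_steklov_sub_le [CompleteSpace E] {u : ℝ → E} (hu : Continuous u) {s t ε : ℝ}
    (h : ∀ θ ∈ Icc (0 : ℝ) 1, ‖u (t + s * θ) - u t‖ ≤ ε) :
    ‖steklov u s t - u t‖ ≤ ε := by
  have h1 : steklov u s t - u t = ∫ θ in (0 : ℝ)..1, (u (t + s * θ) - u t) := by
    rw [intervalIntegral.integral_sub ((by fun_prop : Continuous _).intervalIntegrable _ _)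
      (continuous_const.intervalIntegrable _ _)]
    simp [steklov]
  rw [h1]
  refine (intervalIntegral.norm_integral_le_of_norm_le_const (C := ε) fun θ hθ => ?_).trans
    (by simp)
  rw [uIoc_of_le zero_le_one] at hθ
  exact h θ ⟨hθ.1.le, hθ.2⟩

lemma norm_steklov_le {u : ℝ → E} {s t M : ℝ}
    (h : ∀ θ ∈ Icc (0 : ℝ) 1, ‖u (t + s * θ)‖ ≤ M) : ‖steklov u s t‖ ≤ M := by
  refine (intervalIntegral.norm_integral_le_of_norm_le_const (C := M) fun θ hθ => ?_).trans
    (by simp)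
  rw [uIoc_of_le zero_le_one] at hθ
  exact h θ ⟨hθ.1.le, hθ.2⟩

/-- `u` solves `∂ₜ u = -i H u + F` for `t ≥ 0` in the weak sense, where the form `h` represents the
operator `H` and the form `J` represents the pivot inner product. -/
structure IsWeakSolution (J h : E →L⋆[ℂ] E →L[ℂ] ℂ) (u F : ℝ → E) : Prop where
  continuousOn : ContinuousOn u (Ici 0)
  continuousOn_source : ContinuousOn F (Ici 0)
  hasDerivWithinAt : ∀ t : ℝ, 0 ≤ t → ∀ w : E,
    HasDerivWithinAt (fun s => J w (u s)) (-I * h w (u t) + J w (F t)) (Ici 0) t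

/-- A form `B` that is infinitesimally invariant under the flow of `h`: if `H Y₁ = i P₁` and
`H Y₂ = i P₂` weakly, then `B(P₁, Y₂) + B(Y₁, P₂) = 0`. -/
def IsInvariantForm (J h B : E →L⋆[ℂ] E →L[ℂ] ℂ) : Prop :=
  ∀ P₁ P₂ Y₁ Y₂ : E, (∀ w, h w Y₁ = I * J w P₁) → (∀ w, h w Y₂ = I * J w P₂) →
    B P₁ Y₂ + B Y₁ P₂ = 0

variable {J h : E →L⋆[ℂ] E →L[ℂ] ℂ}

/-- Conservation of mass. -/
lemma isInvariantForm_pivot (hJ : ∀ u w, conj (J u w) = J w u) (hh : ∀ u w, conj (h u w) = h w u) :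
    IsInvariantForm J h J := by
  intro P₁ P₂ Y₁ Y₂ h₁ h₂
  have e₁ : h Y₁ Y₂ = I * J Y₁ P₂ := h₂ _
  have e₂ : h Y₁ Y₂ = -I * J P₁ Y₂ := by
    rw [← hh, h₁, map_mul, hJ, Complex.conj_I]
  have : I * (J P₁ Y₂ + J Y₁ P₂) = 0 := by linear_combination e₂ - e₁
  simpa using this

/-- Conservation of energy. -/
lemma isInvariantForm_self (hJ : ∀ u w, conj (J u w) = J w u) (hh : ∀ u w, conj (h u w) = h w u) :
    IsInvariantForm J h h := by
  intro P₁ P₂ Y₁ Y₂ h₁ h₂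
  have e₁ : h Y₁ P₂ = -I * J P₁ P₂ := by
    rw [← hh, h₁, map_mul, hJ, Complex.conj_I]
  rw [h₂, e₁]
  ring

lemma IsInvariantForm.add_smul {B B' : E →L⋆[ℂ] E →L[ℂ] ℂ} (hB : IsInvariantForm J h B)
    (hB' : IsInvariantForm J h B') (c : ℂ) : IsInvariantForm J h (B + c • B') := by
  intro P₁ P₂ Y₁ Y₂ h₁ h₂
  have e := hB P₁ P₂ Y₁ Y₂ h₁ h₂
  have e' := hB' P₁ P₂ Y₁ Y₂ h₁ h₂
  simp only [add_apply, smul_apply, smul_eq_mul]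
  linear_combination e + c * e'

/-- A curve on `[0, ∞)` is extended to negative times by its initial value. -/
lemma continuous_comp_max {X : Type*} [TopologicalSpace X] {u : ℝ → X}
    (hu : ContinuousOn u (Ici 0)) :
    Continuous fun t => u (max t 0) :=
  hu.comp_continuous (by fun_prop) fun t => le_max_right t 0

/-- The time average of a weak solution lies in the domain of the operator: `H Y = i (Y' - F_s)`,
where `Y` and `F_s` are the averages of the solution and of the source. -/
lemma IsWeakSolution.steklov_eq [CompleteSpace E] {u F : ℝ → E} (hu : IsWeakSolution J h u F)
    {s t : ℝ} (hs : 0 < s) (ht : 0 ≤ t) (w : E) :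
    h w (steklov (fun t => u (max t 0)) s t)
      = I * J w (s⁻¹ • (u (t + s) - u t) - steklov (fun t => F (max t 0)) s t) := by
  have cu := continuous_comp_max hu.continuousOn
  have cF := continuous_comp_max hu.continuousOn_source
  have ch : Continuous fun τ => -I * h w (u (max τ 0)) :=
    continuous_const.mul ((h w).continuous.comp cu)
  have cJ : Continuous fun τ => J w (F (max τ 0)) := (J w).continuous.comp cF
  have hts : t ≤ t + s := by linarith
  have hint : ∫ τ in t..t + s, (-I * h w (u (max τ 0)) + J w (F (max τ 0)))
      = J w (u (t + s)) - J w (u t) := by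
    refine intervalIntegral.integral_eq_sub_of_hasDeriv_right_of_le (f := fun τ => J w (u τ)) hts
      ?_ ?_ ?_
    · exact ((J w).continuous.comp_continuousOn hu.continuousOn).mono
        fun x hx => ht.trans hx.1
    · intro x hx
      have hx0 : 0 ≤ x := ht.trans hx.1.le
      have := hu.hasDerivWithinAt x hx0 w
      rw [max_eq_left hx0]
      exact this.mono fun y hy => hx0.trans (le_of_lt hy)
    · exact (ch.add cJ).intervalIntegrable _ _
  rw [intervalIntegral.integral_add (ch.intervalIntegrable _ _) (cJ.intervalIntegrable _ _),
    intervalIntegral.integral_const_mul,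
    (h w).intervalIntegral_comp_comm (cu.intervalIntegrable _ _),
    (J w).intervalIntegral_comp_comm (cF.intervalIntegrable _ _)] at hint
  rw [SchrodingerLohe.steklov_eq hs.ne', SchrodingerLohe.steklov_eq hs.ne', ← smul_sub]
  have real_smul : ∀ (r : ℝ) (x : E), r • x = (r : ℂ) • x := fun r x =>
    (Complex.coe_smul r x).symm
  simp only [real_smul, map_smul, map_sub, smul_eq_mul]
  linear_combination (((s⁻¹ : ℝ) : ℂ) * I) * hint
    + (((s⁻¹ : ℝ) : ℂ) * h w (∫ τ in t..t + s, u (max τ 0))) * Complex.I_sq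

/-- Balance law for an invariant form along two weak solutions: only the sources contribute. The
time averages satisfy it by `IsWeakSolution.steklov_eq`, and the length of the averaging window
tends to zero in the integrated identity. -/
theorem IsWeakSolution.hasDerivWithinAt_form [CompleteSpace E] {B : E →L⋆[ℂ] E →L[ℂ] ℂ}
    (hB : IsInvariantForm J h B) {u₁ u₂ F₁ F₂ : ℝ → E} (h₁ : IsWeakSolution J h u₁ F₁)
    (h₂ : IsWeakSolution J h u₂ F₂) {t : ℝ} (ht : 0 ≤ t) :
    HasDerivWithinAt (fun s => B (u₁ s) (u₂ s)) (B (F₁ t) (u₂ t) + B (u₁ t) (F₂ t)) (Ici 0) t := by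
  set U₁ : ℝ → E := fun t => u₁ (max t 0) with hU₁
  set U₂ : ℝ → E := fun t => u₂ (max t 0) with hU₂
  set G₁ : ℝ → E := fun t => F₁ (max t 0) with hG₁
  set G₂ : ℝ → E := fun t => F₂ (max t 0) with hG₂
  have cU₁ : Continuous U₁ := continuous_comp_max h₁.continuousOn
  have cU₂ : Continuous U₂ := continuous_comp_max h₂.continuousOn
  have cG₁ : Continuous G₁ := continuous_comp_max h₁.continuousOn_source
  have cG₂ : Continuous G₂ := continuous_comp_max h₂.continuousOn_source
  have key : ∀ b : ℝ, 0 ≤ b → B (U₁ b) (U₂ b)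
      = B (U₁ 0) (U₂ 0) + ∫ τ in (0 : ℝ)..b, (B (G₁ τ) (U₂ τ) + B (U₁ τ) (G₂ τ)) := by
    intro b hb
    -- the error in the integrated balance law for the averages over windows of length `s`; it
    -- vanishes for `s > 0` and is continuous at `s = 0`
    let R : ℝ → ℂ := fun s => B (steklov U₁ s b) (steklov U₂ s b)
      - B (steklov U₁ s 0) (steklov U₂ s 0)
      - ∫ τ in (0 : ℝ)..b, (B (steklov G₁ s τ) (steklov U₂ s τ)
        + B (steklov U₁ s τ) (steklov G₂ s τ))
    have cst : ∀ {u : ℝ → E}, Continuous u → ∀ b : ℝ, Continuous fun s => steklov u s b :=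
      fun hu b => (continuous_steklov hu).comp (by fun_prop : Continuous fun s : ℝ => (s, b))
    have cR : Continuous R := by
      refine ((continuous_sesquilinear B (cst cU₁ b) (cst cU₂ b)).sub
        (continuous_sesquilinear B (cst cU₁ 0) (cst cU₂ 0))).sub
        (intervalIntegral.continuous_parametric_intervalIntegral_of_continuous' ?_ 0 b)
      exact (continuous_sesquilinear B (continuous_steklov cG₁) (continuous_steklov cU₂)).add
        (continuous_sesquilinear B (continuous_steklov cU₁) (continuous_steklov cG₂))
    have R_pos : ∀ s : ℝ, 0 < s → R s = 0 := by
      intro s hs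
      have cs : ∀ {u : ℝ → E}, Continuous u → Continuous fun τ => steklov u s τ :=
        fun hu => (continuous_steklov hu).comp (by fun_prop : Continuous fun τ : ℝ => (s, τ))
      have hder : ∀ τ ∈ uIcc 0 b, HasDerivAt (fun τ => B (steklov U₁ s τ) (steklov U₂ s τ))
          (B (steklov G₁ s τ) (steklov U₂ s τ) + B (steklov U₁ s τ) (steklov G₂ s τ)) τ := by
        intro τ hτ
        rw [uIcc_of_le hb] at hτ
        have hτ0 := hτ.1
        have e := hasDerivAt_sesquilinear B (hasDerivAt_steklov cU₁ hs.ne' τ)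
          (hasDerivAt_steklov cU₂ hs.ne' τ)
        have inv := hB _ _ _ _ (fun w => h₁.steklov_eq hs hτ0 w) (fun w => h₂.steklov_eq hs hτ0 w)
        have m₁ : max τ 0 = τ := max_eq_left hτ0
        have m₂ : max (τ + s) 0 = τ + s := max_eq_left (by linarith)
        convert e using 1
        simp only [hU₁, hU₂, m₁, m₂]
        simp only [map_sub, sub_apply] at inv ⊢
        linear_combination -inv
      have := intervalIntegral.integral_eq_sub_of_hasDerivAt hder
        (((continuous_sesquilinear B (cs cG₁) (cs cU₂)).add
          (continuous_sesquilinear B (cs cU₁) (cs cG₂))).intervalIntegrable _ _)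
      simp only [R]
      rw [this]
      ring
    have hR0 : R 0 = 0 := by
      have h1 : Tendsto R (𝓝[>] 0) (𝓝 (R 0)) := cR.continuousAt.tendsto.mono_left nhdsWithin_le_nhds
      have h2 : Tendsto R (𝓝[>] 0) (𝓝 0) := by
        refine tendsto_const_nhds.congr' ?_
        filter_upwards [self_mem_nhdsWithin] with s hs
        exact (R_pos s hs).symm
      exact tendsto_nhds_unique h1 h2
    simp only [R, steklov_zero] at hR0
    linear_combination hR0
  have hcont : Continuous fun τ => B (G₁ τ) (U₂ τ) + B (U₁ τ) (G₂ τ) :=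
    (continuous_sesquilinear B cG₁ cU₂).add (continuous_sesquilinear B cU₁ cG₂)
  have hd : HasDerivAt (fun b => B (U₁ 0) (U₂ 0)
      + ∫ τ in (0 : ℝ)..b, (B (G₁ τ) (U₂ τ) + B (U₁ τ) (G₂ τ)))
      (B (G₁ t) (U₂ t) + B (U₁ t) (G₂ t)) t :=
    (intervalIntegral.integral_hasDerivAt_right (hcont.intervalIntegrable _ _)
      (hcont.stronglyMeasurableAtFilter _ _) hcont.continuousAt).const_add _
  have mt : max t 0 = t := max_eq_left ht
  simp only [hG₁, hG₂, hU₁, hU₂, mt] at hd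
  refine hd.hasDerivWithinAt.congr_of_mem (fun b hb => ?_) ht
  have := key b hb
  have mb : max b 0 = b := max_eq_left hb
  simp only [hU₁, hU₂, mb] at this
  exact this

lemma IsWeakSolution.add {u₁ u₂ F₁ F₂ : ℝ → E} (h₁ : IsWeakSolution J h u₁ F₁)
    (h₂ : IsWeakSolution J h u₂ F₂) : IsWeakSolution J h (u₁ + u₂) (F₁ + F₂) where
  continuousOn := h₁.continuousOn.add h₂.continuousOn
  continuousOn_source := h₁.continuousOn_source.add h₂.continuousOn_source
  hasDerivWithinAt t ht w := by
    have := (h₁.hasDerivWithinAt t ht w).add (h₂.hasDerivWithinAt t ht w)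
    refine (this.congr_deriv ?_).congr (fun s _ => ?_) ?_ <;>
    simp only [Pi.add_apply, map_add]
    ring

lemma IsWeakSolution.sub {u₁ u₂ F₁ F₂ : ℝ → E} (h₁ : IsWeakSolution J h u₁ F₁)
    (h₂ : IsWeakSolution J h u₂ F₂) : IsWeakSolution J h (u₁ - u₂) (F₁ - F₂) where
  continuousOn := h₁.continuousOn.sub h₂.continuousOn
  continuousOn_source := h₁.continuousOn_source.sub h₂.continuousOn_source
  hasDerivWithinAt t ht w := by
    have := (h₁.hasDerivWithinAt t ht w).sub (h₂.hasDerivWithinAt t ht w)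
    refine (this.congr_deriv ?_).congr (fun s _ => ?_) ?_ <;>
    simp only [Pi.sub_apply, map_sub]
    ring

lemma IsWeakSolution.comp_add_const {u F : ℝ → E} (hu : IsWeakSolution J h u F) {a : ℝ}
    (ha : 0 ≤ a) : IsWeakSolution J h (fun t => u (t + a)) (fun t => F (t + a)) := by
  have maps : MapsTo (fun t : ℝ => t + a) (Ici 0) (Ici 0) := fun t ht => add_nonneg ht ha
  refine ⟨hu.continuousOn.comp (by fun_prop) maps, hu.continuousOn_source.comp (by fun_prop) maps,
    fun t ht w => ?_⟩
  have h1 := hu.hasDerivWithinAt (t + a) (add_nonneg ht ha) w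
  have h2 := h1.scomp t ((hasDerivWithinAt_id t (Ici 0)).add_const a) maps
  simpa [Function.comp_def] using h2

end WeakEvolution

end SchrodingerLohe

/-! ### Weak derivatives as limits of difference quotients -/

namespace SchrodingerLohe

section WeakDeriv

variable {d : ℕ}

/-- `p` is the weak derivative of `u` in the direction `e`. Integrability is not part of the
definition. -/
def IsWeakDeriv (e : Space d) (u p : Space d → ℂ) : Prop :=
  ∀ η : Space d → ℝ, ContDiff ℝ ∞ η → HasCompactSupport η →
    ∫ x, (fderiv ℝ η x e) • u x = - ∫ x, η x • p x

lemma integral_translate (η : Space d → ℝ) (u : Space d → ℂ) (v : Space d) :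
    ∫ x, η x • u (x + v) = ∫ x, η (x - v) • u x := by
  rw [← integral_add_right_eq_self (fun x => η (x - v) • u x) v]
  simp

/-- Translating a test function differentiates it under the integral. -/
lemma hasDerivAt_integral_translate {η : Space d → ℝ} (hη : ContDiff ℝ ∞ η)
    (hc : HasCompactSupport η) {u : Space d → ℂ} (hu : LocallyIntegrable u volume) (e : Space d)
    (s : ℝ) :
    HasDerivAt (fun s : ℝ => ∫ x, η (x - s • e) • u x)
      (-∫ x, (fderiv ℝ η (x - s • e) e) • u x) s := by
  set ζ : Space d → ℝ := fun y => η (-y) with hζ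
  have hζc : ContDiff ℝ 1 ζ := (hη.of_le (by exact_mod_cast le_top)).comp contDiff_neg
  have hζs : HasCompactSupport ζ := hc.comp_homeomorph (Homeomorph.neg (Space d))
  set L : ℂ →L[ℝ] ℝ →L[ℝ] ℂ := (ContinuousLinearMap.lsmul ℝ ℝ).flip with hL
  have hder : ∀ y, fderiv ℝ ζ y e = - fderiv ℝ η (-y) e := by
    intro y
    have h1 : HasFDerivAt η (fderiv ℝ η (-y)) (-y) :=
      (hη.differentiable (by simp) (-y)).hasFDerivAt
    have h2 := h1.comp y (f := fun y => -y) (hasFDerivAt_id y).neg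
    have h3 : fderiv ℝ ζ y = (fderiv ℝ η (-y)).comp (-ContinuousLinearMap.id ℝ (Space d)) :=
      h2.fderiv
    rw [h3]
    simp
  have h1 := hζs.hasFDerivAt_convolution_right L hu hζc (s • e)
  have h2 : HasDerivAt (fun s : ℝ => s • e) e s := by
    simpa using (hasDerivAt_id s).smul_const e
  have h3 := h1.comp_hasDerivAt s h2
  rw [convolution_precompR_apply L hu (hζs.fderiv (𝕜 := ℝ))
    (hζc.continuous_fderiv (by simp))] at h3
  have e1 : (convolution u ζ L volume ∘ fun s : ℝ => s • e)
      = fun s : ℝ => ∫ x, η (x - s • e) • u x := by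
    funext s
    simp [convolution_def, hL, hζ]
  have e2 : convolution u (fun a => (fderiv ℝ ζ a) e) L volume (s • e)
      = -∫ x, (fderiv ℝ η (x - s • e) e) • u x := by
    rw [convolution_def, ← integral_neg]
    congr 1
    funext x
    simp [hL, hder]
  rw [e1, e2] at h3
  exact h3

lemma IsWeakDeriv.hasDerivAt_integral {e : Space d} {u p : Space d → ℂ} (h : IsWeakDeriv e u p)
    (hu : LocallyIntegrable u volume) {η : Space d → ℝ} (hη : ContDiff ℝ ∞ η)
    (hc : HasCompactSupport η) (s : ℝ) :
    HasDerivAt (fun s : ℝ => ∫ x, η x • u (x + s • e)) (∫ x, η x • p (x + s • e)) s := by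
  have h1 := hasDerivAt_integral_translate hη hc hu e s
  simp_rw [integral_translate]
  convert h1 using 1
  have h2 := h (fun x => η (x - s • e)) (hη.comp (contDiff_id.sub contDiff_const))
    (hc.comp_homeomorph (Homeomorph.subRight (s • e)))
  simp_rw [fderiv_comp_sub] at h2
  rw [h2, neg_neg]

lemma measurePreserving_translate (v : Space d) :
    MeasurePreserving (fun x : Space d => x + v) volume volume :=
  measurePreserving_add_right volume v

/-- The translation `u ↦ u (· + v)` on `L²`. -/
noncomputable def translate {F : Type*} [NormedAddCommGroup F] (v : Space d)
    (u : Lp F 2 (volume : Measure (Space d))) : Lp F 2 (volume : Measure (Space d)) :=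
  Lp.compMeasurePreserving (fun x => x + v) (measurePreserving_translate v) u

lemma coeFn_translate {F : Type*} [NormedAddCommGroup F] (v : Space d)
    (u : Lp F 2 (volume : Measure (Space d))) :
    translate v u =ᵐ[volume] fun x => u (x + v) :=
  Lp.coeFn_compMeasurePreserving _ _

lemma continuous_translate {F : Type*} [NormedAddCommGroup F]
    (u : Lp F 2 (volume : Measure (Space d))) (e : Space d) :
    Continuous fun s : ℝ => translate (s • e) u := by
  have hg : Continuous fun s : ℝ =>
      (⟨fun x : Space d => x + s • e, by fun_prop⟩ : C(Space d, Space d)) :=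
    ContinuousMap.continuous_of_continuous_uncurry _
      (show Continuous fun q : ℝ × Space d => q.2 + q.1 • e by fun_prop)
  exact continuous_const.compMeasurePreservingLp hg
    (fun s => measurePreserving_translate (s • e)) (by simp)

lemma translate_zero {F : Type*} [NormedAddCommGroup F]
    (u : Lp F 2 (volume : Measure (Space d))) : translate 0 u = u := by
  refine Lp.ext ((coeFn_translate 0 u).trans ?_)
  simp

lemma locallyIntegrable_Lp {F : Type*} [NormedAddCommGroup F]
    (u : Lp F 2 (volume : Measure (Space d))) : LocallyIntegrable u volume :=
  (Lp.memLp u).locallyIntegrable (by norm_num)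

lemma locallyIntegrable_norm_Lp {F : Type*} [NormedAddCommGroup F]
    (u : Lp F 2 (volume : Measure (Space d))) : LocallyIntegrable (fun x => ‖u x‖) volume :=
  (Lp.memLp u).norm.locallyIntegrable (by norm_num)

/-- The weak derivative commutes with translations, also when tested with a complex test
function. -/
lemma IsWeakDeriv.hasDerivAt_inner {e : Space d}
    {u p : Lp ℂ 2 (volume : Measure (Space d))} (h : IsWeakDeriv e u p)
    {v : Lp ℂ 2 (volume : Measure (Space d))} {ζ : Space d → ℂ} (hv : v =ᵐ[volume] ζ)
    (hζ : ContDiff ℝ ∞ ζ) (hc : HasCompactSupport ζ) (s : ℝ) :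
    HasDerivAt (fun s : ℝ => inner ℂ v (translate (s • e) u))
      (inner ℂ v (translate (s • e) p)) s := by
  have hre : ContDiff ℝ ∞ fun x => (ζ x).re := Complex.reCLM.contDiff.comp hζ
  have him : ContDiff ℝ ∞ fun x => (ζ x).im := Complex.imCLM.contDiff.comp hζ
  have cre : HasCompactSupport fun x => (ζ x).re := hc.comp_left (g := Complex.re) rfl
  have cim : HasCompactSupport fun x => (ζ x).im := hc.comp_left (g := Complex.im) rfl
  have key : ∀ (f : Lp ℂ 2 (volume : Measure (Space d))) (s : ℝ),
      inner ℂ v (translate (s • e) f)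
        = (∫ x, (ζ x).re • f (x + s • e)) - Complex.I * ∫ x, (ζ x).im • f (x + s • e) := by
    intro f s
    have hf : LocallyIntegrable (fun x => f (x + s • e)) volume :=
      (locallyIntegrable_congr (coeFn_translate (s • e) f)).1 (locallyIntegrable_Lp _)
    have i1 : Integrable (fun x => (ζ x).re • f (x + s • e)) volume :=
      hf.integrable_smul_left_of_hasCompactSupport hre.continuous cre
    have i2 : Integrable (fun x => (ζ x).im • f (x + s • e)) volume :=
      hf.integrable_smul_left_of_hasCompactSupport him.continuous cim
    rw [L2.inner_def, ← integral_const_mul, ← integral_sub i1 (i2.const_mul _)]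
    refine integral_congr_ae ?_
    filter_upwards [hv, coeFn_translate (s • e) f] with x h1 h2
    rw [h1, h2, RCLike.inner_apply]
    apply Complex.ext <;> simp <;> ring
  simp_rw [key]
  exact (h.hasDerivAt_integral (locallyIntegrable_Lp u) hre cre s).sub
    ((h.hasDerivAt_integral (locallyIntegrable_Lp u) him cim s).const_mul _)

/-- The difference quotients of `u` converge strongly in `L²` to its weak derivative. -/
theorem IsWeakDeriv.tendsto_diffQuot {e : Space d} {u p : Lp ℂ 2 (volume : Measure (Space d))}
    (h : IsWeakDeriv e u p) :
    Tendsto (fun s : ℝ => s⁻¹ • (translate (s • e) u - u)) (𝓝[≠] 0) (𝓝 p) := by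
  rw [Metric.tendsto_nhdsWithin_nhds]
  intro ε hε
  have h0 : Tendsto (fun s : ℝ => translate (s • e) p) (𝓝 0) (𝓝 p) := by
    have := (continuous_translate p e).tendsto 0
    rwa [zero_smul, translate_zero] at this
  obtain ⟨δ, hδ, hp⟩ := Metric.tendsto_nhds_nhds.1 h0 (ε / 2) (by positivity)
  refine ⟨δ, hδ, fun {s} hs hsδ => ?_⟩
  have hs0 : s ≠ 0 := hs
  set X := translate (s • e) u - u - s • p with hX
  have bound : ∀ v : Lp ℂ 2 (volume : Measure (Space d)),
      ‖(inner ℂ v X : ℂ)‖ ≤ ε / 2 * |s| * ‖v‖ := by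
    have hclosed : IsClosed {v : Lp ℂ 2 (volume : Measure (Space d)) |
        ‖(inner ℂ v X : ℂ)‖ ≤ ε / 2 * |s| * ‖v‖} :=
      isClosed_le (by fun_prop) (by fun_prop)
    refine fun v => hclosed.closure_subset_iff.2 ?_
      ((Lp.dense_hasCompactSupport_contDiff (F := ℂ) (μ := (volume : Measure (Space d)))
        (p := 2) (by simp)) v)
    rintro w ⟨ζ, hw, hc, hζ⟩
    have hder : ∀ τ ∈ Metric.ball (0 : ℝ) δ, HasDerivWithinAt
        (fun τ : ℝ => (inner ℂ w (translate (τ • e) u) : ℂ) - (τ : ℂ) * inner ℂ w p)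
        (inner ℂ w (translate (τ • e) p) - inner ℂ w p) (Metric.ball 0 δ) τ := by
      intro τ _
      have h1 : HasDerivAt (fun τ : ℝ => (τ : ℂ) * (inner ℂ w p : ℂ)) (inner ℂ w p) τ := by
        simpa using (Complex.ofRealCLM.hasDerivAt (x := τ)).mul_const (inner ℂ w p : ℂ)
      exact ((h.hasDerivAt_inner hw hζ hc τ).sub h1).hasDerivWithinAt
    have hbd : ∀ τ ∈ Metric.ball (0 : ℝ) δ,
        ‖(inner ℂ w (translate (τ • e) p) - inner ℂ w p : ℂ)‖ ≤ ‖w‖ * (ε / 2) := by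
      intro τ hτ
      rw [← inner_sub_right]
      refine (norm_inner_le_norm _ _).trans ?_
      gcongr
      have := hp hτ
      rw [dist_eq_norm] at this
      exact this.le
    have := Convex.norm_image_sub_le_of_norm_hasDerivWithin_le hder hbd (convex_ball 0 δ)
      (Metric.mem_ball_self hδ) (show s ∈ Metric.ball (0 : ℝ) δ from hsδ)
    simp only [zero_smul, translate_zero, Complex.ofReal_zero, zero_mul, sub_zero] at this
    have e1 : (inner ℂ w X : ℂ)
        = inner ℂ w (translate (s • e) u) - (s : ℂ) * inner ℂ w p - inner ℂ w u := by
      rw [hX, inner_sub_right, inner_sub_right, inner_smul_right_eq_smul, Complex.real_smul]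
      ring
    rw [mem_ofPred_eq, e1]
    refine this.trans (le_of_eq ?_)
    rw [Real.norm_eq_abs]
    ring
  have hXn : ‖X‖ ≤ ε / 2 * |s| := by
    have h1 := bound X
    rw [inner_self_eq_norm_sq_to_K] at h1
    simp only [norm_pow, RCLike.norm_ofReal, abs_norm] at h1
    by_contra hcon
    push Not at hcon
    have : 0 < ‖X‖ := lt_of_le_of_lt (by positivity) hcon
    nlinarith
  have e2 : s⁻¹ • (translate (s • e) u - u) - p = s⁻¹ • X := by
    rw [hX, smul_sub s⁻¹ (_ - _), smul_smul, inv_mul_cancel₀ hs0, one_smul]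
  rw [dist_eq_norm, e2, norm_smul, norm_inv, Real.norm_eq_abs, inv_mul_lt_iff₀ (by positivity)]
  have : 0 < |s| := by positivity
  nlinarith

lemma integral_norm_mul_norm_le {F G : Type*} [NormedAddCommGroup F] [NormedAddCommGroup G]
    (f : Lp F 2 (volume : Measure (Space d))) (g : Lp G 2 (volume : Measure (Space d))) :
    ∫ x, ‖f x‖ * ‖g x‖ ≤ ‖f‖ * ‖g‖ := by
  have hf := (Lp.memLp f).norm
  have hg := (Lp.memLp g).norm
  have h1 : (inner ℝ hf.toLp hg.toLp : ℝ) = ∫ x, ‖f x‖ * ‖g x‖ := by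
    rw [L2.inner_def]
    refine integral_congr_ae ?_
    filter_upwards [hf.coeFn_toLp, hg.coeFn_toLp] with x h1 h2
    rw [h1, h2]
    simp [mul_comm]
  rw [← h1]
  refine (real_inner_le_norm _ _).trans (le_of_eq ?_)
  rw [Lp.norm_toLp, Lp.norm_toLp, eLpNorm_norm, eLpNorm_norm, Lp.norm_def, Lp.norm_def]

lemma integrable_norm_mul_norm {F G : Type*} [NormedAddCommGroup F] [NormedAddCommGroup G]
    (f : Lp F 2 (volume : Measure (Space d))) (g : Lp G 2 (volume : Measure (Space d))) :
    Integrable (fun x => ‖f x‖ * ‖g x‖) volume :=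
  (Lp.memLp f).norm.integrable_mul (Lp.memLp g).norm

lemma locallyIntegrable_comp_lipschitz {u₁ u₂ : Lp ℂ 2 (volume : Measure (Space d))}
    {f : ℂ × ℂ → ℂ} {K : NNReal} (hf : LipschitzWith K f) :
    LocallyIntegrable (fun x => f (u₁ x, u₂ x)) volume := by
  have hg : LocallyIntegrable (fun x => ‖f 0‖ + K * (‖u₁ x‖ + ‖u₂ x‖)) volume :=
    (locallyIntegrable_const _).add
      (((locallyIntegrable_norm_Lp u₁).add (locallyIntegrable_norm_Lp u₂)).smul (K : ℝ))
  refine hg.mono (hf.continuous.comp_aestronglyMeasurable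
    ((Lp.aestronglyMeasurable u₁).prodMk (Lp.aestronglyMeasurable u₂))) (ae_of_all _ fun x => ?_)
  have h1 : ‖f (u₁ x, u₂ x) - f 0‖ ≤ K * ‖(u₁ x, u₂ x)‖ := by
    simpa [dist_eq_norm] using hf.dist_le_mul (u₁ x, u₂ x) 0
  have h2 : ‖(u₁ x, u₂ x)‖ ≤ ‖u₁ x‖ + ‖u₂ x‖ :=
    max_le (le_add_of_nonneg_right (norm_nonneg _)) (le_add_of_nonneg_left (norm_nonneg _))
  rw [Real.norm_of_nonneg (by positivity)]
  calc ‖f (u₁ x, u₂ x)‖ = ‖f 0 + (f (u₁ x, u₂ x) - f 0)‖ := by rw [add_sub_cancel]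
    _ ≤ ‖f 0‖ + K * ‖(u₁ x, u₂ x)‖ := (norm_add_le _ _).trans (by gcongr)
    _ ≤ _ := by gcongr

lemma norm_diffQuot_le {f : ℂ × ℂ → ℂ} {K : NNReal} (hf : LipschitzWith K f) (z : ℂ × ℂ)
    (p₁ p₂ : ℂ) (s : ℝ) :
    ‖s⁻¹ • (f (z + s • (p₁, p₂)) - f z)‖ ≤ K * (‖p₁‖ + ‖p₂‖) := by
  rcases eq_or_ne s 0 with rfl | hs
  · simp only [inv_zero, zero_smul, norm_zero]; positivity
  have h1 : ‖f (z + s • (p₁, p₂)) - f z‖ ≤ K * ‖s • (p₁, p₂)‖ := by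
    simpa [dist_eq_norm] using hf.dist_le_mul (z + s • (p₁, p₂)) z
  have h2 : ‖(p₁, p₂)‖ ≤ ‖p₁‖ + ‖p₂‖ :=
    max_le (le_add_of_nonneg_right (norm_nonneg _)) (le_add_of_nonneg_left (norm_nonneg _))
  rw [norm_smul] at h1
  rw [norm_smul, norm_inv, inv_mul_le_iff₀ (norm_pos_iff.2 hs)]
  calc _ ≤ K * (‖s‖ * ‖(p₁, p₂)‖) := h1
    _ ≤ K * (‖s‖ * (‖p₁‖ + ‖p₂‖)) := by gcongr
    _ = _ := by ring

/-- Chain rule for Lipschitz functions. Differentiability of `f` is only used along the gradient,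
and even one-sided directional derivatives suffice, since the difference quotients of `(u₁, u₂)`
converge strongly. -/
theorem IsWeakDeriv.comp_lipschitz {e : Space d} {u₁ u₂ p₁ p₂ : Lp ℂ 2 (volume : Measure (Space d))}
    (h₁ : IsWeakDeriv e u₁ p₁) (h₂ : IsWeakDeriv e u₂ p₂) {f : ℂ × ℂ → ℂ} {K : NNReal}
    (hf : LipschitzWith K f) {q : Space d → ℂ} {l : Filter ℝ} [l.NeBot] [l.IsCountablyGenerated]
    (hl : l ≤ 𝓝[≠] 0)
    (hq : ∀ᵐ x, Tendsto (fun s : ℝ =>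
      s⁻¹ • (f ((u₁ x, u₂ x) + s • (p₁ x, p₂ x)) - f (u₁ x, u₂ x))) l (𝓝 (q x))) :
    IsWeakDeriv e (fun x => f (u₁ x, u₂ x)) q := by
  intro η hη hc
  set U : Space d → ℂ := fun x => f (u₁ x, u₂ x) with hU
  have hUloc : LocallyIntegrable U volume := locallyIntegrable_comp_lipschitz hf
  set R₁ : ℝ → Lp ℂ 2 (volume : Measure (Space d)) :=
    fun s => s⁻¹ • (translate (s • e) u₁ - u₁) - p₁ with hR₁
  set R₂ : ℝ → Lp ℂ 2 (volume : Measure (Space d)) :=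
    fun s => s⁻¹ • (translate (s • e) u₂ - u₂) - p₂ with hR₂
  have hηL : MemLp η 2 volume := hη.continuous.memLp_of_hasCompactSupport hc
  have huL : AEStronglyMeasurable (fun x => (u₁ x, u₂ x)) volume :=
    (Lp.aestronglyMeasurable u₁).prodMk (Lp.aestronglyMeasurable u₂)
  have hpL : AEStronglyMeasurable (fun x => (p₁ x, p₂ x)) volume :=
    (Lp.aestronglyMeasurable p₁).prodMk (Lp.aestronglyMeasurable p₂)
  -- the difference quotient `Q` of `U`, and its replacement `q'` along the weak derivatives
  set Q : ℝ → Space d → ℂ := fun s x => s⁻¹ • (U (x + s • e) - U x) with hQ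
  set q' : ℝ → Space d → ℂ := fun s x =>
    s⁻¹ • (f ((u₁ x, u₂ x) + s • (p₁ x, p₂ x)) - f (u₁ x, u₂ x)) with hq'
  have hUt : ∀ s : ℝ, LocallyIntegrable (fun x => U (x + s • e)) volume := by
    intro s
    refine (locallyIntegrable_congr ?_).1 (locallyIntegrable_comp_lipschitz
      (u₁ := translate (s • e) u₁) (u₂ := translate (s • e) u₂) hf)
    filter_upwards [coeFn_translate (s • e) u₁, coeFn_translate (s • e) u₂] with x a b
    rw [a, b]
  have iQ : ∀ s, Integrable (fun x => η x • Q s x) volume := fun s =>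
    (((hUt s).sub hUloc).smul s⁻¹).integrable_smul_left_of_hasCompactSupport hη.continuous hc
  have q'_meas : ∀ s, AEStronglyMeasurable (q' s) volume := fun s =>
    ((hf.continuous.comp_aestronglyMeasurable (huL.add (hpL.const_smul s))).sub
      (hf.continuous.comp_aestronglyMeasurable huL)).const_smul s⁻¹
  have q'_le : ∀ s x, ‖q' s x‖ ≤ K * (‖p₁ x‖ + ‖p₂ x‖) := fun s x =>
    norm_diffQuot_le hf _ _ _ s
  have ibd : Integrable (fun x => ‖η x‖ * (K * (‖p₁ x‖ + ‖p₂ x‖))) volume := by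
    have hp : LocallyIntegrable (fun x => K * (‖p₁ x‖ + ‖p₂ x‖)) volume :=
      ((locallyIntegrable_norm_Lp p₁).add (locallyIntegrable_norm_Lp p₂)).smul (K : ℝ)
    exact hp.integrable_smul_left_of_hasCompactSupport hη.continuous.norm hc.norm
  have q'_norm : ∀ s x, ‖η x • q' s x‖ ≤ ‖η x‖ * (K * (‖p₁ x‖ + ‖p₂ x‖)) := fun s x => by
    rw [norm_smul]
    gcongr
    exact q'_le s x
  have iq' : ∀ s, Integrable (fun x => η x • q' s x) volume := fun s =>
    ibd.mono' (hηL.1.smul (q'_meas s)) (ae_of_all _ (q'_norm s))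
  -- dominated convergence for the replaced quotients
  have lim₂ : Tendsto (fun s => ∫ x, η x • q' s x) l (𝓝 (∫ x, η x • q x)) :=
    tendsto_integral_filter_of_dominated_convergence _
      (Eventually.of_forall fun s => (iq' s).1)
      (Eventually.of_forall fun s => ae_of_all _ (q'_norm s)) ibd
      (hq.mono fun x hx => hx.const_smul (η x))
  have lim₁ : Tendsto (fun s => ∫ x, η x • (Q s x - q' s x)) l (𝓝 0) := by
    have hlim : Tendsto (fun s => K * (‖hηL.toLp‖ * ‖R₁ s‖ + ‖hηL.toLp‖ * ‖R₂ s‖)) l (𝓝 0) := by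
      have a₁ : Tendsto (fun s => ‖R₁ s‖) l (𝓝 0) := by
        have := ((h₁.tendsto_diffQuot.mono_left hl).sub_const p₁).norm
        rwa [sub_self, norm_zero] at this
      have a₂ : Tendsto (fun s => ‖R₂ s‖) l (𝓝 0) := by
        have := ((h₂.tendsto_diffQuot.mono_left hl).sub_const p₂).norm
        rwa [sub_self, norm_zero] at this
      simpa using ((a₁.const_mul ‖hηL.toLp‖).add (a₂.const_mul ‖hηL.toLp‖)).const_mul (K : ℝ)
    refine squeeze_zero_norm' ?_ hlim
    filter_upwards [hl self_mem_nhdsWithin] with s hs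
    have hs0 : s ≠ 0 := hs
    have ib : Integrable (fun x => K * (‖hηL.toLp η x‖ * ‖R₁ s x‖ + ‖hηL.toLp η x‖ * ‖R₂ s x‖))
        volume := ((integrable_norm_mul_norm _ _).add (integrable_norm_mul_norm _ _)).const_mul _
    refine (norm_integral_le_of_norm_le ib ?_).trans ?_
    · filter_upwards [hηL.coeFn_toLp, coeFn_translate (s • e) u₁, coeFn_translate (s • e) u₂,
        Lp.coeFn_sub (s⁻¹ • (translate (s • e) u₁ - u₁)) p₁,
        Lp.coeFn_smul s⁻¹ (translate (s • e) u₁ - u₁), Lp.coeFn_sub (translate (s • e) u₁) u₁,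
        Lp.coeFn_sub (s⁻¹ • (translate (s • e) u₂ - u₂)) p₂,
        Lp.coeFn_smul s⁻¹ (translate (s • e) u₂ - u₂), Lp.coeFn_sub (translate (s • e) u₂) u₂]
        with x e0 e1 e2 a1 a2 a3 b1 b2 b3
      have eR₁ : R₁ s x = s⁻¹ • (u₁ (x + s • e) - u₁ x) - p₁ x := by
        simp only [hR₁, a1, Pi.sub_apply, a2, Pi.smul_apply, a3, e1]
      have eR₂ : R₂ s x = s⁻¹ • (u₂ (x + s • e) - u₂ x) - p₂ x := by
        simp only [hR₂, b1, Pi.sub_apply, b2, Pi.smul_apply, b3, e2]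
      have eQ : Q s x - q' s x = s⁻¹ • (f (u₁ (x + s • e), u₂ (x + s • e))
          - f ((u₁ x, u₂ x) + s • (p₁ x, p₂ x))) := by
        simp only [hQ, hq', hU, ← smul_sub]
        congr 1
        ring
      have ed : (u₁ (x + s • e), u₂ (x + s • e)) - ((u₁ x, u₂ x) + s • (p₁ x, p₂ x))
          = s • (R₁ s x, R₂ s x) := by
        rw [eR₁, eR₂]
        ext <;> simp [smul_sub, hs0] <;> ring
      have hL : ‖f (u₁ (x + s • e), u₂ (x + s • e)) - f ((u₁ x, u₂ x) + s • (p₁ x, p₂ x))‖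
          ≤ K * (‖s‖ * ‖(R₁ s x, R₂ s x)‖) := by
        have := hf.dist_le_mul (u₁ (x + s • e), u₂ (x + s • e))
          ((u₁ x, u₂ x) + s • (p₁ x, p₂ x))
        rwa [dist_eq_norm, dist_eq_norm, ed, norm_smul] at this
      have h2 : ‖(R₁ s x, R₂ s x)‖ ≤ ‖R₁ s x‖ + ‖R₂ s x‖ :=
        max_le (le_add_of_nonneg_right (norm_nonneg _)) (le_add_of_nonneg_left (norm_nonneg _))
      have h3 : ‖Q s x - q' s x‖ ≤ K * (‖R₁ s x‖ + ‖R₂ s x‖) := by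
        rw [eQ, norm_smul, norm_inv, inv_mul_le_iff₀ (norm_pos_iff.2 hs0)]
        calc _ ≤ K * (‖s‖ * ‖(R₁ s x, R₂ s x)‖) := hL
          _ ≤ K * (‖s‖ * (‖R₁ s x‖ + ‖R₂ s x‖)) := by gcongr
          _ = _ := by ring
      rw [norm_smul, e0]
      calc _ ≤ ‖η x‖ * (K * (‖R₁ s x‖ + ‖R₂ s x‖)) := by gcongr
        _ = _ := by ring
    · rw [integral_const_mul, integral_add (integrable_norm_mul_norm _ _)
        (integrable_norm_mul_norm _ _)]
      gcongr <;> exact integral_norm_mul_norm_le _ _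
  have limQ : Tendsto (fun s => ∫ x, η x • Q s x) l (𝓝 (∫ x, η x • q x)) := by
    have := lim₁.add lim₂
    rw [zero_add] at this
    refine this.congr fun s => ?_
    rw [← integral_add]
    · refine integral_congr_ae (ae_of_all _ fun x => ?_)
      simp [smul_sub]
    · refine ((iQ s).sub (iq' s)).congr (ae_of_all _ fun x => ?_)
      simp [smul_sub]
    · exact iq' s
  -- the same quotients, with the difference moved onto the test function
  have limη : Tendsto (fun s => ∫ x, η x • Q s x) l (𝓝 (-∫ x, (fderiv ℝ η x e) • U x)) := by
    have h0 := (hasDerivAt_integral_translate hη hc hUloc e 0).tendsto_slope_zero.mono_left hl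
    simp only [zero_add, zero_smul, sub_zero] at h0
    refine h0.congr fun s => ?_
    rw [← integral_translate, ← integral_sub
      ((hUt s).integrable_smul_left_of_hasCompactSupport hη.continuous hc)
      (hUloc.integrable_smul_left_of_hasCompactSupport hη.continuous hc), ← integral_smul]
    refine integral_congr_ae (ae_of_all _ fun x => ?_)
    simp only [hQ, ← smul_sub]
    rw [smul_comm]
  rw [← tendsto_nhds_unique limη limQ, neg_neg]

/-- The derivative produced by `IsWeakDeriv.comp_lipschitz` is square integrable. -/
lemma memLp_of_tendsto_diffQuot {u₁ u₂ p₁ p₂ : Lp ℂ 2 (volume : Measure (Space d))}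
    {f : ℂ × ℂ → ℂ} {K : NNReal}
    (hf : LipschitzWith K f) {q : Space d → ℂ} {l : Filter ℝ} [l.NeBot] [l.IsCountablyGenerated]
    (hq : ∀ᵐ x, Tendsto (fun s : ℝ =>
      s⁻¹ • (f ((u₁ x, u₂ x) + s • (p₁ x, p₂ x)) - f (u₁ x, u₂ x))) l (𝓝 (q x))) :
    MemLp q 2 volume := by
  have huL : AEStronglyMeasurable (fun x => (u₁ x, u₂ x)) volume :=
    (Lp.aestronglyMeasurable u₁).prodMk (Lp.aestronglyMeasurable u₂)
  have hpL : AEStronglyMeasurable (fun x => (p₁ x, p₂ x)) volume :=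
    (Lp.aestronglyMeasurable p₁).prodMk (Lp.aestronglyMeasurable p₂)
  have hmeas : AEStronglyMeasurable q volume :=
    aestronglyMeasurable_of_tendsto_ae l (fun s =>
      ((hf.continuous.comp_aestronglyMeasurable (huL.add (hpL.const_smul s))).sub
        (hf.continuous.comp_aestronglyMeasurable huL)).const_smul s⁻¹) hq
  refine (((Lp.memLp p₁).norm.add (Lp.memLp p₂).norm).const_mul (K : ℝ)).mono hmeas ?_
  filter_upwards [hq] with x hx
  have h1 := le_of_tendsto hx.norm (Eventually.of_forall fun s =>
    norm_diffQuot_le hf (u₁ x, u₂ x) (p₁ x) (p₂ x) s)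
  refine h1.trans (le_abs_self _)

lemma memLp_comp_lipschitz {u₁ u₂ : Lp ℂ 2 (volume : Measure (Space d))} {f : ℂ × ℂ → ℂ}
    {K : NNReal} (hf : LipschitzWith K f) (h0 : f 0 = 0) :
    MemLp (fun x => f (u₁ x, u₂ x)) 2 volume := by
  refine (((Lp.memLp u₁).norm.add (Lp.memLp u₂).norm).const_mul (K : ℝ)).mono
    (hf.continuous.comp_aestronglyMeasurable
      ((Lp.aestronglyMeasurable u₁).prodMk (Lp.aestronglyMeasurable u₂))) (ae_of_all _ fun x => ?_)
  have h1 : ‖f (u₁ x, u₂ x)‖ ≤ K * ‖(u₁ x, u₂ x)‖ := by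
    simpa [dist_eq_norm, h0] using hf.dist_le_mul (u₁ x, u₂ x) 0
  have h2 : ‖(u₁ x, u₂ x)‖ ≤ ‖u₁ x‖ + ‖u₂ x‖ :=
    max_le (le_add_of_nonneg_right (norm_nonneg _)) (le_add_of_nonneg_left (norm_nonneg _))
  refine (h1.trans ?_).trans (le_abs_self _)
  simp only [Pi.add_apply]
  gcongr

lemma hasDerivAt_norm_add_smul {z : ℂ} (hz : z ≠ 0) (p : ℂ) :
    HasDerivAt (fun s : ℝ => ‖z + s • p‖) ((conj z * p).re / ‖z‖) 0 := by
  have h1 : HasDerivAt (fun s : ℝ => z + s • p) p 0 := by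
    simpa using ((hasDerivAt_id (0 : ℝ)).smul_const p).const_add z
  have h2 := h1.norm_sq.sqrt (by simpa using hz)
  simp only [Real.sqrt_sq (norm_nonneg _), zero_smul, add_zero] at h2
  convert h2 using 1
  rw [real_inner_eq_re_inner ℂ, RCLike.inner_apply, mul_div_mul_left _ _ two_ne_zero, mul_comm]
  rfl

lemma tendsto_diffQuot_norm {l : Filter ℝ} (hl : l ≤ 𝓝[≠] 0) {σ : ℝ}
    (hσ : ∀ᶠ s in l, s⁻¹ * |s| = σ) (z p : ℂ) :
    Tendsto (fun s : ℝ => s⁻¹ • ((‖z + s • p‖ : ℂ) - (‖z‖ : ℂ))) l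
      (𝓝 ((if z = 0 then σ * ‖p‖ else (conj z * p).re / ‖z‖ : ℝ) : ℂ)) := by
  have h : Tendsto (fun s : ℝ => s⁻¹ * (‖z + s • p‖ - ‖z‖)) l
      (𝓝 (if z = 0 then σ * ‖p‖ else (conj z * p).re / ‖z‖)) := by
    split_ifs with hz
    · refine tendsto_const_nhds.congr' ?_
      filter_upwards [hσ] with s hs
      rw [hz, zero_add, norm_zero, sub_zero, norm_smul, Real.norm_eq_abs, ← mul_assoc, hs]
    · have := (hasDerivAt_norm_add_smul hz p).tendsto_slope_zero.mono_left hl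
      simpa using this
  refine ((Complex.continuous_ofReal.tendsto _).comp h).congr fun s => ?_
  simp

lemma lipschitzWith_norm_fst : LipschitzWith 1 (fun z : ℂ × ℂ => ((‖z.1‖ : ℝ) : ℂ)) := by
  have h1 : LipschitzWith 1 (fun x : ℝ => (x : ℂ)) := Complex.isometry_ofReal.lipschitz
  simpa [Function.comp_def] using
    h1.comp (lipschitzWith_one_norm.comp (LipschitzWith.prod_fst (α := ℂ) (β := ℂ)))

/-- The weak derivative of `|u|` computed from one-sided difference quotients: `l` is the right or
left punctured neighbourhood filter of `0` and `σ` the sign of its elements. -/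
lemma IsWeakDeriv.norm_aux {e : Space d} {u p : Lp ℂ 2 (volume : Measure (Space d))}
    (h : IsWeakDeriv e u p) {l : Filter ℝ} [l.NeBot] [l.IsCountablyGenerated] (hl : l ≤ 𝓝[≠] 0)
    {σ : ℝ} (hσ : ∀ᶠ s in l, s⁻¹ * |s| = σ) :
    IsWeakDeriv e (fun x => ((‖u x‖ : ℝ) : ℂ)) (fun x =>
      ((if u x = 0 then σ * ‖p x‖ else (conj (u x) * p x).re / ‖u x‖ : ℝ) : ℂ)) ∧
    MemLp (fun x => ((if u x = 0 then σ * ‖p x‖ else (conj (u x) * p x).re / ‖u x‖ : ℝ) : ℂ))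
      2 volume := by
  have hq : ∀ᵐ x, Tendsto (fun s : ℝ => s⁻¹ • ((fun z : ℂ × ℂ => ((‖z.1‖ : ℝ) : ℂ))
      ((u x, u x) + s • (p x, p x)) - (fun z : ℂ × ℂ => ((‖z.1‖ : ℝ) : ℂ)) (u x, u x))) l
      (𝓝 ((if u x = 0 then σ * ‖p x‖ else (conj (u x) * p x).re / ‖u x‖ : ℝ) : ℂ)) :=
    ae_of_all _ fun x => tendsto_diffQuot_norm hl hσ (u x) (p x)
  exact ⟨h.comp_lipschitz h lipschitzWith_norm_fst hl hq,
    memLp_of_tendsto_diffQuot lipschitzWith_norm_fst hq⟩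

lemma eventually_inv_mul_abs_nhdsGT : ∀ᶠ s : ℝ in 𝓝[>] 0, s⁻¹ * |s| = 1 := by
  filter_upwards [self_mem_nhdsWithin] with s hs
  rw [abs_of_pos hs, inv_mul_cancel₀ (ne_of_gt hs)]

lemma eventually_inv_mul_abs_nhdsLT : ∀ᶠ s : ℝ in 𝓝[<] 0, s⁻¹ * |s| = -1 := by
  filter_upwards [self_mem_nhdsWithin] with s hs
  rw [abs_of_neg hs, mul_neg, inv_mul_cancel₀ (ne_of_lt hs)]

/-- The weak derivative of `u` vanishes almost everywhere on the zero set of `u`: there the right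
and left difference quotients of `|u|` give `|p|` and `-|p|`, and both are the weak derivative. -/
theorem IsWeakDeriv.ae_eq_zero {e : Space d} {u p : Lp ℂ 2 (volume : Measure (Space d))}
    (h : IsWeakDeriv e u p) : ∀ᵐ x, u x = 0 → p x = 0 := by
  obtain ⟨a, a'⟩ := h.norm_aux (nhdsGT_le_nhdsNE 0)
    eventually_inv_mul_abs_nhdsGT
  obtain ⟨b, b'⟩ := h.norm_aux (nhdsLT_le_nhdsNE 0)
    eventually_inv_mul_abs_nhdsLT
  have := ae_eq_of_integral_contDiff_smul_eq (a'.locallyIntegrable (by norm_num))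
    (b'.locallyIntegrable (by norm_num)) fun η hη hc => by
      have e₁ := a η hη hc
      have e₂ := b η hη hc
      rw [e₁] at e₂
      exact neg_injective e₂
  filter_upwards [this] with x hx h0
  rw [if_pos h0, if_pos h0] at hx
  have : (1 : ℝ) * ‖p x‖ = -1 * ‖p x‖ := by exact_mod_cast hx
  exact norm_eq_zero.1 (by linarith)

/-- The weak derivative of `|u|` is `Re(conj(φ) p)`, for any polar factor `φ` of `u`. -/
theorem IsWeakDeriv.norm {e : Space d} {u p : Lp ℂ 2 (volume : Measure (Space d))}
    (h : IsWeakDeriv e u p) {φ : Space d → ℂ} (hφ : ∀ᵐ x, u x = ‖u x‖ * φ x) :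
    IsWeakDeriv e (fun x => ((‖u x‖ : ℝ) : ℂ)) (fun x => (((conj (φ x) * p x).re : ℝ) : ℂ)) := by
  obtain ⟨a, -⟩ := h.norm_aux (nhdsGT_le_nhdsNE 0)
    eventually_inv_mul_abs_nhdsGT
  intro η hη hc
  rw [a η hη hc]
  congr 1
  refine integral_congr_ae ?_
  filter_upwards [hφ, h.ae_eq_zero] with x h1 h2
  congr 2
  split_ifs with h3
  · simp [h2 h3]
  · have h4 : (‖u x‖ : ℂ) ≠ 0 := by simpa using h3
    rw [div_eq_iff (by simpa using h3)]
    conv_lhs => rw [h1, map_mul, Complex.conj_ofReal, mul_assoc, Complex.re_ofReal_mul]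
    ring

end WeakDeriv

end SchrodingerLohe

/-! ### The Sobolev space `H¹` as a Banach space, and its energy forms -/

namespace SchrodingerLohe

section Sobolev

variable {d : ℕ}

/-- `toL2` as a continuous linear map. -/
noncomputable def toL2L (d : ℕ) : H1 d →L[ℂ] Lp ℂ 2 (volume : Measure (Space d)) :=
  (WithLp.fstL 2 ℂ (Lp ℂ 2 (volume : Measure (Space d)))
    (Lp (EuclideanSpace ℂ (Fin d)) 2 (volume : Measure (Space d)))).comp (H1 d).subtypeL

/-- `grad` as a continuous linear map. -/
noncomputable def gradL (d : ℕ) :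
    H1 d →L[ℂ] Lp (EuclideanSpace ℂ (Fin d)) 2 (volume : Measure (Space d)) :=
  (WithLp.sndL 2 ℂ (Lp ℂ 2 (volume : Measure (Space d)))
    (Lp (EuclideanSpace ℂ (Fin d)) 2 (volume : Measure (Space d)))).comp (H1 d).subtypeL

lemma H1.norm_sq (u : H1 d) : ‖u‖ ^ 2 = ‖toL2 u‖ ^ 2 + ‖grad u‖ ^ 2 :=
  WithLp.prod_norm_sq_eq_of_L2 u.1

lemma norm_toL2_le (u : H1 d) : ‖toL2 u‖ ≤ ‖u‖ :=
  abs_le_of_sq_le_sq' (by rw [H1.norm_sq]; nlinarith [sq_nonneg ‖grad u‖]) (norm_nonneg _) |>.2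

lemma norm_grad_le (u : H1 d) : ‖grad u‖ ≤ ‖u‖ :=
  abs_le_of_sq_le_sq' (by rw [H1.norm_sq]; nlinarith [sq_nonneg ‖toL2 u‖]) (norm_nonneg _) |>.2

lemma H1.norm_le_add (u : H1 d) : ‖u‖ ≤ ‖toL2 u‖ + ‖grad u‖ := by
  refine abs_le_of_sq_le_sq' ?_ (by positivity) |>.2
  rw [H1.norm_sq]
  nlinarith [mul_nonneg (norm_nonneg (toL2 u)) (norm_nonneg (grad u))]

/-- The `j`-th coordinate as a continuous linear functional. -/
noncomputable def coordL (d : ℕ) (j : Fin d) : EuclideanSpace ℂ (Fin d) →L[ℂ] ℂ :=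
  EuclideanSpace.proj j

/-- The `j`-th partial derivative of `u`, as an element of `L²`. -/
noncomputable def gradComp (u : H1 d) (j : Fin d) : Lp ℂ 2 (volume : Measure (Space d)) :=
  (coordL d j).compLp (grad u)

lemma coeFn_gradComp (u : H1 d) (j : Fin d) :
    gradComp u j =ᵐ[volume] fun x => grad u x j :=
  ContinuousLinearMap.coeFn_compLp _ _

lemma isWeakDeriv_gradComp (u : H1 d) (j : Fin d) :
    IsWeakDeriv (EuclideanSpace.single j 1) (toL2 u) (gradComp u j) := by
  intro η hη hc
  have h1 : ∫ x, η x • gradComp u j x = ∫ x, η x • grad u x j :=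
    integral_congr_ae (by filter_upwards [coeFn_gradComp u j] with x hx; rw [hx])
  rw [h1]
  exact u.2.integral_eq η hη hc j

/-- The gradient of an `H¹` function vanishes almost everywhere on its zero set. -/
lemma grad_ae_eq_zero (u : H1 d) : ∀ᵐ x, toL2 u x = 0 → grad u x = 0 := by
  have h : ∀ᵐ x, ∀ j, toL2 u x = 0 → grad u x j = 0 := by
    refine ae_all_iff.2 fun j => ?_
    filter_upwards [(isWeakDeriv_gradComp u j).ae_eq_zero, coeFn_gradComp u j] with x h1 h2 h0
    rw [← h2, h1 h0]
  filter_upwards [h] with x hx h0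
  ext j
  simpa using hx j h0

lemma exists_H1 {u : Space d → ℂ} {g : Space d → EuclideanSpace ℂ (Fin d)}
    (hu : MemLp u 2 volume) (hg : MemLp g 2 volume)
    (h : ∀ j, IsWeakDeriv (EuclideanSpace.single j 1) u (fun x => g x j)) :
    ∃ w : H1 d, toL2 w =ᵐ[volume] u ∧ grad w =ᵐ[volume] g := by
  have h0 : HasWeakGradient u g :=
    ⟨hu.locallyIntegrable (by norm_num), hg.locallyIntegrable (by norm_num),
      fun η hη hc j => h j η hη hc⟩
  exact ⟨⟨WithLp.toLp 2 (hu.toLp u, hg.toLp g),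
    h0.congr hu.coeFn_toLp.symm hg.coeFn_toLp.symm⟩, hu.coeFn_toLp, hg.coeFn_toLp⟩

lemma continuous_integral_smul {φ : Space d → ℝ} (hφ : Continuous φ) (hc : HasCompactSupport φ) :
    Continuous fun u : Lp ℂ 2 (volume : Measure (Space d)) => ∫ x, φ x • u x := by
  have hL : MemLp (fun x => (φ x : ℂ)) 2 volume :=
    (Complex.continuous_ofReal.comp hφ).memLp_of_hasCompactSupport
      (hc.comp_left (g := ((↑) : ℝ → ℂ)) rfl)
  have h : (fun u : Lp ℂ 2 (volume : Measure (Space d)) => ∫ x, φ x • u x)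
      = fun u => inner ℂ (hL.toLp) u := by
    funext u
    rw [L2.inner_def]
    refine integral_congr_ae ?_
    filter_upwards [hL.coeFn_toLp] with x hx
    rw [hx, RCLike.inner_apply]
    simp [mul_comm]
  rw [h]
  fun_prop

/-- The defining identities of the weak gradient pass to `L²` limits, so `H¹` is closed. -/
instance : CompleteSpace (H1 d) := by
  have hclosed : IsClosed (H1 d : Set (WithLp 2 (Lp ℂ 2 (volume : Measure (Space d)) ×
      Lp (EuclideanSpace ℂ (Fin d)) 2 (volume : Measure (Space d))))) := by
    have hset : (H1 d : Set (WithLp 2 (Lp ℂ 2 (volume : Measure (Space d)) ×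
        Lp (EuclideanSpace ℂ (Fin d)) 2 (volume : Measure (Space d)))))
        = ⋂ (η : Space d → ℝ) (_ : ContDiff ℝ ∞ η) (_ : HasCompactSupport η) (j : Fin d),
          {w | ∫ x, (fderiv ℝ η x (EuclideanSpace.single j 1)) • w.fst x
            = -∫ x, η x • (coordL d j).compLpL 2 volume w.snd x} := by
      ext w
      simp only [mem_iInter, mem_ofPred_eq]
      have e : ∀ (η : Space d → ℝ) (j : Fin d),
          ∫ x, η x • (coordL d j).compLpL 2 volume w.snd x = ∫ x, η x • w.snd x j := by
        intro η j
        refine integral_congr_ae ?_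
        filter_upwards [ContinuousLinearMap.coeFn_compLpL (p := 2) (μ := volume)
          (coordL d j) w.snd] with x hx
        rw [hx]
        rfl
      simp only [e]
      exact ⟨fun h η hη hc j => h.integral_eq η hη hc j, fun h =>
        ⟨locallyIntegrable_Lp _, locallyIntegrable_Lp _, fun η hη hc j => h η hη hc j⟩⟩
    rw [hset]
    refine isClosed_iInter fun η => isClosed_iInter fun hη => isClosed_iInter fun hc =>
      isClosed_iInter fun j => isClosed_eq ?_ ?_
    · exact (continuous_integral_smul
        ((hη.continuous_fderiv (by simp)).clm_apply continuous_const)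
        (hc.fderiv_apply (𝕜 := ℝ) _)).comp (WithLp.fstL 2 ℂ _ _).continuous
    · exact ((continuous_integral_smul hη.continuous hc).comp
        (((coordL d j).compLpL 2
          volume).continuous.comp (WithLp.sndL 2 ℂ _ _).continuous)).neg
  exact hclosed.completeSpace_coe

/-- The `L²` inner product as a form on `H¹`. -/
noncomputable def pivotForm (d : ℕ) : H1 d →L⋆[ℂ] H1 d →L[ℂ] ℂ :=
  (innerSL ℂ).bilinearComp (toL2L d) (toL2L d)

@[simp] lemma pivotForm_apply (w u : H1 d) : pivotForm d w u = inner ℂ (toL2 w) (toL2 u) := rfl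

lemma conj_pivotForm (w u : H1 d) : conj (pivotForm d w u) = pivotForm d u w := by
  rw [pivotForm_apply, pivotForm_apply, inner_conj_symm]

variable {V : Space d → ℝ}

lemma HasEnergySpaceH1.integrable_abs (hV : HasEnergySpaceH1 V) (u : H1 d) :
    Integrable (fun x => |V x| * ‖toL2 u x‖ ^ 2) volume := by
  refine (hV.integrable u).norm.congr (ae_of_all _ fun x => ?_)
  simp

lemma norm_potential_le (V : Space d → ℝ) (w u : H1 d) (x : Space d) {a : ℝ} (ha : 0 < a) :
    ‖(V x : ℂ) * (conj (toL2 w x) * toL2 u x)‖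
      ≤ a / 2 * (|V x| * ‖toL2 w x‖ ^ 2) + a⁻¹ / 2 * (|V x| * ‖toL2 u x‖ ^ 2) := by
  simp only [norm_mul, Complex.norm_real, Real.norm_eq_abs, RCLike.norm_conj]
  have h : ‖toL2 w x‖ * ‖toL2 u x‖ ≤ a / 2 * ‖toL2 w x‖ ^ 2 + a⁻¹ / 2 * ‖toL2 u x‖ ^ 2 := by
    have h1 : 0 ≤ a⁻¹ * (a * ‖toL2 w x‖ - ‖toL2 u x‖) ^ 2 := by positivity
    have h2 : a⁻¹ * (a * ‖toL2 w x‖ - ‖toL2 u x‖) ^ 2 = a * ‖toL2 w x‖ ^ 2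
      - 2 * (‖toL2 w x‖ * ‖toL2 u x‖) + a⁻¹ * ‖toL2 u x‖ ^ 2 := by
      field_simp
      ring
    linarith
  calc _ ≤ |V x| * (a / 2 * ‖toL2 w x‖ ^ 2 + a⁻¹ / 2 * ‖toL2 u x‖ ^ 2) := by gcongr
    _ = _ := by ring

lemma HasEnergySpaceH1.integrable_mul (hV : HasEnergySpaceH1 V) (w u : H1 d) :
    Integrable (fun x => (V x : ℂ) * (conj (toL2 w x) * toL2 u x)) volume := by
  refine (((hV.integrable_abs w).const_mul (1 / 2)).add
    ((hV.integrable_abs u).const_mul (1⁻¹ / 2))).mono' ?_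
    (ae_of_all _ fun x => norm_potential_le V w u x one_pos)
  exact (Complex.continuous_ofReal.comp_aestronglyMeasurable hV.aestronglyMeasurable).mul
    ((Complex.continuous_conj.comp_aestronglyMeasurable (Lp.aestronglyMeasurable _)).mul
      (Lp.aestronglyMeasurable _))

lemma toL2_add (u w : H1 d) : toL2 (u + w) = toL2 u + toL2 w := rfl

lemma toL2_smul (c : ℂ) (u : H1 d) : toL2 (c • u) = c • toL2 u := rfl

/-- The potential energy `∫ V conj(w) u` as a function of two elements of `H¹`. -/
noncomputable def potentialPairing (V : Space d → ℝ) (w u : H1 d) : ℂ :=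
  ∫ x, (V x : ℂ) * (conj (toL2 w x) * toL2 u x)

lemma conj_potentialPairing (V : Space d → ℝ) (w u : H1 d) :
    conj (potentialPairing V w u) = potentialPairing V u w := by
  unfold potentialPairing
  rw [← integral_conj]
  congr 1
  funext x
  simp [mul_comm]

lemma potentialPairing_add_right (hV : HasEnergySpaceH1 V) (w u u' : H1 d) :
    potentialPairing V w (u + u') = potentialPairing V w u + potentialPairing V w u' := by
  unfold potentialPairing
  rw [← integral_add (hV.integrable_mul _ _) (hV.integrable_mul _ _)]
  refine integral_congr_ae ?_
  filter_upwards [Lp.coeFn_add (toL2 u) (toL2 u')] with x hx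
  rw [toL2_add, hx, Pi.add_apply]
  ring

lemma potentialPairing_smul_right (V : Space d → ℝ) (c : ℂ) (w u : H1 d) :
    potentialPairing V w (c • u) = c * potentialPairing V w u := by
  unfold potentialPairing
  rw [← integral_const_mul]
  refine integral_congr_ae ?_
  filter_upwards [Lp.coeFn_smul c (toL2 u)] with x hx
  rw [toL2_smul, hx, Pi.smul_apply, smul_eq_mul]
  ring

lemma potentialPairing_zero_right (V : Space d → ℝ) (w : H1 d) : potentialPairing V w 0 = 0 := by
  have h := potentialPairing_smul_right V 0 w 0
  rwa [zero_smul, zero_mul] at h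

lemma HasEnergySpaceH1.exists_pairing_bound (hV : HasEnergySpaceH1 V) :
    ∃ C : ℝ, ∀ w u : H1 d, ‖potentialPairing V w u‖ ≤ C * ‖w‖ * ‖u‖ := by
  obtain ⟨C, hC⟩ := hV.bounded
  refine ⟨C, fun w u => ?_⟩
  by_cases hu : u = 0
  · rw [hu, potentialPairing_zero_right, norm_zero, norm_zero, mul_zero]
  by_cases hw : w = 0
  · rw [hw, ← conj_potentialPairing, potentialPairing_zero_right, map_zero, norm_zero, norm_zero,
      mul_zero, zero_mul]
  have hw' : 0 < ‖w‖ := norm_pos_iff.2 hw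
  have hu' : 0 < ‖u‖ := norm_pos_iff.2 hu
  -- the weight that balances the two halves of the arithmetic-geometric mean inequality
  obtain ⟨a, ha⟩ : ∃ a, a = ‖u‖ / ‖w‖ := ⟨_, rfl⟩
  have ha0 : 0 < a := by rw [ha]; positivity
  have h1 : ‖potentialPairing V w u‖ ≤ ∫ x, (a / 2 * (|V x| * ‖toL2 w x‖ ^ 2)
      + a⁻¹ / 2 * (|V x| * ‖toL2 u x‖ ^ 2)) := by
    unfold potentialPairing
    exact norm_integral_le_of_norm_le (((hV.integrable_abs w).const_mul _).add
      ((hV.integrable_abs u).const_mul _)) (ae_of_all _ fun x => norm_potential_le V w u x ha0)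
  rw [integral_add ((hV.integrable_abs w).const_mul _) ((hV.integrable_abs u).const_mul _),
    integral_const_mul, integral_const_mul] at h1
  have h2 : a / 2 * (C * ‖w‖ ^ 2) + a⁻¹ / 2 * (C * ‖u‖ ^ 2) = C * ‖w‖ * ‖u‖ := by
    rw [ha]
    field_simp
    ring
  rw [← h2]
  exact h1.trans (add_le_add (mul_le_mul_of_nonneg_left (hC w) (by positivity))
    (mul_le_mul_of_nonneg_left (hC u) (by positivity)))

/-- The potential energy `∫ V conj(w) u` as a sesquilinear form. -/
noncomputable def potentialFormAux (hV : HasEnergySpaceH1 V) : H1 d →ₗ⋆[ℂ] H1 d →ₗ[ℂ] ℂ :=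
  LinearMap.mk₂'ₛₗ (starRingEnd ℂ) (RingHom.id ℂ) (potentialPairing V)
    (fun w w' u => by
      rw [← conj_potentialPairing, potentialPairing_add_right hV, map_add, conj_potentialPairing,
        conj_potentialPairing])
    (fun c w u => by
      rw [← conj_potentialPairing, potentialPairing_smul_right, map_mul, conj_potentialPairing,
        smul_eq_mul])
    (potentialPairing_add_right hV) (fun c w u => potentialPairing_smul_right V c w u)

lemma exists_potentialForm_bound (hV : HasEnergySpaceH1 V) :
    ∃ C : ℝ, ∀ w u : H1 d, ‖potentialFormAux hV w u‖ ≤ C * ‖w‖ * ‖u‖ :=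
  hV.exists_pairing_bound

/-- The energy form `½ ∫ conj(∇w) · ∇u + ∫ V conj(w) u` as a continuous sesquilinear form. It is
definitionally equal to `hamiltonianForm V`. -/
noncomputable def energyForm (hV : HasEnergySpaceH1 V) : H1 d →L⋆[ℂ] H1 d →L[ℂ] ℂ :=
  (1 / 2 : ℂ) • (innerSL ℂ).bilinearComp (gradL d) (gradL d)
    + (potentialFormAux hV).mkContinuous₂ (exists_potentialForm_bound hV).choose
      (exists_potentialForm_bound hV).choose_spec

lemma conj_energyForm (hV : HasEnergySpaceH1 V) (w u : H1 d) :
    conj (energyForm hV w u) = energyForm hV u w := by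
  have h : ∀ w u, energyForm hV w u
      = 1 / 2 * inner ℂ (grad w) (grad u) + potentialPairing V w u := fun _ _ => rfl
  have h2 : conj (1 / 2 : ℂ) = 1 / 2 := by
    rw [map_div₀, map_one, Complex.conj_ofNat]
  rw [h, h, map_add, map_mul, inner_conj_symm, conj_potentialPairing, h2]

end Sobolev

end SchrodingerLohe

/-! ### A logarithmic cutoff of the ratio of two functions -/

namespace SchrodingerLohe

section Cutoff

/-- `|w|² / (|z|² + |w|² + c)`; the positive `c` regularizes the ratio at the origin. -/
noncomputable def ratio (c : ℝ) (z w : ℂ) : ℝ := ‖w‖ ^ 2 / (‖z‖ ^ 2 + ‖w‖ ^ 2 + c)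

/-- The derivative of `ratio c` at `(z, w)` in the direction `(ζ, ξ)`. -/
noncomputable def ratioDeriv (c : ℝ) (z w ζ ξ : ℂ) : ℝ :=
  (2 * inner ℝ w ξ * (‖z‖ ^ 2 + c) - ‖w‖ ^ 2 * (2 * inner ℝ z ζ)) / (‖z‖ ^ 2 + ‖w‖ ^ 2 + c) ^ 2

lemma ratio_mem_Icc {c : ℝ} (hc : 0 ≤ c) (z w : ℂ) : ratio c z w ∈ Icc (0 : ℝ) 1 := by
  refine ⟨by unfold ratio; positivity, div_le_one_of_le₀ ?_ (by positivity)⟩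
  nlinarith [sq_nonneg ‖z‖]

lemma hasDerivAt_ratio {c : ℝ} {Z W : ℝ → ℂ} {ζ ξ : ℂ} {s : ℝ} (hZ : HasDerivAt Z ζ s)
    (hW : HasDerivAt W ξ s) (h0 : ‖Z s‖ ^ 2 + ‖W s‖ ^ 2 + c ≠ 0) :
    HasDerivAt (fun s => ratio c (Z s) (W s)) (ratioDeriv c (Z s) (W s) ζ ξ) s := by
  have h := hW.norm_sq.div ((hZ.norm_sq.add hW.norm_sq).add_const c) h0
  refine h.congr_deriv ?_
  unfold ratioDeriv
  simp only [Pi.add_apply]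
  congr 1
  ring

/-- The bound does not depend on `c`. The factor `ratio c z w` in front of `‖ζ‖` is what makes a
profile with small logarithmic derivative useful. -/
lemma abs_ratioDeriv_mul_le {c : ℝ} (hc : 0 ≤ c) (z w ζ ξ : ℂ) :
    |ratioDeriv c z w ζ ξ| * ‖z‖ ≤ ‖ξ‖ + 2 * ratio c z w * ‖ζ‖ := by
  unfold ratioDeriv ratio
  set A := ‖z‖ with hA
  set B := ‖w‖ with hB
  have A0 : 0 ≤ A := norm_nonneg z
  have B0 : 0 ≤ B := norm_nonneg w
  rcases (by positivity : 0 ≤ A ^ 2 + B ^ 2 + c).eq_or_lt with h | hS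
  · rw [← h]; simp
  have h1 : |(inner ℝ w ξ : ℝ)| ≤ B * ‖ξ‖ := abs_real_inner_le_norm _ _
  have h2 : |(inner ℝ z ζ : ℝ)| ≤ A * ‖ζ‖ := abs_real_inner_le_norm _ _
  have h3 : |2 * inner ℝ w ξ * (A ^ 2 + c) - B ^ 2 * (2 * inner ℝ z ζ)|
      ≤ 2 * (B * ‖ξ‖) * (A ^ 2 + c) + B ^ 2 * (2 * (A * ‖ζ‖)) := by
    refine (abs_sub _ _).trans ?_
    rw [abs_mul, abs_mul, abs_mul, abs_mul, abs_of_pos (zero_lt_two' ℝ),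
      abs_of_nonneg (by positivity : 0 ≤ A ^ 2 + c), abs_of_nonneg (by positivity : 0 ≤ B ^ 2)]
    gcongr
  rw [abs_div, abs_of_pos (by positivity : 0 < (A ^ 2 + B ^ 2 + c) ^ 2), div_mul_eq_mul_div,
    div_le_iff₀ (by positivity)]
  have h4 : (‖ξ‖ + 2 * (B ^ 2 / (A ^ 2 + B ^ 2 + c)) * ‖ζ‖) * (A ^ 2 + B ^ 2 + c) ^ 2
      = ‖ξ‖ * (A ^ 2 + B ^ 2 + c) ^ 2 + 2 * B ^ 2 * ‖ζ‖ * (A ^ 2 + B ^ 2 + c) := by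
    field_simp
  rw [h4]
  have h5 : 2 * (A * B) * (A ^ 2 + c) ≤ (A ^ 2 + B ^ 2 + c) ^ 2 := by
    rw [sq (A ^ 2 + B ^ 2 + c)]
    gcongr
    · nlinarith [sq_nonneg (A - B)]
    · nlinarith [sq_nonneg B]
  have h6 : A * A ≤ A ^ 2 + B ^ 2 + c := by nlinarith [sq_nonneg B]
  calc _ ≤ (2 * (B * ‖ξ‖) * (A ^ 2 + c) + B ^ 2 * (2 * (A * ‖ζ‖))) * A := by gcongr
    _ = ‖ξ‖ * (2 * (A * B) * (A ^ 2 + c)) + 2 * B ^ 2 * ‖ζ‖ * (A * A) := by ring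
    _ ≤ _ := by gcongr

/-- `G (ratio) z`, the value `z` cut off by a function of the ratio. -/
noncomputable def cutoffMap (G : ℝ → ℝ) (c : ℝ) (p : ℂ × ℂ) : ℂ := (G (ratio c p.1 p.2) : ℂ) * p.1

/-- The derivative of `cutoffMap G c`, where `G'` is the derivative of `G`. -/
noncomputable def cutoffDeriv (G G' : ℝ → ℝ) (c : ℝ) (z w ζ ξ : ℂ) : ℂ :=
  (G (ratio c z w) : ℂ) * ζ + ((G' (ratio c z w) * ratioDeriv c z w ζ ξ : ℝ) : ℂ) * z

variable {G G' : ℝ → ℝ}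

lemma hasDerivAt_cutoffMap (hG : ∀ r ∈ Icc (0 : ℝ) 1, HasDerivAt G (G' r) r) {c : ℝ} (hc : 0 ≤ c)
    (p v : ℂ × ℂ) (s : ℝ) (h0 : ‖(p + s • v).1‖ ^ 2 + ‖(p + s • v).2‖ ^ 2 + c ≠ 0) :
    HasDerivAt (fun s : ℝ => cutoffMap G c (p + s • v))
      (cutoffDeriv G G' c (p + s • v).1 (p + s • v).2 v.1 v.2) s := by
  have hZ : HasDerivAt (fun s : ℝ => (p + s • v).1) v.1 s := by
    simpa using ((hasDerivAt_id s).smul_const v.1).const_add p.1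
  have hW : HasDerivAt (fun s : ℝ => (p + s • v).2) v.2 s := by
    simpa using ((hasDerivAt_id s).smul_const v.2).const_add p.2
  have h1 := ((hG _ (ratio_mem_Icc hc _ _)).comp s (hasDerivAt_ratio hZ hW h0)).ofReal_comp.mul hZ
  refine h1.congr_deriv ?_
  simp only [cutoffDeriv, Function.comp_apply]
  ring

lemma lipschitzWith_cutoffMap_of_pos {M₀ M₁ : NNReal}
    (hG : ∀ r ∈ Icc (0 : ℝ) 1, HasDerivAt G (G' r) r)
    (h₀ : ∀ r ∈ Icc (0 : ℝ) 1, |G r| ≤ M₀) (h₁ : ∀ r ∈ Icc (0 : ℝ) 1, |G' r| ≤ M₁)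
    {c : ℝ} (hc : 0 < c) : LipschitzWith (M₀ + M₁ * 3) (cutoffMap G c) := by
  refine LipschitzWith.of_dist_le_mul fun q p => ?_
  have hder : ∀ s ∈ Icc (0 : ℝ) 1, HasDerivWithinAt
      (fun s : ℝ => cutoffMap G c (p + s • (q - p)))
      (cutoffDeriv G G' c (p + s • (q - p)).1 (p + s • (q - p)).2 (q - p).1 (q - p).2)
      (Icc 0 1) s := fun s _ =>
    (hasDerivAt_cutoffMap hG hc.le p (q - p) s (by positivity)).hasDerivWithinAt
  have hbd : ∀ s ∈ Ico (0 : ℝ) 1,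
      ‖cutoffDeriv G G' c (p + s • (q - p)).1 (p + s • (q - p)).2 (q - p).1 (q - p).2‖
        ≤ (M₀ + M₁ * 3) * ‖q - p‖ := by
    intro s _
    set z := (p + s • (q - p)).1
    set w := (p + s • (q - p)).2
    have hr := ratio_mem_Icc hc.le z w
    have e1 : ‖(q - p).1‖ ≤ ‖q - p‖ := norm_fst_le _
    have e2 : ‖(q - p).2‖ ≤ ‖q - p‖ := norm_snd_le _
    have e3 := abs_ratioDeriv_mul_le hc.le z w (q - p).1 (q - p).2
    have e4 : 2 * ratio c z w * ‖(q - p).1‖ ≤ 2 * 1 * ‖q - p‖ := by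
      gcongr
      exact hr.2
    calc _ ≤ ‖(G (ratio c z w) : ℂ) * (q - p).1‖
          + ‖((G' (ratio c z w) * ratioDeriv c z w (q - p).1 (q - p).2 : ℝ) : ℂ) * z‖ :=
          norm_add_le _ _
      _ = |G (ratio c z w)| * ‖(q - p).1‖
          + |G' (ratio c z w)| * (|ratioDeriv c z w (q - p).1 (q - p).2| * ‖z‖) := by
          rw [norm_mul, norm_mul, Complex.norm_real, Complex.norm_real, Real.norm_eq_abs,
            Real.norm_eq_abs, abs_mul, mul_assoc]
      _ ≤ M₀ * ‖q - p‖ + M₁ * (‖q - p‖ + 2 * 1 * ‖q - p‖) := by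
          gcongr
          · exact h₀ _ hr
          · exact h₁ _ hr
          · exact e3.trans (by gcongr)
      _ = _ := by ring
  have := norm_image_sub_le_of_norm_deriv_le_segment_01' hder hbd
  simpa [dist_eq_norm] using this

/-- The Lipschitz constant of the regularized maps does not depend on `c`, which tends to `0`. -/
lemma lipschitzWith_cutoffMap {M₀ M₁ : NNReal}
    (hG : ∀ r ∈ Icc (0 : ℝ) 1, HasDerivAt G (G' r) r)
    (h₀ : ∀ r ∈ Icc (0 : ℝ) 1, |G r| ≤ M₀) (h₁ : ∀ r ∈ Icc (0 : ℝ) 1, |G' r| ≤ M₁) :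
    LipschitzWith (M₀ + M₁ * 3) (cutoffMap G 0) := by
  have lim : ∀ p, Tendsto (fun c => cutoffMap G c p) (𝓝[>] 0) (𝓝 (cutoffMap G 0 p)) := by
    intro p
    by_cases hp : p.1 = 0
    · simp [cutoffMap, hp]
    have h0 : ‖p.1‖ ^ 2 + ‖p.2‖ ^ 2 + 0 ≠ 0 := by positivity
    have h1 : Tendsto (fun c => ratio c p.1 p.2) (𝓝 0) (𝓝 (ratio 0 p.1 p.2)) := by
      unfold ratio
      exact tendsto_const_nhds.div (tendsto_const_nhds.add tendsto_id) h0
    have h2 : Tendsto (fun c => G (ratio c p.1 p.2)) (𝓝 0) (𝓝 (G (ratio 0 p.1 p.2))) :=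
      (hG _ (ratio_mem_Icc le_rfl _ _)).continuousAt.tendsto.comp h1
    exact (((Complex.continuous_ofReal.tendsto _).comp h2).mul_const p.1).mono_left
      nhdsWithin_le_nhds
  refine LipschitzWith.of_dist_le_mul fun q p => ?_
  refine le_of_tendsto ((lim q).dist (lim p)) ?_
  filter_upwards [self_mem_nhdsWithin] with c hc
  exact (lipschitzWith_cutoffMap_of_pos hG h₀ h₁ hc).dist_le_mul q p

variable {d : ℕ}

/-- Cutting off `a ∈ H¹` by a function of the ratio of `|b|²` to `|a|² + |b|²` gives an element
of `H¹`, with the expected gradient. On the common zero set of `a` and `b`, where the ratio is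
singular, both gradients vanish. -/
theorem exists_H1_cutoff {M₀ M₁ : NNReal} (hG : ∀ r ∈ Icc (0 : ℝ) 1, HasDerivAt G (G' r) r)
    (h₀ : ∀ r ∈ Icc (0 : ℝ) 1, |G r| ≤ M₀) (h₁ : ∀ r ∈ Icc (0 : ℝ) 1, |G' r| ≤ M₁) (a b : H1 d) :
    ∃ w : H1 d, (toL2 w =ᵐ[volume] fun x => cutoffMap G 0 (toL2 a x, toL2 b x)) ∧
      grad w =ᵐ[volume] fun x => WithLp.toLp 2 fun j =>
        cutoffDeriv G G' 0 (toL2 a x) (toL2 b x) (grad a x j) (grad b x j) := by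
  have hL := lipschitzWith_cutoffMap hG h₀ h₁
  have hq : ∀ j, ∀ᵐ x, Tendsto (fun s : ℝ => s⁻¹ • (cutoffMap G 0
      ((toL2 a x, toL2 b x) + s • (gradComp a j x, gradComp b j x))
        - cutoffMap G 0 (toL2 a x, toL2 b x))) (𝓝[≠] 0)
      (𝓝 (cutoffDeriv G G' 0 (toL2 a x) (toL2 b x) (grad a x j) (grad b x j))) := by
    intro j
    filter_upwards [coeFn_gradComp a j, coeFn_gradComp b j, grad_ae_eq_zero a, grad_ae_eq_zero b]
      with x ha hb ha0 hb0
    rw [ha, hb]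
    by_cases h : toL2 a x = 0 ∧ toL2 b x = 0
    · rw [ha0 h.1, hb0 h.2, h.1, h.2]
      simp [cutoffMap, cutoffDeriv]
    have h0 : ‖toL2 a x‖ ^ 2 + ‖toL2 b x‖ ^ 2 + 0 ≠ 0 := by
      rcases not_and_or.1 h with h | h <;> positivity
    have := (hasDerivAt_cutoffMap hG le_rfl (toL2 a x, toL2 b x) (grad a x j, grad b x j) 0
      (by simpa using h0)).tendsto_slope_zero
    simpa using this
  refine exists_H1 (memLp_comp_lipschitz hL (by simp [cutoffMap]))
    (MemLp.of_eval_piLp fun j => memLp_of_tendsto_diffQuot hL (hq j)) fun j => ?_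
  exact (isWeakDeriv_gradComp a j).comp_lipschitz (isWeakDeriv_gradComp b j) hL le_rfl (hq j)

/-- The logarithmic cutoff `log (1 + r / κ) / log (1 + 1 / κ)`, which has a small logarithmic
derivative for small `κ`. -/
noncomputable def logCutoff (κ r : ℝ) : ℝ := Real.log (1 + r / κ) / Real.log (1 + 1 / κ)

lemma log_one_add_inv_pos {κ : ℝ} (hκ : 0 < κ) : 0 < Real.log (1 + 1 / κ) :=
  Real.log_pos (by have : 0 < 1 / κ := by positivity
                   linarith)

lemma hasDerivAt_logCutoff {κ r : ℝ} (hκ : 0 < κ) (hr : 0 ≤ r) :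
    HasDerivAt (logCutoff κ) (1 / (κ + r) / Real.log (1 + 1 / κ)) r := by
  have h0 : 1 + r / κ ≠ 0 := by positivity
  have h := ((((hasDerivAt_id r).div_const κ).const_add 1).log h0).div_const (Real.log (1 + 1 / κ))
  refine h.congr_deriv ?_
  have : κ + r ≠ 0 := by positivity
  simp only [id]
  field_simp

lemma logCutoff_mem_Icc {κ r : ℝ} (hκ : 0 < κ) (hr : r ∈ Icc (0 : ℝ) 1) :
    logCutoff κ r ∈ Icc (0 : ℝ) 1 := by
  have hL := log_one_add_inv_pos hκ
  have h0 : 0 ≤ r / κ := div_nonneg hr.1 hκ.le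
  refine ⟨div_nonneg (Real.log_nonneg (by linarith)) hL.le, div_le_one_of_le₀ ?_ hL.le⟩
  gcongr
  exact hr.2

lemma logCutoff_le {κ r : ℝ} (hκ : 0 < κ) (hr : 0 ≤ r) :
    logCutoff κ r ≤ r / (κ * Real.log (1 + 1 / κ)) := by
  have hL := log_one_add_inv_pos hκ
  have h1 : Real.log (1 + r / κ) ≤ r / κ := by
    have := Real.log_le_sub_one_of_pos (by positivity : 0 < 1 + r / κ)
    linarith
  rw [logCutoff, ← div_div]
  gcongr

lemma half_le_logCutoff {δ r : ℝ} (hδ : 0 < δ) (hr : δ ≤ r) : 1 / 2 ≤ logCutoff (δ ^ 2) r := by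
  have hL := log_one_add_inv_pos (by positivity : 0 < δ ^ 2)
  rw [logCutoff, le_div_iff₀ hL]
  have h1 : Real.log (1 + 1 / δ ^ 2) ≤ Real.log ((1 + 1 / δ) ^ 2) := by
    gcongr
    have : 0 < 1 / δ := by positivity
    have e : 1 / δ ^ 2 = (1 / δ) ^ 2 := by rw [div_pow, one_pow]
    rw [e]
    nlinarith
  have h2 : Real.log (1 + 1 / δ) ≤ Real.log (1 + r / δ ^ 2) := by
    have : 1 / δ ≤ r / δ ^ 2 := by
      rw [div_le_div_iff₀ hδ (by positivity)]
      nlinarith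
    gcongr
  rw [Real.log_pow] at h1
  push_cast at h1
  linarith

end Cutoff

end SchrodingerLohe

/-! ### Localization of the energy -/

namespace SchrodingerLohe

section Localization

variable {d : ℕ}

lemma norm_toLp_le_add {ζ ξ : EuclideanSpace ℂ (Fin d)} {T : Fin d → ℂ} {α β : ℝ} (hα : 0 ≤ α)
    (hβ : 0 ≤ β) (h : ∀ j, ‖T j‖ ≤ α * ‖ξ j‖ + β * ‖ζ j‖) :
    ‖(WithLp.toLp 2 T : EuclideanSpace ℂ (Fin d))‖ ≤ α * ‖ξ‖ + β * ‖ζ‖ := by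
  set X : EuclideanSpace ℝ (Fin d) := WithLp.toLp 2 fun j => ‖ξ j‖ with hX
  set Z : EuclideanSpace ℝ (Fin d) := WithLp.toLp 2 fun j => ‖ζ j‖ with hZ
  have eX : ‖X‖ = ‖ξ‖ := by simp [EuclideanSpace.norm_eq, hX]
  have eZ : ‖Z‖ = ‖ζ‖ := by simp [EuclideanSpace.norm_eq, hZ]
  have h1 : ‖(WithLp.toLp 2 T : EuclideanSpace ℂ (Fin d))‖ ≤ ‖α • X + β • Z‖ := by
    rw [EuclideanSpace.norm_eq, EuclideanSpace.norm_eq]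
    gcongr with j
    simp only [PiLp.add_apply, PiLp.smul_apply, hX, hZ, smul_eq_mul]
    exact (h j).trans (le_abs_self _)
  calc _ ≤ ‖α • X‖ + ‖β • Z‖ := h1.trans (norm_add_le _ _)
    _ = _ := by rw [norm_smul, norm_smul, Real.norm_of_nonneg hα, Real.norm_of_nonneg hβ, eX, eZ]

/-- The pointwise properties of a localization of `a` to the set where `b` is not much smaller
than `a`: `u = σ a` and `w = σ² a` with a cutoff `0 ≤ σ ≤ 1`, and `T = a ∇σ`. The cutoff exceeds
`1 / 2` where `|b|² ≥ δ (|a|² + |b|²)`. The constant `α` may be large, since it only multiplies the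
small function `b`, but `β` has to be small. -/
structure IsLocalization (a b u w : H1 d) (σ : Space d → ℝ)
    (T : Lp (EuclideanSpace ℂ (Fin d)) 2 (volume : Measure (Space d))) (α β δ : ℝ) : Prop where
  toL2_fst : ∀ᵐ x, toL2 u x = σ x * toL2 a x
  toL2_snd : ∀ᵐ x, toL2 w x = (σ x : ℂ) ^ 2 * toL2 a x
  grad_fst : ∀ᵐ x, grad u x = (σ x : ℂ) • grad a x + T x
  grad_snd : ∀ᵐ x, grad w x = (σ x : ℂ) ^ 2 • grad a x + (2 * σ x : ℂ) • T x
  mem_Icc : ∀ᵐ x, σ x ∈ Icc (0 : ℝ) 1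
  mul_norm_le : ∀ᵐ x, σ x * ‖toL2 a x‖ ≤ α * ‖toL2 b x‖
  norm_le : ∀ᵐ x, ‖T x‖ ≤ α * ‖grad b x‖ + β * ‖grad a x‖
  half_le : ∀ᵐ x, toL2 a x ≠ 0 ∨ toL2 b x ≠ 0 →
    δ * (‖toL2 a x‖ ^ 2 + ‖toL2 b x‖ ^ 2) ≤ ‖toL2 b x‖ ^ 2 → 1 / 2 ≤ σ x

/-- Localization by a cutoff profile `g` of the ratio of `|b|²` to `|a|² + |b|²`. -/
theorem exists_isLocalization_of_profile (a b : H1 d) {g g' : ℝ → ℝ} {α β δ : ℝ} (hα : 0 ≤ α)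
    (hβ : 0 ≤ β) (hgmeas : Measurable g)
    (hd : ∀ r ∈ Icc (0 : ℝ) 1, HasDerivAt g (g' r) r)
    (hgm : ∀ r ∈ Icc (0 : ℝ) 1, g r ∈ Icc (0 : ℝ) 1)
    (g'_nonneg : ∀ r ∈ Icc (0 : ℝ) 1, 0 ≤ g' r) (g'_le : ∀ r ∈ Icc (0 : ℝ) 1, g' r ≤ α)
    (g'_log : ∀ r ∈ Icc (0 : ℝ) 1, 2 * (g' r * r) ≤ β)
    (g_le : ∀ r ∈ Icc (0 : ℝ) 1, g r ≤ α * r)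
    (g_half : ∀ r ∈ Icc (0 : ℝ) 1, δ ≤ r → 1 / 2 ≤ g r) :
    ∃ u w σ T, IsLocalization a b u w σ T α β δ := by
  have hd2 : ∀ r ∈ Icc (0 : ℝ) 1, HasDerivAt (fun r => g r ^ 2) (2 * g r * g' r) r := fun r hr => by
    simpa using (hd r hr).fun_pow 2
  obtain ⟨u, hu, hu'⟩ := exists_H1_cutoff (M₀ := 1) (M₁ := ⟨α, hα⟩) hd
    (fun r hr => by rw [abs_of_nonneg (hgm r hr).1]; exact (hgm r hr).2)
    (fun r hr => by rw [abs_of_nonneg (g'_nonneg r hr)]; exact g'_le r hr) a b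
  obtain ⟨w, hw, hw'⟩ := exists_H1_cutoff (M₀ := 1) (M₁ := ⟨2 * α, by positivity⟩) hd2
    (fun r hr => by
      rw [abs_of_nonneg (sq_nonneg _)]
      exact pow_le_one₀ (hgm r hr).1 (hgm r hr).2)
    (fun r hr => by
      have h1 := hgm r hr
      have h2 := g'_nonneg r hr
      have h3 := g'_le r hr
      rw [abs_of_nonneg (by have := h1.1; positivity)]
      change 2 * g r * g' r ≤ 2 * α
      nlinarith [h1.1, h1.2]) a b
  obtain ⟨ρ, hρ⟩ : ∃ ρ : Space d → ℝ, ρ = fun x => ratio 0 (toL2 a x) (toL2 b x) := ⟨_, rfl⟩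
  have hρm : ∀ x, ρ x ∈ Icc (0 : ℝ) 1 := fun x => by
    rw [hρ]; exact ratio_mem_Icc le_rfl _ _
  obtain ⟨σ, hσ⟩ : ∃ σ : Space d → ℝ, σ = fun x => g (ρ x) := ⟨_, rfl⟩
  obtain ⟨S, hS⟩ : ∃ S : Space d → EuclideanSpace ℂ (Fin d), S = fun x => WithLp.toLp 2 fun j =>
    ((g' (ρ x) * ratioDeriv 0 (toL2 a x) (toL2 b x) (grad a x j) (grad b x j) : ℝ) : ℂ)
      * toL2 a x :=
    ⟨_, rfl⟩
  have hS_le : ∀ x, ‖S x‖ ≤ α * ‖grad b x‖ + β * ‖grad a x‖ := by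
    intro x
    rw [hS]
    refine norm_toLp_le_add hα hβ fun j => ?_
    have e1 := abs_ratioDeriv_mul_le le_rfl (toL2 a x) (toL2 b x) (grad a x j) (grad b x j)
    have e2 := g'_nonneg _ (hρm x)
    have e3 := g'_le _ (hρm x)
    have e4 := g'_log _ (hρm x)
    rw [← congrFun hρ x] at e1
    rw [norm_mul, Complex.norm_real, Real.norm_eq_abs, abs_mul, abs_of_nonneg e2, mul_assoc]
    calc _ ≤ g' (ρ x) * (‖grad b x j‖ + 2 * ρ x * ‖grad a x j‖) := by gcongr
      _ = g' (ρ x) * ‖grad b x j‖ + 2 * (g' (ρ x) * ρ x) * ‖grad a x j‖ := by ring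
      _ ≤ α * ‖grad b x j‖ + β * ‖grad a x j‖ := by gcongr
  have hgu : ∀ᵐ x, grad u x = (σ x : ℂ) • grad a x + S x := by
    filter_upwards [hu'] with x hx
    rw [hx]
    ext j
    simp only [cutoffDeriv, PiLp.add_apply, PiLp.smul_apply, smul_eq_mul, hS, hσ, hρ]
  have hσm : AEStronglyMeasurable σ volume := by
    have m1 : AEMeasurable ρ volume := by
      simp only [hρ, ratio]
      have a1 := (Lp.aestronglyMeasurable (toL2 a)).norm.aemeasurable
      have b1 := (Lp.aestronglyMeasurable (toL2 b)).norm.aemeasurable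
      fun_prop
    rw [hσ]
    exact (hgmeas.comp_aemeasurable m1).aestronglyMeasurable
  have hSm : MemLp S 2 volume := by
    have m1 : AEStronglyMeasurable S volume := by
      refine ((Lp.aestronglyMeasurable (grad u)).sub
        ((Complex.continuous_ofReal.comp_aestronglyMeasurable hσm).smul
          (Lp.aestronglyMeasurable (grad a)))).congr ?_
      filter_upwards [hgu] with x hx
      simp only [Pi.sub_apply, Pi.smul_apply', hx]
      exact add_sub_cancel_left _ _
    refine (((Lp.memLp (grad b)).norm.const_mul α).add
      ((Lp.memLp (grad a)).norm.const_mul β)).mono m1 (ae_of_all _ fun x => ?_)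
    exact (hS_le x).trans (le_abs_self _)
  have hT := hSm.coeFn_toLp
  refine ⟨u, w, σ, hSm.toLp S, ?_, ?_, ?_, ?_, ?_, ?_, ?_, ?_⟩
  · filter_upwards [hu] with x hx
    rw [hx, hσ, hρ]
    rfl
  · filter_upwards [hw] with x hx
    rw [hx]
    simp only [cutoffMap, hσ, hρ]
    push_cast
    rfl
  · filter_upwards [hgu, hT] with x hx hTx
    rw [hx, hTx]
  · filter_upwards [hw', hT] with x hx hTx
    rw [hx, hTx]
    ext j
    simp only [cutoffDeriv, PiLp.add_apply, PiLp.smul_apply, smul_eq_mul, hS, hσ, hρ]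
    push_cast
    ring
  · exact ae_of_all _ fun x => by rw [hσ]; exact hgm _ (hρm x)
  · refine ae_of_all _ fun x => ?_
    have e1 : σ x ≤ α * ρ x := by rw [hσ]; exact g_le _ (hρm x)
    have e2 : ρ x * ‖toL2 a x‖ ≤ ‖toL2 b x‖ := by
      simp only [hρ, ratio, add_zero]
      rcases (by positivity : 0 ≤ ‖toL2 a x‖ ^ 2 + ‖toL2 b x‖ ^ 2).eq_or_lt with h | h
      · rw [← h, div_zero, zero_mul]; exact norm_nonneg _
      · rw [div_mul_eq_mul_div, div_le_iff₀ h]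
        have : ‖toL2 b x‖ * ‖toL2 a x‖ ≤ ‖toL2 a x‖ ^ 2 + ‖toL2 b x‖ ^ 2 := by
          nlinarith [sq_nonneg (‖toL2 a x‖ - ‖toL2 b x‖), norm_nonneg (toL2 a x),
            norm_nonneg (toL2 b x)]
        calc _ = ‖toL2 b x‖ * (‖toL2 b x‖ * ‖toL2 a x‖) := by ring
          _ ≤ _ := by gcongr
    calc σ x * ‖toL2 a x‖ ≤ α * ρ x * ‖toL2 a x‖ := by gcongr
      _ = α * (ρ x * ‖toL2 a x‖) := by ring
      _ ≤ α * ‖toL2 b x‖ := by gcongr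
  · filter_upwards [hT] with x hTx
    rw [hTx]
    exact hS_le x
  · refine ae_of_all _ fun x h0 h1 => ?_
    rw [hσ]
    refine g_half _ (hρm x) ?_
    simp only [hρ, ratio, add_zero]
    have h2 : 0 < ‖toL2 a x‖ ^ 2 + ‖toL2 b x‖ ^ 2 := by
      rcases h0 with h0 | h0 <;> positivity
    rwa [le_div_iff₀ h2]

/-- The logarithmic cutoff provides a localization whose `β` is as small as desired. -/
theorem exists_isLocalization (a b : H1 d) {δ : ℝ} (hδ : 0 < δ) :
    ∃ u w σ T, IsLocalization a b u w σ T (1 / δ ^ 2 / Real.log (1 + 1 / δ ^ 2))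
      (2 / Real.log (1 + 1 / δ ^ 2)) δ := by
  have hκ : 0 < δ ^ 2 := by positivity
  have hL := log_one_add_inv_pos hκ
  refine exists_isLocalization_of_profile a b (g := logCutoff (δ ^ 2)) (by positivity)
    (by positivity) (by unfold logCutoff; fun_prop) (fun r hr => hasDerivAt_logCutoff hκ hr.1)
    (fun r hr => logCutoff_mem_Icc hκ hr) ?_ ?_ ?_ ?_ (fun r _ => half_le_logCutoff hδ)
  · intro r hr
    have := hr.1
    positivity
  · intro r hr
    have := hr.1
    gcongr
    linarith
  · intro r hr
    have h0 := hr.1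
    have h1 : 1 / (δ ^ 2 + r) * r ≤ 1 := by
      rw [div_mul_eq_mul_div, one_mul]
      exact div_le_one_of_le₀ (by linarith) (by positivity)
    calc _ = 2 * (1 / (δ ^ 2 + r) * r) / Real.log (1 + 1 / δ ^ 2) := by ring
      _ ≤ 2 * 1 / Real.log (1 + 1 / δ ^ 2) := by gcongr
      _ = _ := by rw [mul_one]
  · intro r hr
    refine (logCutoff_le hκ hr.1).trans (le_of_eq ?_)
    field_simp

section

variable {a b u w : H1 d} {σ : Space d → ℝ}
  {T : Lp (EuclideanSpace ℂ (Fin d)) 2 (volume : Measure (Space d))} {α β δ : ℝ}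

lemma Lp_norm_le_of_ae_le_add {E F G : Type*} [NormedAddCommGroup E] [NormedAddCommGroup F]
    [NormedAddCommGroup G] {f : Lp E 2 (volume : Measure (Space d))}
    {g : Lp F 2 (volume : Measure (Space d))} {h : Lp G 2 (volume : Measure (Space d))} {s t : ℝ}
    (hs : 0 ≤ s) (ht : 0 ≤ t) (hle : ∀ᵐ x, ‖f x‖ ≤ s * ‖g x‖ + t * ‖h x‖) :
    ‖f‖ ≤ s * ‖g‖ + t * ‖h‖ := by
  have hg := (Lp.memLp g).norm
  have hh := (Lp.memLp h).norm
  have h1 : ‖f‖ ≤ ‖s • hg.toLp + t • hh.toLp‖ := by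
    refine Lp.norm_le_norm_of_ae_le ?_
    filter_upwards [hle, hg.coeFn_toLp, hh.coeFn_toLp, Lp.coeFn_add (s • hg.toLp) (t • hh.toLp),
      Lp.coeFn_smul s hg.toLp, Lp.coeFn_smul t hh.toLp] with x e1 e2 e3 e4 e5 e6
    rw [e4, Pi.add_apply, e5, e6, Pi.smul_apply, Pi.smul_apply, e2, e3]
    exact e1.trans (le_abs_self _)
  have eg : ‖hg.toLp‖ = ‖g‖ := by rw [Lp.norm_toLp, eLpNorm_norm, Lp.norm_def]
  have eh : ‖hh.toLp‖ = ‖h‖ := by rw [Lp.norm_toLp, eLpNorm_norm, Lp.norm_def]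
  calc _ ≤ ‖s • hg.toLp‖ + ‖t • hh.toLp‖ := h1.trans (norm_add_le _ _)
    _ = _ := by rw [norm_smul, norm_smul, Real.norm_of_nonneg hs, Real.norm_of_nonneg ht, eg, eh]

lemma IsLocalization.norm_T_le (h : IsLocalization a b u w σ T α β δ) (hα : 0 ≤ α) (hβ : 0 ≤ β) :
    ‖T‖ ≤ α * ‖grad b‖ + β * ‖grad a‖ :=
  Lp_norm_le_of_ae_le_add hα hβ h.norm_le

lemma IsLocalization.norm_toL2_snd_le (h : IsLocalization a b u w σ T α β δ) (hα : 0 ≤ α) :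
    ‖toL2 w‖ ≤ α * ‖toL2 b‖ := by
  have := Lp_norm_le_of_ae_le_add (f := toL2 w) (g := toL2 b) (h := toL2 b) hα le_rfl ?_
  · simpa using this
  filter_upwards [h.toL2_snd, h.mem_Icc, h.mul_norm_le] with x e1 e2 e3
  rw [e1, norm_mul, norm_pow, Complex.norm_real, Real.norm_of_nonneg e2.1, zero_mul, add_zero]
  refine le_trans ?_ e3
  have : σ x ^ 2 ≤ σ x := by nlinarith [e2.1, e2.2]
  gcongr

lemma IsLocalization.norm_toL2_snd_le' (h : IsLocalization a b u w σ T α β δ) :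
    ‖toL2 w‖ ≤ ‖toL2 a‖ := by
  refine Lp.norm_le_norm_of_ae_le ?_
  filter_upwards [h.toL2_snd, h.mem_Icc] with x e1 e2
  rw [e1, norm_mul, norm_pow, Complex.norm_real, Real.norm_of_nonneg e2.1]
  exact mul_le_of_le_one_left (norm_nonneg _) (pow_le_one₀ e2.1 e2.2)

lemma IsLocalization.norm_grad_snd_le (h : IsLocalization a b u w σ T α β δ) :
    ‖grad w‖ ≤ ‖grad a‖ + 2 * ‖T‖ := by
  have := Lp_norm_le_of_ae_le_add (f := grad w) (g := grad a) (h := T) zero_le_one zero_le_two ?_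
  · simpa using this
  filter_upwards [h.grad_snd, h.mem_Icc] with x e1 e2
  rw [e1]
  refine (norm_add_le _ _).trans ?_
  rw [norm_smul, norm_smul, norm_pow, norm_mul, Complex.norm_real, Real.norm_of_nonneg e2.1,
    Complex.norm_ofNat]
  gcongr
  · exact pow_le_one₀ e2.1 e2.2
  · linarith [e2.2]

lemma IsLocalization.norm_le_H1 (h : IsLocalization a b u w σ T α β δ) :
    ‖w‖ ≤ 2 * ‖a‖ + 2 * ‖T‖ := by
  have h1 := H1.norm_le_add w
  have h2 := h.norm_toL2_snd_le'
  have h3 := h.norm_grad_snd_le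
  have h4 := norm_toL2_le a
  have h5 := norm_grad_le a
  linarith

lemma IsLocalization.inner_toL2 (h : IsLocalization a b u w σ T α β δ) :
    (inner ℂ (toL2 u) (toL2 u) : ℂ) = inner ℂ (toL2 w) (toL2 a) := by
  rw [L2.inner_def, L2.inner_def]
  refine integral_congr_ae ?_
  filter_upwards [h.toL2_fst, h.toL2_snd] with x e1 e2
  rw [e1, e2, RCLike.inner_apply, RCLike.inner_apply, map_mul, map_mul, map_pow,
    Complex.conj_ofReal]
  ring

lemma IsLocalization.potentialPairing_eq (h : IsLocalization a b u w σ T α β δ)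
    (V : Space d → ℝ) : potentialPairing V u u = potentialPairing V w a := by
  unfold potentialPairing
  refine integral_congr_ae ?_
  filter_upwards [h.toL2_fst, h.toL2_snd] with x e1 e2
  rw [e1, e2, map_mul, map_mul, map_pow, Complex.conj_ofReal]
  ring

/-- The localization identity for the Dirichlet energy,
`‖∇(σ a)‖² = Re ⟨∇(σ² a), ∇a⟩ + ‖a ∇σ‖²`. -/
lemma IsLocalization.norm_grad_fst_sq (h : IsLocalization a b u w σ T α β δ) :
    ‖grad u‖ ^ 2 = (inner ℂ (grad w) (grad a) : ℂ).re + ‖T‖ ^ 2 := by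
  have e : ∀ f : Lp (EuclideanSpace ℂ (Fin d)) 2 (volume : Measure (Space d)),
      ‖f‖ ^ 2 = ∫ x, ‖f x‖ ^ 2 := by
    intro f
    have h1 : ‖f‖ ^ 2 = (inner ℂ f f : ℂ).re := (inner_self_eq_norm_sq (𝕜 := ℂ) f).symm
    rw [h1, L2.inner_def]
    have h2 := integral_re (𝕜 := ℂ) (L2.integrable_inner (𝕜 := ℂ) f f)
    refine h2.symm.trans (integral_congr_ae (ae_of_all _ fun x => ?_))
    exact inner_self_eq_norm_sq (𝕜 := ℂ) (f x)
  have hT : Integrable (fun x => ‖T x‖ ^ 2) volume := (Lp.memLp T).integrable_norm_pow (by simp)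
  have h2 := integral_re (𝕜 := ℂ) (L2.integrable_inner (𝕜 := ℂ) (grad w) (grad a))
  have h3 : (inner ℂ (grad w) (grad a) : ℂ).re
      = ∫ x, (inner ℂ (grad w x) (grad a x) : ℂ).re := by
    rw [L2.inner_def]
    exact h2.symm
  have hI : Integrable (fun x => (inner ℂ (grad w x) (grad a x) : ℂ).re) volume :=
    (L2.integrable_inner (𝕜 := ℂ) (grad w) (grad a)).re
  rw [e, e, h3, ← integral_add hI hT]
  refine integral_congr_ae ?_
  filter_upwards [h.grad_fst, h.grad_snd] with x e1 e2
  have n1 : ∀ v : EuclideanSpace ℂ (Fin d), ‖v‖ ^ 2 = (inner ℂ v v : ℂ).re := fun v =>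
    (inner_self_eq_norm_sq (𝕜 := ℂ) v).symm
  have n2 : (inner ℂ (T x) (grad a x) : ℂ).re = (inner ℂ (grad a x) (T x) : ℂ).re :=
    inner_re_symm (𝕜 := ℂ) _ _
  rw [n1, n1, e1, e2]
  simp only [inner_add_left, inner_add_right, inner_smul_left, inner_smul_right, map_mul, map_pow,
    Complex.conj_ofReal, Complex.conj_ofNat]
  simp only [← Complex.ofReal_pow, Complex.add_re, Complex.re_ofReal_mul, ← Complex.ofReal_ofNat,
    ← Complex.ofReal_mul, n2]
  ring

/-- The energy form plus `b` times the `L²` inner product, which is coercive for a suitable `b`. -/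
noncomputable def shiftedForm {V : Space d → ℝ} (hV : HasEnergySpaceH1 V) (b : ℝ) :
    H1 d →L⋆[ℂ] H1 d →L[ℂ] ℂ :=
  energyForm hV + (b : ℂ) • pivotForm d

lemma shiftedForm_apply {V : Space d → ℝ} (hV : HasEnergySpaceH1 V) (c : ℝ) (w u : H1 d) :
    shiftedForm hV c w u = 1 / 2 * inner ℂ (grad w) (grad u) + potentialPairing V w u
      + c * inner ℂ (toL2 w) (toL2 u) := rfl

lemma potentialPairing_self (V : Space d → ℝ) (u : H1 d) :
    potentialPairing V u u = ((∫ x, V x * ‖toL2 u x‖ ^ 2 : ℝ) : ℂ) := by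
  unfold potentialPairing
  rw [← integral_complex_ofReal]
  refine integral_congr_ae (ae_of_all _ fun x => ?_)
  simp only [RCLike.conj_mul]
  push_cast
  rfl

lemma HasEnergySpaceH1.exists_coercive {V : Space d → ℝ} (hV : HasEnergySpaceH1 V) :
    ∃ c > 0, ∃ b : ℝ, ∀ u : H1 d, c * ‖u‖ ^ 2 ≤ (shiftedForm hV b u u).re := by
  obtain ⟨c, hc, b, h⟩ := hV.coercive
  refine ⟨c, hc, b, fun u => (h u).trans (le_of_eq ?_)⟩
  rw [shiftedForm_apply, potentialPairing_self, inner_self_eq_norm_sq_to_K,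
    inner_self_eq_norm_sq_to_K]
  simp [← Complex.ofReal_pow]

/-- The localization identity for the energy. -/
lemma IsLocalization.shiftedForm_re (h : IsLocalization a b u w σ T α β δ) {V : Space d → ℝ}
    (hV : HasEnergySpaceH1 V) (c : ℝ) :
    (shiftedForm hV c u u).re = (shiftedForm hV c w a).re + 1 / 2 * ‖T‖ ^ 2 := by
  have h1 := h.norm_grad_fst_sq
  have h2 : (inner ℂ (grad u) (grad u) : ℂ).re = ‖grad u‖ ^ 2 := inner_self_eq_norm_sq (𝕜 := ℂ) _
  have h3 : ∀ z : ℂ, (1 / 2 * z).re = 1 / 2 * z.re := fun z => by simp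
  rw [shiftedForm_apply, shiftedForm_apply, h.potentialPairing_eq, h.inner_toL2]
  simp only [Complex.add_re, h3]
  rw [h2, h1]
  ring

end

end Localization

end SchrodingerLohe

/-! ### Stability of the polar gradient along energy-tight families -/

namespace SchrodingerLohe

section Polar

variable {d : ℕ}

/-- The field `conj(φ) ∇ψ`. Its real part is `∇√ρ` and its imaginary part is `Λ`. -/
noncomputable def polarGrad (ψ : H1 d) (φ : Space d → ℂ) (x : Space d) : EuclideanSpace ℂ (Fin d) :=
  conj (φ x) • grad ψ x

lemma sqrtDensity_eq_norm (ψ : H1 d) (x : Space d) : sqrtDensity ψ x = ‖toL2 ψ x‖ :=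
  Real.sqrt_sq (norm_nonneg _)

lemma norm_polar_sub_mul_le {z w φ₁ φ₂ : ℂ} (h₁ : ‖φ₁‖ ≤ 1) (e₁ : z + w = ‖z + w‖ * φ₁)
    (e₂ : z = ‖z‖ * φ₂) : ‖φ₁ - φ₂‖ * ‖z‖ ≤ 2 * ‖w‖ := by
  have h : (‖z‖ : ℂ) * (φ₁ - φ₂) = ((‖z‖ - ‖z + w‖ : ℝ) : ℂ) * φ₁ + w := by
    push_cast
    linear_combination e₂ - e₁
  have h2 : |‖z‖ - ‖z + w‖| ≤ ‖w‖ := by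
    refine (abs_norm_sub_norm_le _ _).trans (le_of_eq ?_)
    rw [sub_add_cancel_left, norm_neg]
  calc ‖φ₁ - φ₂‖ * ‖z‖ = ‖(‖z‖ : ℂ) * (φ₁ - φ₂)‖ := by
        rw [norm_mul, Complex.norm_real, norm_norm, mul_comm]
    _ ≤ ‖w‖ * 1 + ‖w‖ := by
        rw [h]
        refine (norm_add_le _ _).trans ?_
        rw [norm_mul, Complex.norm_real, Real.norm_eq_abs]
        gcongr
    _ = _ := by ring

/-- Either the localization is active, or the two polar factors are close. -/
lemma norm_polar_sub_le {z w φ₁ φ₂ : ℂ} {σ δ : ℝ} (h₁ : ‖φ₁‖ ≤ 1) (h₂ : ‖φ₂‖ ≤ 1)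
    (e₁ : z + w = ‖z + w‖ * φ₁) (e₂ : z = ‖z‖ * φ₂) (hσ : 0 ≤ σ) (hδ' : δ ≤ 1 / 2)
    (hzw : z ≠ 0 ∨ w ≠ 0) (h : δ * (‖z‖ ^ 2 + ‖w‖ ^ 2) ≤ ‖w‖ ^ 2 → 1 / 2 ≤ σ) :
    ‖φ₁ - φ₂‖ ≤ 4 * σ + √(8 * δ) := by
  by_cases hc : δ * (‖z‖ ^ 2 + ‖w‖ ^ 2) ≤ ‖w‖ ^ 2
  · have := h hc
    have h3 : ‖φ₁ - φ₂‖ ≤ 2 := (norm_sub_le _ _).trans (by linarith)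
    have := Real.sqrt_nonneg (8 * δ)
    linarith
  push Not at hc
  have hz : 0 < ‖z‖ := by
    rw [norm_pos_iff]
    intro hz
    rw [hz, norm_zero] at hc
    have : 0 < ‖w‖ := norm_pos_iff.2 (hzw.resolve_left (not_not.2 hz))
    nlinarith [sq_pos_of_pos this]
  have h3 := norm_polar_sub_mul_le h₁ e₁ e₂
  have h4 : ‖φ₁ - φ₂‖ ^ 2 ≤ 8 * δ := by
    have h5 : (‖φ₁ - φ₂‖ * ‖z‖) ^ 2 ≤ (2 * ‖w‖) ^ 2 := by gcongr
    have h6 : ‖φ₁ - φ₂‖ ^ 2 * ‖z‖ ^ 2 ≤ 8 * δ * ‖z‖ ^ 2 := by nlinarith [sq_nonneg ‖w‖]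
    exact le_of_mul_le_mul_right h6 (by positivity)
  have := Real.le_sqrt_of_sq_le h4
  linarith

lemma eLpNorm_coe_eq {F : Type*} [NormedAddCommGroup F]
    (f : Lp F 2 (volume : Measure (Space d))) : eLpNorm f 2 volume = ENNReal.ofReal ‖f‖ := by
  rw [Lp.norm_def, ENNReal.ofReal_toReal (Lp.eLpNorm_ne_top f)]

lemma eLpNorm_le_of_ae_le_add {E F G H : Type*} [NormedAddCommGroup E] [NormedAddCommGroup F]
    [NormedAddCommGroup G] [NormedAddCommGroup H] {X : Space d → E}
    {f : Lp F 2 (volume : Measure (Space d))} {g : Lp G 2 (volume : Measure (Space d))}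
    {h : Lp H 2 (volume : Measure (Space d))} {r s t : ℝ} (hr : 0 ≤ r) (hs : 0 ≤ s) (ht : 0 ≤ t)
    (hle : ∀ᵐ x, ‖X x‖ ≤ r * ‖f x‖ + s * ‖g x‖ + t * ‖h x‖) :
    eLpNorm X 2 volume ≤ ENNReal.ofReal (r * ‖f‖ + s * ‖g‖ + t * ‖h‖) := by
  have hf := (Lp.memLp f).norm
  have hg := (Lp.memLp g).norm
  have hh := (Lp.memLp h).norm
  set R := r • hf.toLp + s • hg.toLp + t • hh.toLp with hR
  have h1 : eLpNorm X 2 volume ≤ eLpNorm R 2 volume := by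
    refine eLpNorm_mono_ae ?_
    filter_upwards [hle, hf.coeFn_toLp, hg.coeFn_toLp, hh.coeFn_toLp,
      Lp.coeFn_add (r • hf.toLp + s • hg.toLp) (t • hh.toLp),
      Lp.coeFn_add (r • hf.toLp) (s • hg.toLp), Lp.coeFn_smul r hf.toLp, Lp.coeFn_smul s hg.toLp,
      Lp.coeFn_smul t hh.toLp] with x e e1 e2 e3 e4 e5 e6 e7 e8
    rw [hR, e4, Pi.add_apply, e5, Pi.add_apply, e6, e7, e8, Pi.smul_apply, Pi.smul_apply,
      Pi.smul_apply, e1, e2, e3]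
    exact e.trans (le_abs_self _)
  have ef : ‖hf.toLp‖ = ‖f‖ := by rw [Lp.norm_toLp, eLpNorm_norm, Lp.norm_def]
  have eg : ‖hg.toLp‖ = ‖g‖ := by rw [Lp.norm_toLp, eLpNorm_norm, Lp.norm_def]
  have eh : ‖hh.toLp‖ = ‖h‖ := by rw [Lp.norm_toLp, eLpNorm_norm, Lp.norm_def]
  rw [eLpNorm_coe_eq] at h1
  refine h1.trans (ENNReal.ofReal_le_ofReal ?_)
  calc _ ≤ ‖r • hf.toLp‖ + ‖s • hg.toLp‖ + ‖t • hh.toLp‖ := norm_add₃_le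
    _ = _ := by
      rw [norm_smul, norm_smul, norm_smul, Real.norm_of_nonneg hr, Real.norm_of_nonneg hs,
        Real.norm_of_nonneg ht, ef, eg, eh]

lemma IsPolarFactor.eq_norm_mul {ψ : H1 d} {φ : Space d → ℂ} (h : IsPolarFactor ψ φ) :
    ∀ᵐ x, toL2 ψ x = ‖toL2 ψ x‖ * φ x := by
  filter_upwards [h.eq_mul] with x hx
  rwa [sqrtDensity_eq_norm] at hx

/-- A localization controls the difference of the polar gradients of `a` and `a + b`. -/
lemma IsLocalization.eLpNorm_polarGrad_sub_le {a b u w : H1 d} {σ : Space d → ℝ}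
    {T : Lp (EuclideanSpace ℂ (Fin d)) 2 (volume : Measure (Space d))} {α β δ : ℝ}
    (h : IsLocalization a b u w σ T α β δ) (hδ' : δ ≤ 1 / 2) {φ₁ φ₂ : Space d → ℂ}
    (h₁ : IsPolarFactor (a + b) φ₁) (h₂ : IsPolarFactor a φ₂) :
    eLpNorm (polarGrad (a + b) φ₁ - polarGrad a φ₂) 2 volume
      ≤ ENNReal.ofReal (‖b‖ + 4 * (‖u‖ + ‖T‖) + √(8 * δ) * ‖a‖) := by
  have key := eLpNorm_le_of_ae_le_add (X := polarGrad (a + b) φ₁ - polarGrad a φ₂) (f := grad b)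
    (g := grad u - T) (h := grad a) zero_le_one (by norm_num : (0 : ℝ) ≤ 4)
    (Real.sqrt_nonneg (8 * δ)) ?_
  · refine key.trans (ENNReal.ofReal_le_ofReal ?_)
    have n1 := norm_grad_le a
    have n2 := norm_grad_le b
    have n3 := (norm_sub_le (grad u) T).trans (add_le_add_left (norm_grad_le u) _)
    rw [one_mul]
    gcongr
  have hab : grad (a + b) = grad a + grad b := rfl
  have hab' : toL2 (a + b) = toL2 a + toL2 b := rfl
  filter_upwards [h.grad_fst, h.mem_Icc, h.half_le, h₁.eq_norm_mul, h₂.eq_norm_mul, h₁.norm_le,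
    h₂.norm_le, Lp.coeFn_sub (grad u) T, Lp.coeFn_add (grad a) (grad b),
    Lp.coeFn_add (toL2 a) (toL2 b), grad_ae_eq_zero a]
    with x e1 e2 e3 e4 e5 e6 e7 e8 e9 e10 e11
  rw [hab', e10, Pi.add_apply] at e4
  have eN : ‖(grad u - T) x‖ = σ x * ‖grad a x‖ := by
    rw [e8, Pi.sub_apply, e1, add_sub_cancel_right, norm_smul, Complex.norm_real,
      Real.norm_of_nonneg e2.1]
  have eP : (polarGrad (a + b) φ₁ - polarGrad a φ₂) x
      = conj (φ₁ x) • grad b x + conj (φ₁ x - φ₂ x) • grad a x := by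
    simp only [Pi.sub_apply, polarGrad, hab, e9, Pi.add_apply, map_sub]
    module
  rw [eP, eN, one_mul]
  have n1 : ‖conj (φ₁ x) • grad b x‖ ≤ ‖grad b x‖ := by
    rw [norm_smul, RCLike.norm_conj]
    exact mul_le_of_le_one_left (norm_nonneg _) e6
  have n2 : ‖conj (φ₁ x - φ₂ x) • grad a x‖
      ≤ 4 * (σ x * ‖grad a x‖) + √(8 * δ) * ‖grad a x‖ := by
    by_cases h0 : toL2 a x = 0
    · simp [e11 h0]
    rw [norm_smul, RCLike.norm_conj]
    have := norm_polar_sub_le e6 e7 e4 e5 e2.1 hδ' (Or.inl h0) (e3 (Or.inl h0))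
    calc _ ≤ (4 * σ x + √(8 * δ)) * ‖grad a x‖ := by gcongr
      _ = _ := by ring
  have := norm_add_le (conj (φ₁ x) • grad b x) (conj (φ₁ x - φ₂ x) • grad a x)
  linarith

/-- The cutoff parameter can be chosen so that both errors of the localization are small. -/
lemma exists_cutoff_parameter (M : ℝ) {θ : ℝ} (hθ : 0 < θ) :
    ∃ δ : ℝ, 0 < δ ∧ δ ≤ 1 / 2 ∧ √(8 * δ) * M ≤ θ ∧ 2 / Real.log (1 + 1 / δ ^ 2) * M ≤ θ := by
  have t1 : Tendsto (fun δ : ℝ => √(8 * δ) * M) (𝓝[>] 0) (𝓝 0) := by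
    have : Continuous fun δ : ℝ => √(8 * δ) * M := by fun_prop
    have h := this.tendsto 0
    simp only [mul_zero, Real.sqrt_zero, zero_mul] at h
    exact h.mono_left nhdsWithin_le_nhds
  have t2 : Tendsto (fun δ : ℝ => 2 / Real.log (1 + 1 / δ ^ 2) * M) (𝓝[>] 0) (𝓝 0) := by
    have h1 : Tendsto (fun δ : ℝ => 1 + 1 / δ ^ 2) (𝓝[>] 0) atTop := by
      refine tendsto_atTop_add_const_left _ _ ?_
      have := (tendsto_pow_atTop two_ne_zero).comp (tendsto_inv_nhdsGT_zero (𝕜 := ℝ))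
      refine this.congr fun δ => ?_
      simp
    have h2 := (Real.tendsto_log_atTop.comp h1).const_div_atTop 2
    simpa using h2.mul_const M
  have h := ((t1.eventually_le_const hθ).and (t2.eventually_le_const hθ)).and
    ((Ioo_mem_nhdsGT (by norm_num : (0 : ℝ) < 1 / 2)))
  obtain ⟨δ, ⟨h1, h2⟩, h3⟩ := h.exists
  exact ⟨δ, h3.1, h3.2.le, h1, h2⟩

/-- Smallness of the localized function `u = σ a`, when `a` is close to an element `y` of the domain
of the operator: the localization identity reduces its energy to the pairing of `H a` with `σ² a`,
and `σ² a` is small in `L²` because `b` is. -/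
lemma IsLocalization.coercive_le {V : Space d → ℝ} (hV : HasEnergySpaceH1 V) {c s : ℝ}
    (hc : ∀ u : H1 d, c * ‖u‖ ^ 2 ≤ (shiftedForm hV s u u).re) {a b u w y : H1 d}
    {σ : Space d → ℝ} {T : Lp (EuclideanSpace ℂ (Fin d)) 2 (volume : Measure (Space d))}
    {α β δ C H : ℝ}
    (hH : ∀ w u : H1 d, ‖energyForm hV w u‖ ≤ H * ‖w‖ * ‖u‖) (hH0 : 0 ≤ H)
    (h : IsLocalization a b u w σ T α β δ) (hα : 0 ≤ α) (hC : 0 ≤ C)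
    (hy : ∀ w, ‖energyForm hV w y‖ ≤ C * ‖toL2 w‖) :
    c * ‖u‖ ^ 2 ≤ (C + |s| * ‖a‖) * α * ‖b‖
      + H * (2 * ‖a‖ + 2 * ‖T‖) * ‖a - y‖ + 1 / 2 * ‖T‖ ^ 2 := by
  refine (hc u).trans ?_
  rw [h.shiftedForm_re hV s]
  have e : shiftedForm hV s w a
      = energyForm hV w y + energyForm hV w (a - y) + s * inner ℂ (toL2 w) (toL2 a) := by
    have e1 : energyForm hV w (a - y) = energyForm hV w a - energyForm hV w y :=
      ContinuousLinearMap.map_sub _ a y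
    have e2 : shiftedForm hV s w a = energyForm hV w a + s * inner ℂ (toL2 w) (toL2 a) := rfl
    linear_combination e2 - e1
  have hw : ‖toL2 w‖ ≤ α * ‖b‖ :=
    (h.norm_toL2_snd_le hα).trans (mul_le_mul_of_nonneg_left (norm_toL2_le b) hα)
  have n1 : ‖energyForm hV w y‖ ≤ C * (α * ‖b‖) := (hy w).trans (by gcongr)
  have n2 : ‖energyForm hV w (a - y)‖ ≤ H * (2 * ‖a‖ + 2 * ‖T‖) * ‖a - y‖ :=
    (hH w (a - y)).trans (mul_le_mul_of_nonneg_right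
      (mul_le_mul_of_nonneg_left h.norm_le_H1 hH0) (norm_nonneg _))
  have n3 : ‖(s : ℂ) * inner ℂ (toL2 w) (toL2 a)‖ ≤ |s| * (α * ‖b‖ * ‖a‖) := by
    rw [norm_mul, Complex.norm_real, Real.norm_eq_abs]
    gcongr
    refine (norm_inner_le_norm _ _).trans ?_
    gcongr
    exact norm_toL2_le a
  have n4 : (shiftedForm hV s w a).re ≤ C * (α * ‖b‖)
      + H * (2 * ‖a‖ + 2 * ‖T‖) * ‖a - y‖ + |s| * (α * ‖b‖ * ‖a‖) := by
    refine (Complex.re_le_norm _).trans ?_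
    rw [e]
    exact norm_add₃_le.trans (by gcongr)
  linarith

/-- The numerical consequence of `IsLocalization.coercive_le` when each of its three terms is
small. -/
lemma le_sqrt_mul_of_coercive {A B T E U c θ M H C α s ε : ℝ} (hc : 0 < c) (hθ : 0 ≤ θ)
    (hθ1 : θ ≤ 1) (hα : 0 ≤ α) (hs : 0 ≤ s) (hH : 0 ≤ H) (hA : 0 ≤ A) (hB : 0 ≤ B)
    (hT : 0 ≤ T) (hE : 0 ≤ E) (hAM : A ≤ M) (hTθ : T ≤ 2 * θ) (hEε : E ≤ ε)
    (hε : H * (2 * M + 4) * ε ≤ θ ^ 2) (hBθ : (C + s * M) * α * B ≤ θ ^ 2)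
    (h : c * U ^ 2 ≤ (C + s * A) * α * B + H * (2 * A + 2 * T) * E + 1 / 2 * T ^ 2) :
    U ≤ √(4 / c) * θ := by
  have hM : 0 ≤ M := hA.trans hAM
  have e1 : (C + s * A) * α * B ≤ θ ^ 2 := by
    refine le_trans ?_ hBθ
    gcongr
  have e2 : H * (2 * A + 2 * T) * E ≤ θ ^ 2 := by
    refine le_trans ?_ hε
    gcongr
    linarith
  have e3 : T ^ 2 ≤ (2 * θ) ^ 2 := by gcongr
  have e4 : c * U ^ 2 ≤ 4 * θ ^ 2 := by linarith
  have e5 : U ^ 2 ≤ (√(4 / c) * θ) ^ 2 := by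
    rw [mul_pow, Real.sq_sqrt (by positivity), div_mul_eq_mul_div, le_div_iff₀ hc]
    linarith
  exact abs_le_of_sq_le_sq' e5 (by positivity) |>.2

/-- Quantitative form of `tendsto_eLpNorm_polarGrad_sub`: every error term is eventually bounded
by a multiple of `θ`. -/
lemma eventually_eLpNorm_polarGrad_sub_le {ι : Type*} {l : Filter ι} {V : Space d → ℝ}
    (hV : HasEnergySpaceH1 V) {c s : ℝ} (hc : 0 < c)
    (hcoer : ∀ u : H1 d, c * ‖u‖ ^ 2 ≤ (shiftedForm hV s u u).re)
    {a b : ι → H1 d} {φ₁ φ₂ : ι → Space d → ℂ} {M : ℝ}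
    (ha : ∀ᶠ t in l, ‖a t‖ ≤ M) (hb : Tendsto b l (𝓝 0))
    (hy : ∀ ε > 0, ∃ C : ℝ, ∀ᶠ t in l, ∃ y : H1 d, ‖a t - y‖ ≤ ε ∧
      ∀ w, ‖energyForm hV w y‖ ≤ C * ‖toL2 w‖)
    (h₁ : ∀ᶠ t in l, IsPolarFactor (a t + b t) (φ₁ t))
    (h₂ : ∀ᶠ t in l, IsPolarFactor (a t) (φ₂ t))
    {θ : ℝ} (hθ : 0 < θ) (hθ1 : θ ≤ 1) :
    ∀ᶠ t in l, eLpNorm (polarGrad (a t + b t) (φ₁ t) - polarGrad (a t) (φ₂ t)) 2 volume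
      ≤ ENNReal.ofReal ((10 + 4 * √(4 / c)) * θ) := by
  obtain ⟨H, hH0, hH⟩ := exists_form_bound (energyForm hV)
  obtain ⟨δ, hδ, hδ', hδM, hβM⟩ := exists_cutoff_parameter |M| hθ
  have hL := log_one_add_inv_pos (by positivity : 0 < δ ^ 2)
  obtain ⟨α, hα⟩ : ∃ α : ℝ, α = 1 / δ ^ 2 / Real.log (1 + 1 / δ ^ 2) := ⟨_, rfl⟩
  have hα0 : 0 ≤ α := by rw [hα]; positivity
  obtain ⟨β, hβ⟩ : ∃ β : ℝ, β = 2 / Real.log (1 + 1 / δ ^ 2) := ⟨_, rfl⟩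
  have hβ0 : 0 ≤ β := by rw [hβ]; positivity
  rw [← hβ] at hβM
  obtain ⟨ε, hε⟩ : ∃ ε : ℝ, ε = θ ^ 2 / (H * (2 * |M| + 4) + 1) := ⟨_, rfl⟩
  have hε0 : 0 < ε := by rw [hε]; positivity
  have hεle : H * (2 * |M| + 4) * ε ≤ θ ^ 2 := by
    rw [hε, mul_div_assoc', div_le_iff₀ (by positivity)]
    nlinarith [sq_nonneg θ]
  obtain ⟨C, hC⟩ := hy ε hε0
  have hbn : Tendsto (fun t => ‖b t‖) l (𝓝 0) := by simpa using hb.norm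
  have tb : ∀ (A : ℝ) {η : ℝ}, 0 < η → ∀ᶠ t in l, A * ‖b t‖ ≤ η := fun A η hη => by
    have := hbn.const_mul A
    rw [mul_zero] at this
    exact this.eventually_le_const hη
  filter_upwards [ha, hC, h₁, h₂, tb 1 hθ, tb α hθ,
    tb ((|C| + |s| * |M|) * α) (by positivity : 0 < θ ^ 2)] with t ha hC h₁ h₂ b1 b2 b3
  obtain ⟨y, hy1, hy2⟩ := hC
  obtain ⟨u, w, σ, T, hloc⟩ := exists_isLocalization (a t) (b t) hδ
  rw [← hα, ← hβ] at hloc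
  have haM : ‖a t‖ ≤ |M| := ha.trans (le_abs_self M)
  have hT : ‖T‖ ≤ 2 * θ := by
    have e1 := hloc.norm_T_le hα0 hβ0
    have e2 : α * ‖grad (b t)‖ ≤ α * ‖b t‖ := by gcongr; exact norm_grad_le _
    have e3 : β * ‖grad (a t)‖ ≤ β * |M| := by
      gcongr
      exact (norm_grad_le _).trans haM
    linarith
  have hE := hloc.coercive_le hV hcoer hH hH0 hα0 (abs_nonneg C)
    (fun w => (hy2 w).trans (by gcongr; exact le_abs_self C))
  have hu : ‖u‖ ≤ √(4 / c) * θ :=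
    le_sqrt_mul_of_coercive hc hθ.le hθ1 hα0 (abs_nonneg s) hH0 (norm_nonneg _)
      (norm_nonneg _) (norm_nonneg _) (norm_nonneg _) haM hT hy1 hεle b3 hE
  refine (hloc.eLpNorm_polarGrad_sub_le hδ' h₁ h₂).trans (ENNReal.ofReal_le_ofReal ?_)
  have e4 : √(8 * δ) * ‖a t‖ ≤ θ := le_trans (by gcongr) hδM
  linarith

/-- If `b → 0` in `H¹` and `a` is bounded in `H¹` and uniformly approximated in `H¹` by elements on
which the operator is bounded in `L²`, then the polar gradients of `a + b` and of `a` approach each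
other in `L²`. Boundedness of `a` in `H¹` alone would not suffice: `ψ ↦ ∇|ψ|` is not uniformly
continuous on bounded sets. -/
theorem tendsto_eLpNorm_polarGrad_sub {ι : Type*} {l : Filter ι} {V : Space d → ℝ}
    (hV : HasEnergySpaceH1 V) {a b : ι → H1 d} {φ₁ φ₂ : ι → Space d → ℂ} {M : ℝ}
    (ha : ∀ᶠ t in l, ‖a t‖ ≤ M) (hb : Tendsto b l (𝓝 0))
    (hy : ∀ ε > 0, ∃ C : ℝ, ∀ᶠ t in l, ∃ y : H1 d, ‖a t - y‖ ≤ ε ∧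
      ∀ w, ‖energyForm hV w y‖ ≤ C * ‖toL2 w‖)
    (h₁ : ∀ᶠ t in l, IsPolarFactor (a t + b t) (φ₁ t))
    (h₂ : ∀ᶠ t in l, IsPolarFactor (a t) (φ₂ t)) :
    Tendsto (fun t => eLpNorm (polarGrad (a t + b t) (φ₁ t) - polarGrad (a t) (φ₂ t)) 2 volume) l
      (𝓝 0) := by
  obtain ⟨c, hc, s, hcoer⟩ := hV.exists_coercive
  rw [ENNReal.tendsto_nhds_zero]
  intro η hη
  have hlim : Tendsto (fun θ : ℝ => ENNReal.ofReal ((10 + 4 * √(4 / c)) * θ)) (𝓝[>] 0) (𝓝 0) := by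
    have h1 : Continuous fun θ : ℝ => ENNReal.ofReal ((10 + 4 * √(4 / c)) * θ) :=
      ENNReal.continuous_ofReal.comp (by fun_prop)
    have h2 := h1.tendsto 0
    rw [mul_zero, ENNReal.ofReal_zero] at h2
    exact h2.mono_left nhdsWithin_le_nhds
  obtain ⟨θ, h3, h4⟩ := ((hlim.eventually_le_const hη).and
    (Ioo_mem_nhdsGT (zero_lt_one' ℝ))).exists
  filter_upwards [eventually_eLpNorm_polarGrad_sub_le hV hc hcoer ha hb hy h₁ h₂ h4.1 h4.2.le]
    with t ht
  exact ht.trans h3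

end Polar

end SchrodingerLohe

/-! ### Mass conservation and convergence of the correlation -/

namespace SchrodingerLohe

section Synchronization

open Complex (I)

lemma le_of_hasDerivWithinAt_nonpos {f f' : ℝ → ℝ}
    (hf : ∀ t, 0 ≤ t → HasDerivWithinAt f (f' t) (Ici 0) t) (hf' : ∀ t, 0 ≤ t → f' t ≤ 0)
    {s t : ℝ} (hs : 0 ≤ s) (hst : s ≤ t) : f t ≤ f s := by
  have h : AntitoneOn f (Ici 0) := by
    refine antitoneOn_of_hasDerivWithinAt_nonpos (convex_Ici 0)
      (fun t ht => (hf t ht).continuousWithinAt) (f' := f') (fun t ht => ?_) fun t ht => ?_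
    · exact (hf t (interior_subset ht)).mono interior_subset
    · exact hf' t (interior_subset ht)
  exact h hs (hs.trans hst) hst

/-- The solution of a scalar linear equation. -/
lemma eq_mul_exp_of_hasDerivWithinAt {f a : ℝ → ℂ} (ha : ContinuousOn a (Ici 0))
    (hf : ∀ t, 0 ≤ t → HasDerivWithinAt f (a t * f t) (Ici 0) t) {t : ℝ} (ht : 0 ≤ t) :
    f t = f 0 * Complex.exp (∫ τ in (0 : ℝ)..t, a (max τ 0)) := by
  have ca := continuous_comp_max ha
  have hA : ∀ t, HasDerivAt (fun t => ∫ τ in (0 : ℝ)..t, a (max τ 0)) (a (max t 0)) t := fun t =>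
    intervalIntegral.integral_hasDerivAt_right (ca.intervalIntegrable _ _)
      (ca.stronglyMeasurableAtFilter _ _) ca.continuousAt
  set g : ℝ → ℂ := fun t => f t * Complex.exp (-∫ τ in (0 : ℝ)..t, a (max τ 0)) with hg
  have hg' : ∀ t, 0 ≤ t → HasDerivWithinAt g 0 (Ici 0) t := by
    intro t ht
    have h1 := (hf t ht).mul (hA t).neg.cexp.hasDerivWithinAt
    refine h1.congr_deriv ?_
    rw [max_eq_left ht]
    ring
  have h2 := constant_of_has_deriv_right_zero (f := g) (a := 0) (b := t)
    (fun s hs => (hg' s hs.1).continuousWithinAt.mono Icc_subset_Ici_self)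
    (fun s hs => (hg' s hs.1).mono (Ici_subset_Ici.2 hs.1)) t (right_mem_Icc.2 ht)
  simp only [hg, intervalIntegral.integral_same, neg_zero, Complex.exp_zero, mul_one] at h2
  rw [← h2, mul_assoc, ← Complex.exp_add, neg_add_cancel, Complex.exp_zero, mul_one]

variable {E : Type*} [NormedAddCommGroup E] [NormedSpace ℂ E]

/-- `B` is hermitian and positive semidefinite. -/
structure IsPositiveForm (B : E →L⋆[ℂ] E →L[ℂ] ℂ) : Prop where
  conj_apply : ∀ u w, conj (B u w) = B w u
  nonneg : ∀ u, 0 ≤ (B u u).re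

lemma form_self_im {B : E →L⋆[ℂ] E →L[ℂ] ℂ} (hB : ∀ u w, conj (B u w) = B w u) (u : E) :
    (B u u).im = 0 := Complex.conj_eq_iff_im.1 (hB u u)

lemma form_self_eq {B : E →L⋆[ℂ] E →L[ℂ] ℂ} (hB : ∀ u w, conj (B u w) = B w u) (u : E) :
    B u u = ((B u u).re : ℂ) := Complex.ext rfl (by simp [form_self_im hB])

lemma IsPositiveForm.two_mul_norm_le {B : E →L⋆[ℂ] E →L[ℂ] ℂ} (hB : IsPositiveForm B) (u w : E) :
    2 * ‖B u w‖ ≤ (B u u).re + (B w w).re := by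
  -- choose the phase `c` so that `c B(u, w) = |B(u, w)|`
  obtain ⟨c, hc, hcB⟩ : ∃ c : ℂ, c * conj c = 1 ∧ c * B u w = ‖B u w‖ := by
    by_cases h : B u w = 0
    · exact ⟨1, by simp, by simp [h]⟩
    have hn : (‖B u w‖ : ℂ) ≠ 0 := by simpa using h
    refine ⟨conj (B u w) / ‖B u w‖, ?_, ?_⟩
    · rw [map_div₀, Complex.conj_conj, Complex.conj_ofReal, div_mul_div_comm, Complex.conj_mul',
        ← sq, div_self (pow_ne_zero 2 hn)]
    · rw [div_mul_eq_mul_div, Complex.conj_mul', sq, mul_div_assoc, div_self hn, mul_one]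
  have h := hB.nonneg (u - c • w)
  have e : B (u - c • w) (u - c • w) = B u u + B w w - 2 * (‖B u w‖ : ℂ) := by
    have h2 : conj c * B w u = ‖B u w‖ := by
      rw [← hB.conj_apply, ← map_mul, hcB, Complex.conj_ofReal]
    simp only [map_sub, map_smulₛₗ, sub_apply, smul_apply, smul_eq_mul, RingHom.id_apply]
    linear_combination -hcB - h2 + (B w w) * hc
  rw [e] at h
  simp only [Complex.add_re, Complex.sub_re, Complex.mul_re, Complex.ofReal_re, Complex.re_ofNat,
    Complex.im_ofNat, zero_mul, sub_zero] at h
  linarith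

variable {J h k : E →L⋆[ℂ] E →L[ℂ] ℂ} {K : ℝ} {u₁ u₂ : ℝ → E}

/-- The source term `(K / 4) (v - ⟨v, u⟩ u)` of the Schrödinger–Lohe equation. -/
noncomputable def loheSource (J : E →L⋆[ℂ] E →L[ℂ] ℂ) (K : ℝ) (u v : ℝ → E) (t : ℝ) : E :=
  (K / 4 : ℂ) • (v t - J (v t) (u t) • u t)

/-- The Schrödinger–Lohe system for an abstract operator with form `h` and pivot form `J`, for
solutions of unit mass. -/
structure IsLohePair (J h : E →L⋆[ℂ] E →L[ℂ] ℂ) (K : ℝ) (u₁ u₂ : ℝ → E) : Prop where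
  fst : IsWeakSolution J h u₁ (loheSource J K u₁ u₂)
  snd : IsWeakSolution J h u₂ (loheSource J K u₂ u₁)
  mass_fst : J (u₁ 0) (u₁ 0) = 1
  mass_snd : J (u₂ 0) (u₂ 0) = 1

lemma IsLohePair.symm (H : IsLohePair J h K u₁ u₂) : IsLohePair J h K u₂ u₁ :=
  ⟨H.snd, H.fst, H.mass_snd, H.mass_fst⟩

lemma continuousOn_form (B : E →L⋆[ℂ] E →L[ℂ] ℂ) {f g : ℝ → E} {s : Set ℝ}
    (hf : ContinuousOn f s) (hg : ContinuousOn g s) : ContinuousOn (fun t => B (f t) (g t)) s :=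
  (isBoundedBilinearMap_of_sesquilinear B).continuous.comp_continuousOn (hf.prodMk hg)

lemma continuousOn_loheSource {s : Set ℝ} (h₁ : ContinuousOn u₁ s) (h₂ : ContinuousOn u₂ s) :
    ContinuousOn (loheSource J K u₁ u₂) s :=
  (h₂.sub ((continuousOn_form J h₂ h₁).smul h₁)).const_smul _

/-- Conservation of mass: `1 - ‖u₁‖²` solves a linear equation with zero initial value. -/
theorem IsLohePair.mass_eq_one [CompleteSpace E] (H : IsLohePair J h K u₁ u₂)
    (hJ : ∀ u w, conj (J u w) = J w u) (hh : ∀ u w, conj (h u w) = h w u) {t : ℝ} (ht : 0 ≤ t) :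
    J (u₁ t) (u₁ t) = 1 := by
  have hd : ∀ t, 0 ≤ t → HasDerivWithinAt (fun t => 1 - J (u₁ t) (u₁ t))
      (-(K / 4 * (J (u₁ t) (u₂ t) + J (u₂ t) (u₁ t))) * (1 - J (u₁ t) (u₁ t))) (Ici 0) t := by
    intro t ht
    have e := (H.fst.hasDerivWithinAt_form (isInvariantForm_pivot hJ hh) H.fst ht).const_sub 1
    refine e.congr_deriv ?_
    have hK : conj (K / 4 : ℂ) = K / 4 := by
      rw [map_div₀, Complex.conj_ofReal, Complex.conj_ofNat]
    simp only [loheSource, map_sub, map_smulₛₗ, sub_apply, smul_apply, smul_eq_mul,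
      RingHom.id_apply, hJ, hK]
    ring
  have cont : ContinuousOn (fun t => -(K / 4 * (J (u₁ t) (u₂ t) + J (u₂ t) (u₁ t)))) (Ici 0) :=
    (continuousOn_const.mul ((continuousOn_form J H.fst.continuousOn H.snd.continuousOn).add
      (continuousOn_form J H.snd.continuousOn H.fst.continuousOn))).neg
  have := eq_mul_exp_of_hasDerivWithinAt cont hd ht
  rw [H.mass_fst, sub_self, zero_mul] at this
  exact (sub_eq_zero.1 this).symm

/-- The correlation `z = ⟨u₁, u₂⟩` solves `z' = (K / 2) (1 - z²)`. -/
lemma IsLohePair.hasDerivWithinAt_correlation [CompleteSpace E] (H : IsLohePair J h K u₁ u₂)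
    (hJ : ∀ u w, conj (J u w) = J w u) (hh : ∀ u w, conj (h u w) = h w u) {t : ℝ} (ht : 0 ≤ t) :
    HasDerivWithinAt (fun t => J (u₁ t) (u₂ t)) (K / 2 * (1 - J (u₁ t) (u₂ t) ^ 2)) (Ici 0) t := by
  refine (H.fst.hasDerivWithinAt_form (isInvariantForm_pivot hJ hh) H.snd ht).congr_deriv ?_
  have hK : conj (K / 4 : ℂ) = K / 4 := by
    rw [map_div₀, Complex.conj_ofReal, Complex.conj_ofNat]
  have m₁ := H.mass_eq_one hJ hh ht
  have m₂ := H.symm.mass_eq_one hJ hh ht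
  simp only [loheSource, map_sub, map_smulₛₗ, sub_apply, smul_apply, smul_eq_mul,
    RingHom.id_apply, hJ, hK, m₁, m₂]
  ring

/-- Exponential convergence of the correlation to `1`. The quotient `(1 - z) / (1 + z)` solves the
linear equation `r' = -K r`. -/
theorem IsLohePair.exists_correlation_bound [CompleteSpace E] (H : IsLohePair J h K u₁ u₂)
    (hJ : IsPositiveForm J) (hh : ∀ u w, conj (h u w) = h w u)
    (hne : J (u₁ 0) (u₂ 0) ≠ -1) :
    ∃ C : ℝ, 0 ≤ C ∧ ∀ t, 0 ≤ t → ‖1 - J (u₁ t) (u₂ t)‖ ≤ C * Real.exp (-K * t) := by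
  obtain ⟨z, hz⟩ : ∃ z : ℝ → ℂ, z = fun t => J (u₁ t) (u₂ t) := ⟨_, rfl⟩
  have hz' : ∀ t, z t = J (u₁ t) (u₂ t) := fun t => by rw [hz]
  have hd : ∀ t, 0 ≤ t → HasDerivWithinAt z (K / 2 * (1 - z t ^ 2)) (Ici 0) t := fun t ht => by
    rw [hz]
    exact H.hasDerivWithinAt_correlation hJ.conj_apply hh ht
  have cz : ContinuousOn z (Ici 0) := fun t ht => (hd t ht).continuousWithinAt
  -- `1 + z` solves a linear equation, hence it never vanishes
  have hp : ∀ t, 0 ≤ t → 1 + z t ≠ 0 := by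
    intro t ht
    have := eq_mul_exp_of_hasDerivWithinAt (f := fun t => 1 + z t)
      (a := fun t => K / 2 * (1 - z t)) (continuousOn_const.mul (continuousOn_const.sub cz))
      (fun t ht => ((hd t ht).const_add 1).congr_deriv (by ring)) ht
    rw [this]
    refine mul_ne_zero (fun h0 => hne ?_) (Complex.exp_ne_zero _)
    rw [← hz']
    linear_combination h0
  have hr : ∀ t, 0 ≤ t → (1 - z t) / (1 + z t)
      = (1 - z 0) / (1 + z 0) * Complex.exp (((-K * t : ℝ)) : ℂ) := by
    intro t ht
    have := eq_mul_exp_of_hasDerivWithinAt (f := fun t => (1 - z t) / (1 + z t))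
      (a := fun _ => -(K : ℂ)) continuousOn_const (fun t ht => by
        refine (((hd t ht).const_sub 1).fun_div ((hd t ht).const_add 1) (hp t ht)).congr_deriv ?_
        have := hp t ht
        field_simp
        ring) ht
    rw [this]
    congr 2
    simp
    ring
  have hn : ∀ t, 0 ≤ t → ‖1 + z t‖ ≤ 2 := by
    intro t ht
    have h1 := hJ.two_mul_norm_le (u₁ t) (u₂ t)
    rw [H.mass_eq_one hJ.conj_apply hh ht, H.symm.mass_eq_one hJ.conj_apply hh ht, ← hz',
      Complex.one_re] at h1
    have h2 := norm_add_le 1 (z t)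
    rw [norm_one] at h2
    linarith
  refine ⟨‖(1 - z 0) / (1 + z 0)‖ * 2, by positivity, fun t ht => ?_⟩
  have e : 1 - z t = (1 - z 0) / (1 + z 0) * Complex.exp (((-K * t : ℝ)) : ℂ) * (1 + z t) := by
    rw [← hr t ht, div_mul_cancel₀ _ (hp t ht)]
  rw [← hz', e, norm_mul, norm_mul, Complex.norm_exp, Complex.ofReal_re]
  calc _ ≤ ‖(1 - z 0) / (1 + z 0)‖ * Real.exp (-K * t) * 2 := by gcongr; exact hn t ht
    _ = _ := by ring

end Synchronization

end SchrodingerLohe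

/-! ### Decay of the energy of the difference, and uniform continuity of the flow -/

namespace SchrodingerLohe

section EnergyDecay

open Complex (I)

variable {E : Type*} [NormedAddCommGroup E] [NormedSpace ℂ E] {J h k : E →L⋆[ℂ] E →L[ℂ] ℂ}
  {K : ℝ} {u₁ u₂ : ℝ → E}

lemma IsWeakSolution.hasDerivWithinAt_energy [CompleteSpace E] {u F : ℝ → E}
    (hu : IsWeakSolution J h u F) (hk : ∀ u w, conj (k u w) = k w u) (hinv : IsInvariantForm J h k)
    {t : ℝ} (ht : 0 ≤ t) :
    HasDerivWithinAt (fun t => (k (u t) (u t)).re) (2 * (k (u t) (F t)).re) (Ici 0) t := by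
  have h1 := Complex.reCLM.hasFDerivAt.comp_hasDerivWithinAt t
    (hu.hasDerivWithinAt_form hinv hu ht)
  refine h1.congr_deriv ?_
  rw [Complex.reCLM_apply, Complex.add_re, ← hk, Complex.conj_re]
  ring

/-- The source of the difference: damping at rate `(K / 4) (1 + Re z)`, and a coupling to the sum
through the imaginary part of the correlation `z`. -/
lemma loheSource_sub_apply {x y : ℝ} {t : ℝ} (h₁ : J (u₁ t) (u₂ t) = x + I * y)
    (h₂ : J (u₂ t) (u₁ t) = x - I * y) :
    (loheSource J K u₁ u₂ - loheSource J K u₂ u₁) t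
      = (K / 4 : ℂ) • (-(1 + x : ℂ) • (u₁ - u₂) t + (I * y : ℂ) • (u₁ + u₂) t) := by
  simp only [loheSource, Pi.sub_apply, Pi.add_apply, h₁, h₂]
  module

lemma loheSource_add_apply {x y : ℝ} {t : ℝ} (h₁ : J (u₁ t) (u₂ t) = x + I * y)
    (h₂ : J (u₂ t) (u₁ t) = x - I * y) :
    (loheSource J K u₁ u₂ + loheSource J K u₂ u₁) t
      = (K / 4 : ℂ) • ((1 - x : ℂ) • (u₁ + u₂) t + (I * y : ℂ) • (u₁ - u₂) t) := by
  simp only [loheSource, Pi.sub_apply, Pi.add_apply, h₁, h₂]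
  module

/-- Grönwall estimates for the energy `p` of the difference and the energy `q` of the sum. -/
lemma decay_of_hasDerivWithinAt {p q p' q' : ℝ → ℝ} {C : ℝ} (hK : 0 < K) (hC : 0 ≤ C)
    (hp0 : ∀ t, 0 ≤ t → 0 ≤ p t) (hq0 : ∀ t, 0 ≤ t → 0 ≤ q t)
    (hp : ∀ t, 0 ≤ t → HasDerivWithinAt p (p' t) (Ici 0) t)
    (hq : ∀ t, 0 ≤ t → HasDerivWithinAt q (q' t) (Ici 0) t)
    (hp' : ∀ t, 0 ≤ t → p' t ≤ -K * p t + K * (C * Real.exp (-K * t)) * (p t + q t))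
    (hq' : ∀ t, 0 ≤ t → q' t ≤ K * (C * Real.exp (-K * t)) * (p t + q t)) :
    ∃ D : ℝ, 0 ≤ D ∧ ∀ t, 0 ≤ t → q t ≤ D ∧ p t ≤ D * Real.exp (-(K / 2) * t) := by
  have hexp : ∀ t : ℝ, HasDerivAt (fun t => Real.exp (-K * t)) (-K * Real.exp (-K * t)) t := by
    intro t
    have := ((hasDerivAt_id t).const_mul (-K)).exp
    refine this.congr_deriv ?_
    simp only [id]
    ring
  obtain ⟨B, hB⟩ : ∃ B : ℝ, B = (p 0 + q 0) * Real.exp (2 * C) := ⟨_, rfl⟩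
  have hB0 : 0 ≤ B := by
    rw [hB]
    exact mul_nonneg (add_nonneg (hp0 0 le_rfl) (hq0 0 le_rfl)) (Real.exp_pos _).le
  have hsum : ∀ t, 0 ≤ t → p t + q t ≤ B := by
    intro t ht
    -- `exp (2 C e^{-Kt})` is an integrating factor for the total energy
    have h1 := le_of_hasDerivWithinAt_nonpos
      (f := fun t => (p t + q t) * Real.exp (2 * C * Real.exp (-K * t)))
      (f' := fun t => (p' t + q' t) * Real.exp (2 * C * Real.exp (-K * t))
        + (p t + q t) * (Real.exp (2 * C * Real.exp (-K * t))
          * (2 * C * (-K * Real.exp (-K * t)))))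
      (fun t ht => ((hp t ht).add (hq t ht)).mul
        ((hexp t).const_mul (2 * C)).exp.hasDerivWithinAt) (fun t ht => by
        have e1 := hp' t ht
        have e2 := hq' t ht
        have e3 : 0 ≤ K * p t := mul_nonneg hK.le (hp0 t ht)
        have e4 : p' t + q' t - 2 * C * (K * Real.exp (-K * t)) * (p t + q t) ≤ 0 := by
          linarith
        have e5 := mul_nonpos_of_nonpos_of_nonneg e4 (Real.exp_pos (2 * C * Real.exp (-K * t))).le
        linarith) le_rfl ht
    simp only [mul_zero, Real.exp_zero, mul_one] at h1
    rw [hB]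
    refine le_trans ?_ h1
    have e1 : 1 ≤ Real.exp (2 * C * Real.exp (-K * t)) := Real.one_le_exp (by positivity)
    exact le_mul_of_one_le_right (add_nonneg (hp0 t ht) (hq0 t ht)) e1
  obtain ⟨D, hD⟩ : ∃ D : ℝ, D = B + (p 0 + 2 * (C * B)) := ⟨_, rfl⟩
  have hp00 := hp0 0 le_rfl
  have hCB : 0 ≤ C * B := mul_nonneg hC hB0
  refine ⟨D, by rw [hD]; positivity, fun t ht => ⟨?_, ?_⟩⟩
  · have := hsum t ht
    have := hp0 t ht
    rw [hD]
    linarith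
  have hexp' : ∀ t : ℝ, HasDerivAt (fun t => Real.exp (K * t)) (K * Real.exp (K * t)) t := by
    intro t
    have := ((hasDerivAt_id t).const_mul K).exp
    refine this.congr_deriv ?_
    simp only [id]
    ring
  have hprod : ∀ t : ℝ, Real.exp (-K * t) * Real.exp (K * t) = 1 := fun t => by
    rw [← Real.exp_add, neg_mul, neg_add_cancel, Real.exp_zero]
  -- `p exp (K t)` grows at most linearly, which costs half of the decay rate
  have h1 := le_of_hasDerivWithinAt_nonpos
    (f := fun t => p t * Real.exp (K * t) - K * (C * B) * t)
    (f' := fun t => p' t * Real.exp (K * t) + p t * (K * Real.exp (K * t)) - K * (C * B) * 1)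
    (fun t ht => ((hp t ht).mul (hexp' t).hasDerivWithinAt).sub
      ((hasDerivWithinAt_id t _).const_mul (K * (C * B)))) (fun t ht => by
      have e1 : p' t ≤ -K * p t + K * (C * Real.exp (-K * t)) * B := by
        refine (hp' t ht).trans ?_
        gcongr
        exact hsum t ht
      have e2 := mul_le_mul_of_nonneg_right e1 (Real.exp_pos (K * t)).le
      have e3 : (-K * p t + K * (C * Real.exp (-K * t)) * B) * Real.exp (K * t)
          = -K * p t * Real.exp (K * t)
            + K * C * B * (Real.exp (-K * t) * Real.exp (K * t)) := by ring
      rw [e3, hprod] at e2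
      linarith) le_rfl ht
  simp only [mul_zero, Real.exp_zero, mul_one, sub_zero] at h1
  have h2 : p t ≤ (p 0 + K * (C * B) * t) * Real.exp (-K * t) := by
    have := mul_le_mul_of_nonneg_right (sub_le_iff_le_add.1 h1) (Real.exp_pos (-K * t)).le
    rwa [mul_assoc, mul_comm (Real.exp (K * t)), hprod, mul_one] at this
  have h3 : K / 2 * t ≤ Real.exp (K / 2 * t) := by
    have := Real.add_one_le_exp (K / 2 * t)
    linarith
  have h4 : 1 ≤ Real.exp (K / 2 * t) := Real.one_le_exp (by positivity)
  have h5 : Real.exp (K / 2 * t) * Real.exp (-K * t) = Real.exp (-(K / 2) * t) := by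
    rw [← Real.exp_add]
    congr 1
    ring
  calc p t ≤ (p 0 + 2 * (C * B) * (K / 2 * t)) * Real.exp (-K * t) :=
        h2.trans (le_of_eq (by ring))
    _ ≤ (p 0 * Real.exp (K / 2 * t) + 2 * (C * B) * Real.exp (K / 2 * t))
        * Real.exp (-K * t) := by
        gcongr
        exact le_mul_of_one_le_right hp00 h4
    _ = (p 0 + 2 * (C * B)) * (Real.exp (K / 2 * t) * Real.exp (-K * t)) := by ring
    _ ≤ D * Real.exp (-(K / 2) * t) := by
        rw [h5]
        exact mul_le_mul_of_nonneg_right (by rw [hD]; linarith) (Real.exp_pos _).le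

/-- Exponential decay of the difference in the energy norm, and boundedness of the solutions. -/
theorem IsLohePair.exists_decay [CompleteSpace E] (H : IsLohePair J h K u₁ u₂) (hK : 0 < K)
    (hJ : IsPositiveForm J) (hh : ∀ u w, conj (h u w) = h w u)
    (hk : IsPositiveForm k) (hinv : IsInvariantForm J h k) {c : ℝ} (hc : 0 < c)
    (hcoer : ∀ u, c * ‖u‖ ^ 2 ≤ (k u u).re) (hne : J (u₁ 0) (u₂ 0) ≠ -1) :
    ∃ D : ℝ, 0 ≤ D ∧ ∀ t, 0 ≤ t → ‖u₁ t + u₂ t‖ ≤ D ∧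
      ‖u₁ t - u₂ t‖ ≤ D * Real.exp (-(K / 4) * t) := by
  obtain ⟨C, hC, hz⟩ := H.exists_correlation_bound hJ hh hne
  obtain ⟨p, hp⟩ : ∃ p : ℝ → ℝ, p = fun t => (k ((u₁ - u₂) t) ((u₁ - u₂) t)).re := ⟨_, rfl⟩
  obtain ⟨q, hq⟩ : ∃ q : ℝ → ℝ, q = fun t => (k ((u₁ + u₂) t) ((u₁ + u₂) t)).re := ⟨_, rfl⟩
  have hdec : ∀ t, ∃ x y : ℝ, J (u₁ t) (u₂ t) = x + I * y ∧ J (u₂ t) (u₁ t) = x - I * y := by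
    intro t
    refine ⟨(J (u₁ t) (u₂ t)).re, (J (u₁ t) (u₂ t)).im, ?_, ?_⟩
    · rw [mul_comm, Complex.re_add_im]
    · rw [← hJ.conj_apply]
      apply Complex.ext <;> simp
  have bound : ∀ t, 0 ≤ t → ∀ x y : ℝ, J (u₁ t) (u₂ t) = x + I * y →
      |1 - x| ≤ C * Real.exp (-K * t) ∧ |y| ≤ C * Real.exp (-K * t) := by
    intro t ht x y e
    have h1 := hz t ht
    rw [e] at h1
    have e1 : (1 - ((x : ℂ) + I * y)).re = 1 - x := by simp
    have e2 : (1 - ((x : ℂ) + I * y)).im = -y := by simp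
    refine ⟨?_, ?_⟩
    · rw [← e1]; exact (Complex.abs_re_le_norm _).trans h1
    · rw [← abs_neg, ← e2]; exact (Complex.abs_im_le_norm _).trans h1
  have him : ∀ t, |(k ((u₁ - u₂) t) ((u₁ + u₂) t)).im| ≤ (p t + q t) / 2 ∧
      |(k ((u₁ + u₂) t) ((u₁ - u₂) t)).im| ≤ (p t + q t) / 2 := by
    intro t
    have h1 := hk.two_mul_norm_le ((u₁ - u₂) t) ((u₁ + u₂) t)
    have h2 := hk.two_mul_norm_le ((u₁ + u₂) t) ((u₁ - u₂) t)
    have h3 := Complex.abs_im_le_norm (k ((u₁ - u₂) t) ((u₁ + u₂) t))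
    have h4 := Complex.abs_im_le_norm (k ((u₁ + u₂) t) ((u₁ - u₂) t))
    rw [hp, hq]
    constructor <;> linarith
  have hp0 : ∀ t, 0 ≤ t → 0 ≤ p t := fun t _ => by rw [hp]; exact hk.nonneg _
  have hq0 : ∀ t, 0 ≤ t → 0 ≤ q t := fun t _ => by rw [hq]; exact hk.nonneg _
  obtain ⟨D, hD, hDt⟩ := decay_of_hasDerivWithinAt (p := p) (q := q) hK hC hp0 hq0
    (fun t ht => by
      rw [hp]; exact (H.fst.sub H.snd).hasDerivWithinAt_energy hk.conj_apply hinv ht)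
    (fun t ht => by
      rw [hq]; exact (H.fst.add H.snd).hasDerivWithinAt_energy hk.conj_apply hinv ht)
    (fun t ht => by
      obtain ⟨x, y, e₁, e₂⟩ := hdec t
      obtain ⟨b1, b2⟩ := bound t ht x y e₁
      have e3 : 2 * (k ((u₁ - u₂) t) ((loheSource J K u₁ u₂ - loheSource J K u₂ u₁) t)).re
          = K / 2 * (-(1 + x) * p t - y * (k ((u₁ - u₂) t) ((u₁ + u₂) t)).im) := by
        rw [loheSource_sub_apply e₁ e₂, hp]
        simp only [map_smul, map_add, smul_eq_mul]
        rw [form_self_eq hk.conj_apply]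
        simp [Complex.add_re, Complex.mul_re, Complex.mul_im]
        ring
      rw [e3]
      have e4 : |y * (k ((u₁ - u₂) t) ((u₁ + u₂) t)).im|
          ≤ C * Real.exp (-K * t) * ((p t + q t) / 2) := by
        rw [abs_mul]
        gcongr
        exact (him t).1
      have e5 : (1 - x) * p t ≤ C * Real.exp (-K * t) * (p t + q t) := by
        have h1 := hp0 t ht
        have h2 := hq0 t ht
        gcongr
        · exact (le_abs_self _).trans b1
        · linarith
      have e6 := neg_abs_le (y * (k ((u₁ - u₂) t) ((u₁ + u₂) t)).im)
      have e7 : -(1 + x) * p t - y * (k ((u₁ - u₂) t) ((u₁ + u₂) t)).im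
          ≤ -2 * p t + 2 * (C * Real.exp (-K * t) * (p t + q t)) := by
        have h1 : 0 ≤ C * Real.exp (-K * t) * (p t + q t) :=
          mul_nonneg (by positivity) (add_nonneg (hp0 t ht) (hq0 t ht))
        linarith
      have e8 := mul_le_mul_of_nonneg_left e7 (by positivity : 0 ≤ K / 2)
      linarith)
    (fun t ht => by
      obtain ⟨x, y, e₁, e₂⟩ := hdec t
      obtain ⟨b1, b2⟩ := bound t ht x y e₁
      have e3 : 2 * (k ((u₁ + u₂) t) ((loheSource J K u₁ u₂ + loheSource J K u₂ u₁) t)).re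
          = K / 2 * ((1 - x) * q t - y * (k ((u₁ + u₂) t) ((u₁ - u₂) t)).im) := by
        rw [loheSource_add_apply e₁ e₂, hq]
        simp only [map_smul, map_add, smul_eq_mul]
        rw [form_self_eq hk.conj_apply]
        simp [Complex.add_re, Complex.mul_re, Complex.mul_im]
        ring
      rw [e3]
      have e4 : |y * (k ((u₁ + u₂) t) ((u₁ - u₂) t)).im|
          ≤ C * Real.exp (-K * t) * ((p t + q t) / 2) := by
        rw [abs_mul]
        gcongr
        exact (him t).2
      have e5 : (1 - x) * q t ≤ C * Real.exp (-K * t) * (p t + q t) := by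
        have h1 := hp0 t ht
        have h2 := hq0 t ht
        gcongr
        · exact (le_abs_self _).trans b1
        · linarith
      have e6 := neg_abs_le (y * (k ((u₁ + u₂) t) ((u₁ - u₂) t)).im)
      have e7 : (1 - x) * q t - y * (k ((u₁ + u₂) t) ((u₁ - u₂) t)).im
          ≤ 2 * (C * Real.exp (-K * t) * (p t + q t)) := by
        have h1 : 0 ≤ C * Real.exp (-K * t) * (p t + q t) :=
          mul_nonneg (by positivity) (add_nonneg (hp0 t ht) (hq0 t ht))
        linarith
      have e8 := mul_le_mul_of_nonneg_left e7 (by positivity : 0 ≤ K / 2)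
      linarith)
  refine ⟨√(D / c), Real.sqrt_nonneg _, fun t ht => ⟨?_, ?_⟩⟩
  · refine Real.le_sqrt_of_sq_le ?_
    rw [le_div_iff₀ hc, mul_comm]
    refine (hcoer _).trans ?_
    have := (hDt t ht).1
    rwa [hq] at this
  · have h1 : ‖u₁ t - u₂ t‖ ^ 2 ≤ (√(D / c) * Real.exp (-(K / 4) * t)) ^ 2 := by
      have e1 : Real.exp (-(K / 4) * t) ^ 2 = Real.exp (-(K / 2) * t) := by
        rw [← Real.exp_nat_mul]
        congr 1
        push_cast
        ring
      rw [mul_pow, Real.sq_sqrt (by positivity), e1, div_mul_eq_mul_div, le_div_iff₀ hc, mul_comm]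
      refine (hcoer _).trans ?_
      have := (hDt t ht).2
      rwa [hp] at this
    exact abs_le_of_sq_le_sq' h1 (by positivity) |>.2

/-- If the sources decay, a bounded weak solution is uniformly approximated, for large times, by
elements on which the operator is bounded with respect to the seminorm `N` of the pivot space: its
time averages over a short window. The increment `u (t + θ) - u t` is again a weak solution, and its
energy at a late time `t₀` controls its energy at all later times. -/
theorem IsWeakSolution.exists_domain_approx [CompleteSpace E] {u F : ℝ → E}
    (hu : IsWeakSolution J h u F) (hk : IsPositiveForm k) (hinv : IsInvariantForm J h k) {c : ℝ}
    (hc : 0 < c) (hcoer : ∀ u, c * ‖u‖ ^ 2 ≤ (k u u).re) {N : E → ℝ} (hN0 : ∀ w, 0 ≤ N w)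
    (hN : ∀ w v, ‖J w v‖ ≤ N w * ‖v‖) {M A γ : ℝ} (hγ : 0 < γ) (hA : 0 ≤ A)
    (hM : ∀ t, 0 ≤ t → ‖u t‖ ≤ M) (hF : ∀ t, 0 ≤ t → ‖F t‖ ≤ A * Real.exp (-γ * t))
    {ε : ℝ} (hε : 0 < ε) :
    ∃ C : ℝ, ∀ᶠ t in atTop, ∃ y, ‖u t - y‖ ≤ ε ∧ ∀ w, ‖h w y‖ ≤ C * N w := by
  obtain ⟨B, hB0, hB⟩ := exists_form_bound k
  have hM0 : 0 ≤ M := (norm_nonneg _).trans (hM 0 le_rfl)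
  have hFA : ∀ t, 0 ≤ t → ‖F t‖ ≤ A := fun t ht => (hF t ht).trans
    (mul_le_of_le_one_right hA (Real.exp_le_one_iff.2 (by nlinarith)))
  -- the energy of the increments, up to the contribution `R exp (-γ t₀)` of the sources
  obtain ⟨R, hR⟩ : ∃ R : ℝ, R = 2 * (B * (2 * M) * (2 * A)) / γ := ⟨_, rfl⟩
  have hR0 : 0 ≤ R := by rw [hR]; positivity
  have incr : ∀ θ t₀ t, 0 ≤ θ → 0 ≤ t₀ → t₀ ≤ t → c * ‖u (t + θ) - u t‖ ^ 2
      ≤ B * ‖u (t₀ + θ) - u t₀‖ * ‖u (t₀ + θ) - u t₀‖ + R * Real.exp (-γ * t₀) := by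
    intro θ t₀ t hθ ht₀ ht
    have hD := (hu.comp_add_const hθ).sub hu
    have hexp : ∀ t : ℝ, HasDerivAt (fun t => R * Real.exp (-γ * t))
        (-(2 * (B * (2 * M) * (2 * A))) * Real.exp (-γ * t)) t := by
      intro t
      have := (((hasDerivAt_id t).const_mul (-γ)).exp).const_mul R
      refine this.congr_deriv ?_
      rw [hR]
      simp only [id]
      field_simp
    have h1 := le_of_hasDerivWithinAt_nonpos
      (fun t ht => (hD.hasDerivWithinAt_energy hk.conj_apply hinv ht).add
        (hexp t).hasDerivWithinAt) (fun t ht => by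
        have n1 : ‖u (t + θ) - u t‖ ≤ 2 * M := by
          have a1 := hM (t + θ) (by positivity)
          have a2 := hM t ht
          exact (norm_sub_le _ _).trans (by linarith)
        have n2 : ‖F (t + θ) - F t‖ ≤ 2 * A * Real.exp (-γ * t) := by
          have a1 := hF (t + θ) (by positivity)
          have a2 := hF t ht
          have a3 : Real.exp (-γ * (t + θ)) ≤ Real.exp (-γ * t) :=
            Real.exp_le_exp.2 (by nlinarith)
          have a4 := mul_le_mul_of_nonneg_left a3 hA
          exact (norm_sub_le _ _).trans (by linarith)
        have n3 : (k (u (t + θ) - u t) (F (t + θ) - F t)).re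
            ≤ B * (2 * M) * (2 * A * Real.exp (-γ * t)) :=
          ((Complex.re_le_norm _).trans (hB _ _)).trans (by gcongr)
        simp only [Pi.sub_apply]
        linarith) ht₀ ht
    have h2 : (k (u (t₀ + θ) - u t₀) (u (t₀ + θ) - u t₀)).re
        ≤ B * ‖u (t₀ + θ) - u t₀‖ * ‖u (t₀ + θ) - u t₀‖ := (Complex.re_le_norm _).trans (hB _ _)
    have h3 := hcoer (u (t + θ) - u t)
    have h4 : 0 ≤ R * Real.exp (-γ * t) := by positivity
    simp only [Pi.add_apply, Pi.sub_apply] at h1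
    linarith
  -- a late time after which the sources contribute little
  obtain ⟨t₀, ht₀, hsmall⟩ : ∃ t₀, 0 ≤ t₀ ∧ R * Real.exp (-γ * t₀) ≤ c * ε ^ 2 / 2 := by
    have lim : Tendsto (fun t => R * Real.exp (-γ * t)) atTop (𝓝 0) := by
      have h1 : Tendsto (fun t : ℝ => -γ * t) atTop atBot :=
        tendsto_id.const_mul_atTop_of_neg (by linarith)
      simpa using (Real.tendsto_exp_atBot.comp h1).const_mul R
    obtain ⟨t₀, h1, h2⟩ := ((lim.eventually_le_const (by positivity : 0 < c * ε ^ 2 / 2)).and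
      (eventually_ge_atTop 0)).exists
    exact ⟨t₀, h2, h1⟩
  -- a window on which the solution has hardly moved at the time `t₀`
  obtain ⟨s, hs, hwin⟩ : ∃ s > 0, ∀ θ ∈ Icc (0 : ℝ) s,
      B * ‖u (t₀ + θ) - u t₀‖ * ‖u (t₀ + θ) - u t₀‖ ≤ c * ε ^ 2 / 2 := by
    have cU := continuous_comp_max hu.continuousOn
    have hc1 : Continuous fun θ => B * ‖u (max (t₀ + θ) 0) - u t₀‖
        * ‖u (max (t₀ + θ) 0) - u t₀‖ := by
      have : Continuous fun θ => u (max (t₀ + θ) 0) := cU.comp (by fun_prop)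
      have hn := (this.sub (continuous_const (y := u t₀))).norm
      exact (continuous_const.mul hn).mul hn
    have lim := hc1.tendsto 0
    rw [add_zero, max_eq_left ht₀, sub_self, norm_zero, mul_zero] at lim
    obtain ⟨s, hs, hball⟩ := Metric.eventually_nhds_iff.1
      (lim.eventually_le_const (by positivity : 0 < c * ε ^ 2 / 2))
    refine ⟨s / 2, by positivity, fun θ hθ => ?_⟩
    have := hball (y := θ) (by
      rw [Real.dist_0_eq_abs, abs_of_nonneg hθ.1]
      linarith [hθ.2])
    rwa [max_eq_left (add_nonneg ht₀ hθ.1)] at this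
  refine ⟨s⁻¹ * (2 * M) + A, ?_⟩
  filter_upwards [eventually_ge_atTop t₀] with t ht
  have ht0 : 0 ≤ t := ht₀.trans ht
  have cU := continuous_comp_max hu.continuousOn
  have mt : max t 0 = t := max_eq_left ht0
  refine ⟨steklov (fun t => u (max t 0)) s t, ?_, fun w => ?_⟩
  · rw [norm_sub_rev]
    have key := norm_steklov_sub_le cU (s := s) (t := t) (ε := ε) fun θ hθ => ?_
    · rwa [mt] at key
    have hsθ : 0 ≤ s * θ := mul_nonneg hs.le hθ.1
    rw [mt, max_eq_left (add_nonneg ht0 hsθ)]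
    have h1 := incr (s * θ) t₀ t hsθ ht₀ ht
    have h2 := hwin (s * θ) ⟨hsθ, mul_le_of_le_one_right hs.le hθ.2⟩
    have h3 : ‖u (t + s * θ) - u t‖ ^ 2 ≤ ε ^ 2 := by
      have : c * ‖u (t + s * θ) - u t‖ ^ 2 ≤ c * ε ^ 2 := by linarith
      exact le_of_mul_le_mul_left this hc
    exact abs_le_of_sq_le_sq' h3 hε.le |>.2
  · rw [hu.steklov_eq hs ht0 w, norm_mul, Complex.norm_I, one_mul]
    refine (hN w _).trans ?_
    rw [mul_comm]
    refine mul_le_mul_of_nonneg_right ?_ (hN0 w)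
    have n1 : ‖u (t + s) - u t‖ ≤ 2 * M := by
      have a1 := hM (t + s) (by positivity)
      have a2 := hM t ht0
      exact (norm_sub_le _ _).trans (by linarith)
    have n2 : ‖steklov (fun t => F (max t 0)) s t‖ ≤ A :=
      norm_steklov_le fun θ _ => hFA _ (le_max_right _ _)
    refine (norm_sub_le _ _).trans ?_
    rw [norm_smul, norm_inv, Real.norm_of_nonneg hs.le]
    gcongr

end EnergyDecay

end SchrodingerLohe

/-! ### Synchronization in `H¹` -/

namespace SchrodingerLohe

section Application

open Complex (I)

section Abstract

variable {E : Type*} [NormedAddCommGroup E] [NormedSpace ℂ E] {J h k : E →L⋆[ℂ] E →L[ℂ] ℂ}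
  {K : ℝ} {u₁ u₂ : ℝ → E}

/-- The source of the second equation is `(K / 4) ((u₁ - u₂) + (1 - z) u₂)`, hence it decays. -/
lemma IsLohePair.exists_source_bound [CompleteSpace E] (H : IsLohePair J h K u₁ u₂) (hK : 0 < K)
    (hJ : IsPositiveForm J) (hh : ∀ u w, conj (h u w) = h w u) (hne : J (u₁ 0) (u₂ 0) ≠ -1)
    {D : ℝ} (hD : 0 ≤ D) (hbd : ∀ t, 0 ≤ t → ‖u₂ t‖ ≤ D)
    (hdecay : ∀ t, 0 ≤ t → ‖u₁ t - u₂ t‖ ≤ D * Real.exp (-(K / 4) * t)) :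
    ∃ A : ℝ, 0 ≤ A ∧ ∀ t, 0 ≤ t → ‖loheSource J K u₂ u₁ t‖ ≤ A * Real.exp (-(K / 4) * t) := by
  obtain ⟨C, hC, hz⟩ := H.exists_correlation_bound hJ hh hne
  refine ⟨K / 4 * (D + C * D), by positivity, fun t ht => ?_⟩
  have e : loheSource J K u₂ u₁ t
      = (K / 4 : ℂ) • ((u₁ t - u₂ t) + (1 - J (u₁ t) (u₂ t)) • u₂ t) := by
    simp only [loheSource]
    module
  have hn : ‖(K / 4 : ℂ)‖ = K / 4 := by
    rw [norm_div, Complex.norm_real, Real.norm_of_nonneg hK.le, Complex.norm_ofNat]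
  have hexp : Real.exp (-K * t) ≤ Real.exp (-(K / 4) * t) :=
    Real.exp_le_exp.2 (by nlinarith [mul_nonneg hK.le ht])
  have h1 : ‖(1 - J (u₁ t) (u₂ t)) • u₂ t‖ ≤ C * Real.exp (-(K / 4) * t) * D := by
    rw [norm_smul]
    exact mul_le_mul ((hz t ht).trans (mul_le_mul_of_nonneg_left hexp hC)) (hbd t ht)
      (norm_nonneg _) (by positivity)
  rw [e, norm_smul, hn, mul_assoc]
  refine mul_le_mul_of_nonneg_left ?_ (by positivity)
  have h2 := norm_add_le (u₁ t - u₂ t) ((1 - J (u₁ t) (u₂ t)) • u₂ t)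
  have h3 := hdecay t ht
  linarith

/-- An equation tested with all `w` in the form of the Schrödinger–Lohe system is a weak solution
with the corresponding source. -/
lemma isWeakSolution_of_tested {u v : ℝ → E} (hu : ContinuousOn u (Ici 0))
    (hv : ContinuousOn v (Ici 0))
    (heq : ∀ t, 0 ≤ t → ∀ w, ∃ D : ℂ, HasDerivWithinAt (fun s => J w (u s)) D (Ici 0) t ∧
      I * D = h w (u t) + I * K / 4 * (J w (v t) - J (v t) (u t) * J w (u t))) :
    IsWeakSolution J h u (loheSource J K u v) where
  continuousOn := hu
  continuousOn_source := continuousOn_loheSource hu hv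
  hasDerivWithinAt t ht w := by
    obtain ⟨D, hD, hDeq⟩ := heq t ht w
    refine hD.congr_deriv ?_
    simp only [loheSource, map_smul, map_sub, smul_eq_mul]
    linear_combination (-I) * hDeq
      + (D - K / 4 * (J w (v t) - J (v t) (u t) * J w (u t))) * Complex.I_sq

/-- Synchronization: the difference of the two solutions decays, while the second solution is
bounded and, at all late times, close to elements `y` of the domain of the operator whose image
under it is bounded uniformly in time. -/
theorem IsLohePair.synchronization [CompleteSpace E] (H : IsLohePair J h K u₁ u₂) (hK : 0 < K)
    (hJ : IsPositiveForm J) (hh : ∀ u w, conj (h u w) = h w u)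
    (hk : IsPositiveForm k) (hinv : IsInvariantForm J h k) {c : ℝ} (hc : 0 < c)
    (hcoer : ∀ u, c * ‖u‖ ^ 2 ≤ (k u u).re) {N : E → ℝ} (hN0 : ∀ w, 0 ≤ N w)
    (hN : ∀ w v, ‖J w v‖ ≤ N w * ‖v‖) (hne : J (u₁ 0) (u₂ 0) ≠ -1) :
    Tendsto (fun t => u₁ t - u₂ t) atTop (𝓝 0) ∧
      ∃ M : ℝ, (∀ t, 0 ≤ t → ‖u₂ t‖ ≤ M) ∧
        ∀ ε > 0, ∃ C : ℝ, ∀ᶠ t in atTop, ∃ y, ‖u₂ t - y‖ ≤ ε ∧ ∀ w, ‖h w y‖ ≤ C * N w := by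
  obtain ⟨D, hD, hdecay⟩ := H.exists_decay hK hJ hh hk hinv hc hcoer hne
  have hK4 : 0 < K / 4 := by positivity
  have hbd : ∀ t, 0 ≤ t → ‖u₂ t‖ ≤ D := by
    intro t ht
    obtain ⟨a1, a2⟩ := hdecay t ht
    have e : (2 : ℂ) • u₂ t = (u₁ t + u₂ t) - (u₁ t - u₂ t) := by module
    have a3 := norm_sub_le (u₁ t + u₂ t) (u₁ t - u₂ t)
    rw [← e, norm_smul, Complex.norm_ofNat] at a3
    have a4 : D * Real.exp (-(K / 4) * t) ≤ D :=
      mul_le_of_le_one_right hD (Real.exp_le_one_iff.2 (by nlinarith))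
    linarith
  obtain ⟨A, hA, hF⟩ := H.exists_source_bound hK hJ hh hne hD hbd
    fun t ht => (hdecay t ht).2
  refine ⟨?_, D, hbd, fun ε hε => H.snd.exists_domain_approx hk hinv hc hcoer hN0 hN hK4
    hA hbd hF hε⟩
  have lim : Tendsto (fun t => D * Real.exp (-(K / 4) * t)) atTop (𝓝 0) := by
    have h1 : Tendsto (fun t : ℝ => -(K / 4) * t) atTop atBot :=
      tendsto_id.const_mul_atTop_of_neg (by linarith)
    simpa using (Real.tendsto_exp_atBot.comp h1).const_mul D
  refine squeeze_zero_norm' ?_ lim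
  filter_upwards [eventually_ge_atTop 0] with t ht using (hdecay t ht).2

end Abstract

variable {d : ℕ} {V : Space d → ℝ} {K : ℝ} {ψ₁ ψ₂ : ℝ → H1 d}

lemma isPositiveForm_pivotForm : IsPositiveForm (pivotForm d) where
  conj_apply := conj_pivotForm
  nonneg u := by
    rw [pivotForm_apply]
    exact inner_self_nonneg (𝕜 := ℂ)

lemma isPositiveForm_shiftedForm (hV : HasEnergySpaceH1 V) {c b : ℝ} (hc : 0 < c)
    (hcoer : ∀ u : H1 d, c * ‖u‖ ^ 2 ≤ (shiftedForm hV b u u).re) :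
    IsPositiveForm (shiftedForm hV b) where
  conj_apply u w := by
    simp only [shiftedForm, add_apply, smul_apply, smul_eq_mul, map_add, map_mul,
      conj_energyForm, conj_pivotForm, Complex.conj_ofReal]
  nonneg u := (by positivity : 0 ≤ c * ‖u‖ ^ 2).trans (hcoer u)

lemma isInvariantForm_shiftedForm (hV : HasEnergySpaceH1 V) (b : ℝ) :
    IsInvariantForm (pivotForm d) (energyForm hV) (shiftedForm hV b) :=
  (isInvariantForm_self conj_pivotForm (conj_energyForm hV)).add_smul
    (isInvariantForm_pivot conj_pivotForm (conj_energyForm hV)) b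

lemma SolvesLoheEquation.isWeakSolution (hV : HasEnergySpaceH1 V) {u v : ℝ → H1 d}
    (h : SolvesLoheEquation K V u v) (hu : ContinuousOn u (Ici 0)) (hv : ContinuousOn v (Ici 0)) :
    IsWeakSolution (pivotForm d) (energyForm hV) u (loheSource (pivotForm d) K u v) :=
  isWeakSolution_of_tested hu hv h

lemma pivotForm_self_eq_one {ψ : H1 d} (h : ‖toL2 ψ‖ = 1) : pivotForm d ψ ψ = 1 := by
  rw [pivotForm_apply, inner_self_eq_norm_sq_to_K, h]
  simp

lemma IsLoheSolution.isLohePair (hV : HasEnergySpaceH1 V) (h : IsLoheSolution K V ψ₁ ψ₂)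
    (h₁ : ‖toL2 (ψ₁ 0)‖ = 1) (h₂ : ‖toL2 (ψ₂ 0)‖ = 1) :
    IsLohePair (pivotForm d) (energyForm hV) K ψ₁ ψ₂ where
  fst := h.equation₁.isWeakSolution hV h.continuousOn₁ h.continuousOn₂
  snd := h.equation₂.isWeakSolution hV h.continuousOn₂ h.continuousOn₁
  mass_fst := pivotForm_self_eq_one h₁
  mass_snd := pivotForm_self_eq_one h₂

lemma norm_pivotForm_le (w v : H1 d) : ‖pivotForm d w v‖ ≤ ‖toL2 w‖ * ‖v‖ := by
  rw [pivotForm_apply]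
  exact (norm_inner_le_norm _ _).trans
    (mul_le_mul_of_nonneg_left (norm_toL2_le v) (norm_nonneg _))

theorem IsLoheSolution.synchronization (h : IsLoheSolution K V ψ₁ ψ₂) (hK : 0 < K)
    (hV : HasEnergySpaceH1 V) (h₁ : ‖toL2 (ψ₁ 0)‖ = 1) (h₂ : ‖toL2 (ψ₂ 0)‖ = 1)
    (hne : inner ℂ (toL2 (ψ₁ 0)) (toL2 (ψ₂ 0)) ≠ -1) :
    Tendsto (fun t => ψ₁ t - ψ₂ t) atTop (𝓝 0) ∧
      ∃ M : ℝ, (∀ t, 0 ≤ t → ‖ψ₂ t‖ ≤ M) ∧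
        ∀ ε > 0, ∃ C : ℝ, ∀ᶠ t in atTop, ∃ y : H1 d, ‖ψ₂ t - y‖ ≤ ε ∧
          ∀ w, ‖energyForm hV w y‖ ≤ C * ‖toL2 w‖ := by
  have H := h.isLohePair hV h₁ h₂
  obtain ⟨c, hc, b, hcoer⟩ := hV.exists_coercive
  have hk := isPositiveForm_shiftedForm hV hc hcoer
  have hinv := isInvariantForm_shiftedForm hV b
  exact H.synchronization hK isPositiveForm_pivotForm (conj_energyForm hV) hk hinv hc hcoer
    (fun w => norm_nonneg (toL2 w)) norm_pivotForm_le hne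

end Application

/-! ### Weak gradient of the amplitude, and bounds on the hydrodynamic variables -/

section Hydrodynamic

variable {d : ℕ}

/-- The field `Re(conj(φ) ∇ψ)`, which is the weak gradient of `√ρ` when `φ` is a polar factor of
`ψ`. -/
noncomputable def gradSqrtDensity (ψ : H1 d) (φ : Space d → ℂ) (x : Space d) :
    EuclideanSpace ℝ (Fin d) :=
  WithLp.toLp 2 (fun j => (conj (φ x) * grad ψ x j).re)

lemma norm_polarGrad_le {ψ : H1 d} {φ : Space d → ℂ} (h : IsPolarFactor ψ φ) :
    ∀ᵐ x, ‖polarGrad ψ φ x‖ ≤ ‖grad ψ x‖ := by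
  filter_upwards [h.norm_le] with x hx
  rw [polarGrad, norm_smul, RCLike.norm_conj]
  exact mul_le_of_le_one_left (norm_nonneg _) hx

lemma norm_toLp_le_of_abs_le {v : Fin d → ℝ} {z : EuclideanSpace ℂ (Fin d)}
    (h : ∀ j, |v j| ≤ ‖z j‖) : ‖(WithLp.toLp 2 v : EuclideanSpace ℝ (Fin d))‖ ≤ ‖z‖ := by
  rw [EuclideanSpace.norm_eq, EuclideanSpace.norm_eq]
  refine Real.sqrt_le_sqrt (Finset.sum_le_sum fun j _ => ?_)
  exact pow_le_pow_left₀ (norm_nonneg _) (h j) 2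

lemma norm_gradSqrtDensity_le (ψ : H1 d) (φ : Space d → ℂ) (x : Space d) :
    ‖gradSqrtDensity ψ φ x‖ ≤ ‖polarGrad ψ φ x‖ :=
  norm_toLp_le_of_abs_le fun _ => Complex.abs_re_le_norm _

lemma norm_hydroLambda_le (ψ : H1 d) (φ : Space d → ℂ) (x : Space d) :
    ‖hydroLambda ψ φ x‖ ≤ ‖polarGrad ψ φ x‖ :=
  norm_toLp_le_of_abs_le fun _ => Complex.abs_im_le_norm _

lemma norm_gradSqrtDensity_sub_le (ψ ψ' : H1 d) (φ φ' : Space d → ℂ) (x : Space d) :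
    ‖(gradSqrtDensity ψ φ - gradSqrtDensity ψ' φ') x‖
      ≤ ‖(polarGrad ψ φ - polarGrad ψ' φ') x‖ := by
  have e : (gradSqrtDensity ψ φ - gradSqrtDensity ψ' φ') x
      = WithLp.toLp 2 fun j => ((polarGrad ψ φ - polarGrad ψ' φ') x j).re := by
    ext j
    simp only [gradSqrtDensity, polarGrad, Pi.sub_apply, PiLp.sub_apply, PiLp.smul_apply,
      smul_eq_mul, Complex.sub_re]
  rw [e]
  exact norm_toLp_le_of_abs_le fun _ => Complex.abs_re_le_norm _

lemma norm_hydroLambda_sub_le (ψ ψ' : H1 d) (φ φ' : Space d → ℂ) (x : Space d) :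
    ‖(hydroLambda ψ φ - hydroLambda ψ' φ') x‖ ≤ ‖(polarGrad ψ φ - polarGrad ψ' φ') x‖ := by
  have e : (hydroLambda ψ φ - hydroLambda ψ' φ') x
      = WithLp.toLp 2 fun j => ((polarGrad ψ φ - polarGrad ψ' φ') x j).im := by
    ext j
    simp only [hydroLambda, polarGrad, Pi.sub_apply, PiLp.sub_apply, PiLp.smul_apply,
      smul_eq_mul, Complex.sub_im]
  rw [e]
  exact norm_toLp_le_of_abs_le fun _ => Complex.abs_im_le_norm _

lemma eLpNorm_polarGrad_le {ψ : H1 d} {φ : Space d → ℂ} (h : IsPolarFactor ψ φ) :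
    eLpNorm (polarGrad ψ φ) 2 volume ≤ ENNReal.ofReal ‖ψ‖ := by
  refine (eLpNorm_mono_ae (norm_polarGrad_le h)).trans ?_
  rw [eLpNorm_coe_eq]
  exact ENNReal.ofReal_le_ofReal (norm_grad_le ψ)

/-- The chain rule `∇√ρ = Re(conj(φ) ∇ψ)` for every polar factor `φ` of `ψ`. -/
theorem IsPolarFactor.hasL2WeakGradient {ψ : H1 d} {φ : Space d → ℂ} (h : IsPolarFactor ψ φ) :
    HasL2WeakGradient (sqrtDensity ψ) (gradSqrtDensity ψ φ) := by
  have hs : sqrtDensity ψ = fun x => ‖toL2 ψ x‖ := funext (sqrtDensity_eq_norm ψ)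
  have hmeas : AEStronglyMeasurable (gradSqrtDensity ψ φ) volume := by
    have h1 : AEStronglyMeasurable (polarGrad ψ φ) volume :=
      (RCLike.continuous_conj.comp_aestronglyMeasurable h.aestronglyMeasurable).smul
        (Lp.aestronglyMeasurable (grad ψ))
    have h2 : Continuous fun z : EuclideanSpace ℂ (Fin d) =>
        (WithLp.toLp 2 fun j => (z j).re : EuclideanSpace ℝ (Fin d)) := by fun_prop
    exact h2.comp_aestronglyMeasurable h1
  have hL2 : MemLp (gradSqrtDensity ψ φ) 2 volume := by
    refine (Lp.memLp (grad ψ)).of_le hmeas ?_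
    filter_upwards [norm_polarGrad_le h] with x hx
    exact (norm_gradSqrtDensity_le ψ φ x).trans hx
  refine ⟨⟨?_, hL2.locallyIntegrable one_le_two, fun η hη hc j => ?_⟩, hL2⟩
  · rw [hs]
    exact fun x => (locallyIntegrable_Lp (toL2 ψ) x).norm
  · have h1 := (isWeakDeriv_gradComp ψ j).norm h.eq_norm_mul η hη hc
    have h2 : ∫ x, η x • (((conj (φ x) * gradComp ψ j x).re : ℝ) : ℂ)
        = ((∫ x, η x • gradSqrtDensity ψ φ x j : ℝ) : ℂ) := by
      rw [← integral_complex_ofReal]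
      refine integral_congr_ae ?_
      filter_upwards [coeFn_gradComp ψ j] with x hx
      rw [hx, gradSqrtDensity, Complex.real_smul, smul_eq_mul, Complex.ofReal_mul]
    have h3 : ∫ x, (fderiv ℝ η x (EuclideanSpace.single j 1)) • ((‖toL2 ψ x‖ : ℝ) : ℂ)
        = ((∫ x, (fderiv ℝ η x (EuclideanSpace.single j 1)) • sqrtDensity ψ x : ℝ) : ℂ) := by
      rw [← integral_complex_ofReal]
      refine integral_congr_ae (ae_of_all _ fun x => ?_)
      simp only [sqrtDensity_eq_norm, Complex.real_smul, smul_eq_mul, Complex.ofReal_mul]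
    rw [h2, h3] at h1
    exact_mod_cast h1

end Hydrodynamic

end SchrodingerLohe

open SchrodingerLohe in
theorem mainTheorem3 (d : ℕ) (K : ℝ) (hK : 0 < K)
    (V : SchrodingerLohe.Space d → ℝ) (hV : SchrodingerLohe.HasEnergySpaceH1 V)
    (ψ₁₀ ψ₂₀ : SchrodingerLohe.H1 d)
    (hnorm₁ : ‖(SchrodingerLohe.toL2 ψ₁₀)‖ = 1) (hnorm₂ : ‖(SchrodingerLohe.toL2 ψ₂₀)‖ = 1)
    (hne : inner ℂ (SchrodingerLohe.toL2 ψ₁₀) (SchrodingerLohe.toL2 ψ₂₀) ≠ -1)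
    (ψ₁ ψ₂ : ℝ → SchrodingerLohe.H1 d) (hψ : SchrodingerLohe.IsLoheSolution K V ψ₁ ψ₂)
    (hinit₁ : ψ₁ 0 = ψ₁₀) (hinit₂ : ψ₂ 0 = ψ₂₀)
    (φ₁ φ₂ φd : ℝ → SchrodingerLohe.Space d → ℂ)
    (hφ₁ : ∀ t, 0 ≤ t → SchrodingerLohe.IsPolarFactor (ψ₁ t) (φ₁ t))
    (hφ₂ : ∀ t, 0 ≤ t → SchrodingerLohe.IsPolarFactor (ψ₂ t) (φ₂ t))
    (hφd : ∀ t, 0 ≤ t → SchrodingerLohe.IsPolarFactor (ψ₁ t - ψ₂ t) (φd t)) :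
    ∃ G₁ G₂ Gd : ℝ → SchrodingerLohe.Space d → EuclideanSpace ℝ (Fin d),
      (∀ t, 0 ≤ t →
        SchrodingerLohe.HasL2WeakGradient (SchrodingerLohe.sqrtDensity (ψ₁ t)) (G₁ t) ∧
        SchrodingerLohe.HasL2WeakGradient (SchrodingerLohe.sqrtDensity (ψ₂ t)) (G₂ t) ∧
        SchrodingerLohe.HasL2WeakGradient (SchrodingerLohe.sqrtDensity (ψ₁ t - ψ₂ t)) (Gd t)) ∧
      Tendsto (fun t => eLpNorm (Gd t) 2 volume
          + eLpNorm (SchrodingerLohe.hydroLambda (ψ₁ t - ψ₂ t) (φd t)) 2 volume)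
        atTop (𝓝 0) ∧
      Tendsto (fun t => eLpNorm (G₁ t - G₂ t) 2 volume
          + eLpNorm (SchrodingerLohe.hydroLambda (ψ₁ t) (φ₁ t)
              - SchrodingerLohe.hydroLambda (ψ₂ t) (φ₂ t)) 2 volume)
        atTop (𝓝 0) := by
  have h₁ : ‖toL2 (ψ₁ 0)‖ = 1 := hinit₁ ▸ hnorm₁
  have h₂ : ‖toL2 (ψ₂ 0)‖ = 1 := hinit₂ ▸ hnorm₂
  have hne' : inner ℂ (toL2 (ψ₁ 0)) (toL2 (ψ₂ 0)) ≠ -1 := by rwa [hinit₁, hinit₂]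
  obtain ⟨hb, M, hM, hy⟩ := hψ.synchronization hK hV h₁ h₂ hne'
  have hpos : ∀ᶠ t : ℝ in atTop, 0 ≤ t := eventually_ge_atTop 0
  refine ⟨fun t => gradSqrtDensity (ψ₁ t) (φ₁ t), fun t => gradSqrtDensity (ψ₂ t) (φ₂ t),
    fun t => gradSqrtDensity (ψ₁ t - ψ₂ t) (φd t),
    fun t ht => ⟨(hφ₁ t ht).hasL2WeakGradient, (hφ₂ t ht).hasL2WeakGradient,
      (hφd t ht).hasL2WeakGradient⟩, ?_, ?_⟩
  · have hlim : Tendsto (fun t => ENNReal.ofReal ‖ψ₁ t - ψ₂ t‖) atTop (𝓝 0) := by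
      simpa using ENNReal.tendsto_ofReal hb.norm
    have hlim2 := hlim.add hlim
    rw [add_zero] at hlim2
    refine tendsto_of_tendsto_of_tendsto_of_le_of_le' tendsto_const_nhds hlim2
      (Eventually.of_forall fun _ => zero_le) ?_
    filter_upwards [hpos] with t ht
    have hle := eLpNorm_polarGrad_le (hφd t ht)
    exact add_le_add ((eLpNorm_mono (norm_gradSqrtDensity_le _ _)).trans hle)
      ((eLpNorm_mono (norm_hydroLambda_le _ _)).trans hle)
  · -- `ψ₁` is regarded as the perturbation of `ψ₂` by `ψ₁ - ψ₂`
    have hlim := tendsto_eLpNorm_polarGrad_sub hV (a := ψ₂) (b := fun t => ψ₁ t - ψ₂ t)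
      (φ₁ := φ₁) (φ₂ := φ₂) (hpos.mono hM) hb hy
      (hpos.mono fun t ht => by rw [add_sub_cancel]; exact hφ₁ t ht) (hpos.mono hφ₂)
    simp only [add_sub_cancel] at hlim
    have hlim2 := hlim.add hlim
    rw [add_zero] at hlim2
    exact tendsto_of_tendsto_of_tendsto_of_le_of_le tendsto_const_nhds hlim2 (fun _ => zero_le)
      fun t => add_le_add (eLpNorm_mono (norm_gradSqrtDensity_sub_le _ _ _ _))
        (eLpNorm_mono (norm_hydroLambda_sub_le _ _ _ _))
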